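/- Let $\Gamma=\mathbb{Z}^2\rtimes\mathcal{C}_s$ be the wallpaper group generated by the translations by $(1,0)$ and $(0,1)$ and the reflection $s$ in the $x$-axis; an element of $\Gamma$ is a translation exactly when its linear component (its image in $\mathcal{C}_s$) is trivial. A $\Gamma$-gain graph $(G,m)$ is a finite multigraph $G=(V,E)$ (loops and parallel edges allowed) whose edges are directed and labelled by elements of $\Gamma$; an edge from $u$ to $v$ with gain $g$ is written $(u,v;g)$ and is identified with $(v,u;g^{-1})$. Loops have non-identity gain, and no two distinct edges are equal as gained edges (parallel edges with the same direction have different gains). A switching operation at $v\in V$ by $\gamma\in\Gamma$ replaces the gain of a loop at $v$ by $\gamma g\gamma^{-1}$, of a non-loop edge directed from $v$ by $\gamma g$, of a non-loop edge directed to $v$ by $g\gamma^{-1}$, and leaves all other gains unchanged. Gain graphs are regarded as equivalent if they differ by a sequence of switching operations. The net gain of a walk is the product of the gains of its edges in order, inverted for edges traversed backwards. A gain graph is purely periodic if, for each of its vertices $v$, the subgroup generated by the net gains of the closed walks at $v$ consists of translations. A multigraph is $(k,l)$-sparse if $|E'|\le k|V'|-l$ for every subgraph $(V',E')$ with $E'\neq\emptyset$,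 and $(k,l)$-tight if moreover $|E|=k|V|-l$. A $\Gamma$-gain graph $(G,m)$ is $(\mathbb{Z}^2\rtimes\mathcal{C}_s)_q$-tight if $G$ is $(2,1)$-tight and every purely periodic subgraph is $(2,2)$-sparse. The following moves produce a new gain graph from a gain graph $(G,m)$; $v_0,w_2,w_3,w_4$ denote new vertices. 1. Gained $0$-extension: add $v_0$ with two distinct edges $(v_0,v_1;g_1)$, $(v_0,v_2;g_2)$, where $v_1,v_2\in V$ may coincide. 2. Gained $1$-extension: remove an edge $(v_1,v_2;g)$ and add $v_0$ with three distinct edges $(v_0,v_1;g_1)$, $(v_0,v_2;g_2)$, $(v_0,v_3;g_3)$, where $v_3\in V$ and $g_1^{-1}g_2=g$; the vertices $v_1,v_2,v_3$ need not be distinct. 3. Gained loop-$1$-extension: add $v_0$ with a loop $(v_0,v_0;h)$, where $h$ has non-trivial linear component, and an edge $(v_0,v_1;g)$ with $v_1\in V$. 4. Gained edge-to-$K_3$ move: choose an edge $e=(v_1,v_2;g)$ with $v_1\neq v_2$ and add $v_0$ with edges $(v_0,v_1;g_1)$, $(v_0,v_2;g_2)$, where $g_1^{-1}g_2=g$; every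 edge $(v_1,w;k)$ other than $e$ (possibly $w=v_1$) is either left unchanged or replaced by $(v_0,w;g_1k)$. 5. Gained vertex-to-$K_4$ move: replace a vertex $v_1$ by a copy of $K_4$ on $v_1,w_2,w_3,w_4$ in which all edges have identity gain; every edge $(v_1,w;k)$ of $G$ (possibly $w=v_1$) is either left unchanged or replaced by $(y,w;k)$ for some $y\in\{w_2,w_3,w_4\}$, which may depend on the edge. Theorem. A $\mathbb{Z}^2\rtimes\mathcal{C}_s$-gain graph is $(\mathbb{Z}^2\rtimes\mathcal{C}_s)_q$-tight if and only if it can be constructed from a $(\mathbb{Z}^2\rtimes\mathcal{C}_s)_q$-tight gain graph on $K_1^1$ (one vertex with one loop) by a finite sequence of gained $0$-extensions, $1$-extensions, loop-$1$-extensions, edge-to-$K_3$ moves and vertex-to-$K_4$ moves, where gain graphs are taken up to equivalence, that is, switching operations may be applied at any stage. -/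

import Mathlib

universe u w

/-! ### The group `ℤ² ⋊ C_s` -/

/-- The reflection group `C_s`, written as `{1, -1}`: the element `-1` is the reflection `s` in the
`x`-axis.  Its action on the lattice of translations is `s • (a, b) = (a, -b)`. -/
def reflectionAction : ℤˣ →* MulAut (Multiplicative (ℤ × ℤ)) where
  toFun σ := AddEquiv.toMultiplicative
    (AddEquiv.prodCongr (AddEquiv.refl ℤ) (DistribMulAction.toAddEquiv ℤ σ))
  map_one' := by
    ext x
    · rfl
    · exact one_smul ℤˣ (Multiplicative.toAdd x).2
  map_mul' σ τ := by
    ext x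
    · rfl
    · exact mul_smul σ τ (Multiplicative.toAdd x).2

/-- The wallpaper group `ℤ² ⋊ C_s` generated by the unit translations and the reflection in the
`x`-axis: `(t, σ)` is the isometry `p ↦ σ p + t`. -/
abbrev ZReflective : Type := Multiplicative (ℤ × ℤ) ⋊[reflectionAction] ℤˣ

/-- The subgroup of translations: the elements with trivial linear component. -/
def translations : Subgroup ZReflective :=
  (SemidirectProduct.rightHom : ZReflective →* ℤˣ).ker

/-! ### Gain graphs -/

/-- A triple `(u, v, g)` is an edge directed from `u` to `v` with gain `g`.  Reversing the
direction and inverting the gain describes the same edge. -/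
def gainedEdgeSetoid (α : Type u) (Γ : Type w) [Group Γ] : Setoid (α × α × Γ) where
  r x y := x = y ∨ x = (y.2.1, y.1, y.2.2⁻¹)
  iseqv :=
    { refl := fun _ => Or.inl rfl
      symm := by
        rintro ⟨a, b, g⟩ ⟨c, d, h⟩ (h | h) <;> simp_all
      trans := by
        rintro ⟨a, b, g⟩ ⟨c, d, h⟩ ⟨e, f, k⟩ (h1 | h1) (h2 | h2) <;> simp_all }

/-- Gained edges between elements of `α`, up to reversal. -/
def GainedEdge (α : Type u) (Γ : Type w) [Group Γ] : Type (max u w) :=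
  Quotient (gainedEdgeSetoid α Γ)

/-- The gained edge `(u, v; g)`; note `gedge u v g = gedge v u g⁻¹`. -/
def gedge {α : Type u} {Γ : Type w} [Group Γ] (u v : α) (g : Γ) : GainedEdge α Γ :=
  Quotient.mk (gainedEdgeSetoid α Γ) (u, v, g)

theorem gedge_eq_iff {α : Type u} {Γ : Type w} [Group Γ] {a b c d : α} {g h : Γ} :
    gedge a b g = gedge c d h ↔ (a = c ∧ b = d ∧ g = h) ∨ (a = d ∧ b = c ∧ g = h⁻¹) := by
  have key : gedge a b g = gedge c d h ↔ ((a, b, g) = (c, d, h) ∨ (a, b, g) = (d, c, h⁻¹)) :=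
    ⟨fun H => Quotient.exact (s := gainedEdgeSetoid α Γ) H,
      fun H => Quotient.sound (s := gainedEdgeSetoid α Γ) H⟩
  rw [key]
  simp

/-- A finite `Γ`-gain graph with vertices taken from `α`.  The underlying multigraph may have
parallel edges and loops.  As parallel edges carry different gains (when they are given the same
direction), an edge is determined by its ends and its gain, so that the edges form a set of gained
edges.  Loops have non-identity gain. -/
structure GainGraph (α : Type u) (Γ : Type w) [Group Γ] where
  verts : Set α
  edges : Set (GainedEdge α Γ)
  verts_finite : verts.Finite
  edges_finite : edges.Finite
  ends_mem : ∀ u v g, gedge u v g ∈ edges → u ∈ verts ∧ v ∈ verts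
  loop_gain_ne_one : ∀ v g, gedge v v g ∈ edges → g ≠ 1

namespace GainGraph

section General

variable {α : Type u} {Γ : Type w} [Group Γ]

/-- `H` is a subgraph of `G` (with the restricted gains). -/
def IsSubgraph (H G : GainGraph α Γ) : Prop :=
  H.verts ⊆ G.verts ∧ H.edges ⊆ G.edges

/-- `(k, l)`-sparsity: `|E'| ≤ k |V'| - l` for all subgraphs with at least one edge. -/
def Sparse (k l : ℕ) (G : GainGraph α Γ) : Prop :=
  ∀ H : GainGraph α Γ, H.IsSubgraph G → H.edges.Nonempty →
    (H.edges.ncard : ℤ) ≤ k * H.verts.ncard - l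

/-- `(k, l)`-tightness: `(k, l)`-sparse with `|E| = k |V| - l`. -/
def Tight (k l : ℕ) (G : GainGraph α Γ) : Prop :=
  G.Sparse k l ∧ (G.edges.ncard : ℤ) = k * G.verts.ncard - l

/-- `G.WalkGain u v g`: there is a walk in `G` from `u` to `v` with net gain `g`.  An edge
`(u, v; g)` contributes `g` when traversed forwards and `g⁻¹` when traversed backwards. -/
inductive WalkGain (G : GainGraph α Γ) : α → α → Γ → Prop
  | nil {v : α} (hv : v ∈ G.verts) : WalkGain G v v 1
  | cons {a b c : α} {g h : Γ} (he : gedge a b g ∈ G.edges) (hw : WalkGain G b c h) :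
      WalkGain G a c (g * h)

/-- The gain space at `v`: the subgroup generated by the net gains of the closed walks at `v`. -/
def gainSpace (G : GainGraph α Γ) (v : α) : Subgroup Γ :=
  Subgroup.closure {g | G.WalkGain v v g}

/-- `G` is a gain graph on `K_1^1`: one vertex with one loop. -/
def IsSingleLoop (G : GainGraph α Γ) : Prop :=
  ∃ (v : α) (g : Γ), G.verts = {v} ∧ G.edges = {gedge v v g}

open Classical in
/-- `G'` arises from `G` by switching at the vertex `v` by `γ`: an edge `(a, b; g)` becomes
`(a, b; σ(a) g σ(b)⁻¹)`, where `σ(v) = γ` and `σ` is the identity elsewhere. -/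
def Switching (G G' : GainGraph α Γ) : Prop :=
  ∃ v ∈ G.verts, ∃ γ : Γ, G'.verts = G.verts ∧
    ∀ (a b : α) (g : Γ),
      gedge a b ((if a = v then γ else 1) * g * (if b = v then γ else 1)⁻¹) ∈ G'.edges ↔
        gedge a b g ∈ G.edges

/-- Gained 0-extension: a new vertex `v₀` with two edges `(v₀, v₁; g₁)`, `(v₀, v₂; g₂)`; the ends
`v₁`, `v₂` may coincide. -/
def ZeroExtension (G G' : GainGraph α Γ) : Prop :=
  ∃ (v₀ v₁ v₂ : α) (g₁ g₂ : Γ),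
    v₀ ∉ G.verts ∧ v₁ ∈ G.verts ∧ v₂ ∈ G.verts ∧
    gedge v₀ v₁ g₁ ≠ gedge v₀ v₂ g₂ ∧
    G'.verts = insert v₀ G.verts ∧
    G'.edges = G.edges ∪ {gedge v₀ v₁ g₁, gedge v₀ v₂ g₂}

/-- Gained 1-extension: an edge `(v₁, v₂; g)` is removed and a new vertex `v₀` is added with three
edges `(v₀, vᵢ; gᵢ)`, where `g₁⁻¹ g₂ = g`; the vertices `v₁`, `v₂`, `v₃` need not be distinct. -/
def OneExtension (G G' : GainGraph α Γ) : Prop :=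
  ∃ (v₀ v₁ v₂ v₃ : α) (g g₁ g₂ g₃ : Γ),
    v₀ ∉ G.verts ∧ v₃ ∈ G.verts ∧ gedge v₁ v₂ g ∈ G.edges ∧ g₁⁻¹ * g₂ = g ∧
    gedge v₀ v₁ g₁ ≠ gedge v₀ v₂ g₂ ∧ gedge v₀ v₁ g₁ ≠ gedge v₀ v₃ g₃ ∧
    gedge v₀ v₂ g₂ ≠ gedge v₀ v₃ g₃ ∧
    G'.verts = insert v₀ G.verts ∧
    G'.edges = (G.edges \ {gedge v₁ v₂ g}) ∪ {gedge v₀ v₁ g₁, gedge v₀ v₂ g₂, gedge v₀ v₃ g₃}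

/-- Gained edge-to-`K_3` move (vertex splitting) at the edge `e = (v₁, v₂; g)`: a new vertex `v₀`
with edges `(v₀, v₁; g₁)` and `(v₀, v₂; g₂)`, where `g₁⁻¹ g₂ = g`, is added.  Every other edge
`(v₁, x; k)` (possibly a loop) is either kept or replaced by `(v₀, x; g₁ k)`; for `g₁ = 1`, which
can be reached by switching at `v₀`, this is `(v₀, x; k)`.  The edges other than `e` are
transformed by `f`. -/
def EdgeToK3 (G G' : GainGraph α Γ) : Prop :=
  ∃ (v₀ v₁ v₂ : α) (g g₁ g₂ : Γ) (f : GainedEdge α Γ → GainedEdge α Γ),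
    v₀ ∉ G.verts ∧ v₁ ≠ v₂ ∧ gedge v₁ v₂ g ∈ G.edges ∧ g₁⁻¹ * g₂ = g ∧
    (∀ e ∈ G.edges \ {gedge v₁ v₂ g},
      f e = e ∨ ∃ (x : α) (k : Γ), e = gedge v₁ x k ∧ f e = gedge v₀ x (g₁ * k)) ∧
    G'.verts = insert v₀ G.verts ∧
    G'.edges = f '' (G.edges \ {gedge v₁ v₂ g}) ∪
      {gedge v₁ v₂ g, gedge v₀ v₁ g₁, gedge v₀ v₂ g₂}

/-- Gained vertex-to-`K_4` move at the vertex `v₁`: the vertex becomes part of a `K_4` on `v₁` and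
three new vertices `w₂`, `w₃`, `w₄`, all of whose edges have identity gain.  Every edge
`(v₁, x; k)` of `G` (possibly a loop) is either kept or replaced by `(y, x; k)` for another vertex
`y` of this `K_4`.  The edges of `G` are transformed by `f`. -/
def VertexToK4 (G G' : GainGraph α Γ) : Prop :=
  ∃ (v₁ w₂ w₃ w₄ : α) (f : GainedEdge α Γ → GainedEdge α Γ),
    v₁ ∈ G.verts ∧ w₂ ∉ G.verts ∧ w₃ ∉ G.verts ∧ w₄ ∉ G.verts ∧
    w₂ ≠ w₃ ∧ w₂ ≠ w₄ ∧ w₃ ≠ w₄ ∧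
    (∀ e ∈ G.edges,
      f e = e ∨ ∃ (x : α) (k : Γ) (y : α),
        e = gedge v₁ x k ∧ y ∈ ({w₂, w₃, w₄} : Set α) ∧ f e = gedge y x k) ∧
    G'.verts = G.verts ∪ {w₂, w₃, w₄} ∧
    G'.edges = f '' G.edges ∪
      {gedge v₁ w₂ 1, gedge v₁ w₃ 1, gedge v₁ w₄ 1,
        gedge w₂ w₃ 1, gedge w₂ w₄ 1, gedge w₃ w₄ 1}

end General

section ZReflective

variable {α : Type u}

/-- Every gain space consists of translations only. -/
def PurelyPeriodic (G : GainGraph α ZReflective) : Prop :=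
  ∀ v ∈ G.verts, G.gainSpace v ≤ translations

/-- `(ℤ² ⋊ C_s)_q`-tightness. -/
def ZReflectiveTight (G : GainGraph α ZReflective) : Prop :=
  G.Tight 2 1 ∧
    ∀ H : GainGraph α ZReflective, H.IsSubgraph G → H.PurelyPeriodic → H.Sparse 2 2

/-- Gained loop-1-extension: a new vertex `v₀` with a loop whose gain `l` has a non-trivial linear
component, and an edge `(v₀, v₁; g)`. -/
def LoopOneExtension (G G' : GainGraph α ZReflective) : Prop :=
  ∃ (v₀ v₁ : α) (l g : ZReflective),
    v₀ ∉ G.verts ∧ v₁ ∈ G.verts ∧ l.right ≠ 1 ∧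
    G'.verts = insert v₀ G.verts ∧
    G'.edges = G.edges ∪ {gedge v₀ v₀ l, gedge v₀ v₁ g}

/-- One step of a construction.  Gain graphs that differ by switching operations are equivalent,
so a switching operation is allowed as a step. -/
def Step (G G' : GainGraph α ZReflective) : Prop :=
  ZeroExtension G G' ∨ OneExtension G G' ∨ LoopOneExtension G G' ∨ EdgeToK3 G G' ∨
    VertexToK4 G G' ∨ Switching G G'

/-- `G` can be constructed from a tight gain graph on `K_1^1` by a finite sequence of steps. -/
def Constructible (G : GainGraph α ZReflective) : Prop :=
  ∃ G₀ : GainGraph α ZReflective, G₀.IsSingleLoop ∧ G₀.ZReflectiveTight ∧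
    Relation.ReflTransGen Step G₀ G

end ZReflective

end GainGraph

/-! Tightness sees a gain only through its linear part, a sign in {1, -1}. A gain graph is purely
periodic exactly when there is a potential φ on the vertices with sign(g) = φ(u) φ(v) for every edge
(u, v; g). With the surplus 2|V| - |E|, tightness therefore becomes `SignTight`: the whole graph has
surplus 1, nonempty subgraphs have surplus at least 1, and those carrying a compatible potential
have surplus at least 2. Surplus is modular under union and intersection, so subgraphs can be
uncrossed. Potentials can be glued across an intersection of surplus at most 2 (`SignTight.glue`).

Each move preserves `SignTight`: a subgraph of the new graph is carried back to one of the old graph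
with no larger surplus, and its potential is carried along. Where the potential cannot be carried
along (the two splitting moves), the count has slack to compensate.

For the converse, induct on the number of vertices. Since |E| = 2|V| - 1, some vertex v has degree
at most 3, loops counted twice, and sparsity of the rest gives it at least two incident edges. Two
edges undo a 0-extension or a loop-1-extension. With three non-loop edges to a, b, c there are three
candidate edges joining neighbours with the gain of the path through v. A candidate undoes a
1-extension unless it is already present or is blocked by a subgraph that is too dense. Uncrossing
shows that two candidates are never both blocked (`IsClaw.not_blocked_and_blocked`), and that none
is blocked when the other two are present (`IsClaw.not_blocked_of_mem`). So if no reduction of this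
kind exists, all three are present and v lies in a K_4 which becomes gain-free after switching.

In that case, among all switchings take a largest graph built from a gain-free K_4 by repeatedly
attaching a vertex to both ends of an edge (`TriangleSeq`); such graphs have surplus exactly 2 and
constant potential. If it is only the K_4, maximality makes contracting the K_4 legitimate
(`SignTight.exists_vertexToK4`). Otherwise an edge at the last attached vertex can be contracted
(`SignTight.exists_edgeToK3`); the rest of the sequence supplies the extra unit of surplus needed by
subgraphs missing the third vertex of the triangle. -/

/-! ### Ends of gained edges and sign potentials -/

namespace GainedEdge

variable {α : Type*} {Γ : Type*} [Group Γ]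

/-- The set of ends of a gained edge. -/
def supp : GainedEdge α Γ → Set α :=
  Quotient.lift (s := gainedEdgeSetoid α Γ) (fun x => {x.1, x.2.1}) (by
    rintro ⟨a, b, g⟩ ⟨c, d, h⟩ (h | h) <;> simp_all [Set.pair_comm])

@[simp] theorem supp_gedge (u v : α) (g : Γ) : (gedge u v g).supp = {u, v} := rfl

theorem exists_eq_gedge (e : GainedEdge α Γ) : ∃ u v g, e = gedge u v g := by
  induction e using Quotient.ind with
  | _ x => exact ⟨x.1, x.2.1, x.2.2, rfl⟩

theorem exists_eq_gedge_of_mem {e : GainedEdge α Γ} {v : α} (hv : v ∈ e.supp) :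
    ∃ x g, e = gedge v x g := by
  obtain ⟨a, b, g, rfl⟩ := e.exists_eq_gedge
  rcases hv with rfl | rfl
  · exact ⟨b, g, rfl⟩
  · exact ⟨a, g⁻¹, by simp [gedge_eq_iff]⟩

/-- A sign potential `φ` is compatible with an edge `(u, v; g)` if `χ g = φ u φ v`. -/
def Compat (χ : Γ →* ℤˣ) (φ : α → ℤˣ) : GainedEdge α Γ → Prop :=
  Quotient.lift (s := gainedEdgeSetoid α Γ) (fun x => χ x.2.2 = φ x.1 * φ x.2.1) (by
    rintro ⟨a, b, g⟩ ⟨c, d, h⟩ (h | h) <;> simp_all [mul_comm])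

@[simp] theorem compat_gedge {χ : Γ →* ℤˣ} {φ : α → ℤˣ} {u v : α} {g : Γ} :
    (gedge u v g).Compat χ φ ↔ χ g = φ u * φ v := Iff.rfl

theorem Compat.congr {χ : Γ →* ℤˣ} {φ ψ : α → ℤˣ} {e : GainedEdge α Γ} (h : e.Compat χ φ)
    (hφ : ∀ x ∈ e.supp, φ x = ψ x) : e.Compat χ ψ := by
  obtain ⟨a, b, g, rfl⟩ := e.exists_eq_gedge
  rw [compat_gedge] at h ⊢
  rw [← hφ a (by simp), ← hφ b (by simp), h]

theorem Compat.const_mul {χ : Γ →* ℤˣ} {φ : α → ℤˣ} {e : GainedEdge α Γ} (h : e.Compat χ φ)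
    (ε : ℤˣ) : e.Compat χ (fun x => ε * φ x) := by
  obtain ⟨a, b, g, rfl⟩ := e.exists_eq_gedge
  rw [compat_gedge] at h ⊢
  rw [h, mul_mul_mul_comm, Int.units_mul_self, one_mul]

end GainedEdge

theorem gedge_symm {α : Type*} {Γ : Type*} [Group Γ] (u v : α) (g : Γ) :
    gedge u v g = gedge v u g⁻¹ := by simp [gedge_eq_iff]

theorem Int.units_eq_mul_iff {a b c : ℤˣ} : a = b * c ↔ a * b = c := by
  constructor
  · rintro rfl
    rw [mul_right_comm, Int.units_mul_self, one_mul]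
  · rintro rfl
    rw [mul_left_comm, Int.units_mul_self, mul_one]

namespace GainGraph

variable {α : Type*} {Γ : Type*} [Group Γ]

/-! ### Subgraphs as pairs of sets, and their surplus -/

/-- The vertex set `V` and the edge set `E` form a subgraph of `G`. -/
structure IsSub (G : GainGraph α Γ) (V : Set α) (E : Set (GainedEdge α Γ)) : Prop where
  verts : V ⊆ G.verts
  edges : E ⊆ G.edges
  supp : ∀ e ∈ E, e.supp ⊆ V

/-- The quantity `2 |V| - |E|`. -/
noncomputable def surplus (V : Set α) (E : Set (GainedEdge α Γ)) : ℤ :=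
  2 * V.ncard - E.ncard

theorem supp_subset_verts (G : GainGraph α Γ) {e : GainedEdge α Γ} (he : e ∈ G.edges) :
    e.supp ⊆ G.verts := by
  obtain ⟨a, b, g, rfl⟩ := e.exists_eq_gedge
  have := G.ends_mem a b g he
  rintro x (rfl | rfl)
  exacts [this.1, this.2]

theorem IsSubgraph.isSub {H G : GainGraph α Γ} (h : H.IsSubgraph G) :
    G.IsSub H.verts H.edges :=
  ⟨h.1, h.2, fun _ => H.supp_subset_verts⟩

namespace IsSub

variable {G : GainGraph α Γ} {V V' : Set α} {E E' : Set (GainedEdge α Γ)}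

theorem finite_verts (h : G.IsSub V E) : V.Finite := G.verts_finite.subset h.verts

theorem finite_edges (h : G.IsSub V E) : E.Finite := G.edges_finite.subset h.edges

theorem mem_of_gedge (h : G.IsSub V E) {u v : α} {g : Γ} (he : gedge u v g ∈ E) :
    u ∈ V ∧ v ∈ V :=
  ⟨h.supp _ he (by simp), h.supp _ he (by simp)⟩

theorem union (h : G.IsSub V E) (h' : G.IsSub V' E') : G.IsSub (V ∪ V') (E ∪ E') :=
  ⟨Set.union_subset h.verts h'.verts, Set.union_subset h.edges h'.edges, by
    rintro e (he | he)
    · exact (h.supp e he).trans Set.subset_union_left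
    · exact (h'.supp e he).trans Set.subset_union_right⟩

theorem inter (h : G.IsSub V E) (h' : G.IsSub V' E') : G.IsSub (V ∩ V') (E ∩ E') :=
  ⟨Set.inter_subset_left.trans h.verts, Set.inter_subset_left.trans h.edges, fun e he =>
    Set.subset_inter (h.supp e he.1) (h'.supp e he.2)⟩

/-- Surplus is modular because vertex sets and edge sets are united and intersected separately. All
uncrossing arguments rest on this identity together with the lower bounds in `SignTight`. -/
theorem surplus_union_add_inter (h : G.IsSub V E) (h' : G.IsSub V' E') :
    surplus (V ∪ V') (E ∪ E') + surplus (V ∩ V') (E ∩ E') = surplus V E + surplus V' E' := by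
  have h1 := Set.ncard_union_add_ncard_inter V V' h.finite_verts h'.finite_verts
  have h2 := Set.ncard_union_add_ncard_inter E E' h.finite_edges h'.finite_edges
  simp only [surplus]
  omega

theorem insert_edge (h : G.IsSub V E) {u v : α} {g : Γ} (he : gedge u v g ∈ G.edges)
    (hu : u ∈ V) (hv : v ∈ V) : G.IsSub V (insert (gedge u v g) E) :=
  ⟨h.verts, Set.insert_subset he h.edges, by
    rintro e (rfl | he)
    · rintro x (rfl | rfl) <;> assumption
    · exact h.supp e he⟩

theorem surplus_insert_edge (h : G.IsSub V E) {e : GainedEdge α Γ} (he : e ∉ E) :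
    surplus V (insert e E) = surplus V E - 1 := by
  simp only [surplus, Set.ncard_insert_of_notMem he h.finite_edges]
  push_cast
  ring

theorem insert_vertex (h : G.IsSub V E) {v : α} (hv : v ∈ G.verts) : G.IsSub (insert v V) E :=
  ⟨Set.insert_subset hv h.verts, h.edges, fun e he => (h.supp e he).trans (Set.subset_insert _ _)⟩

theorem surplus_insert_vertex (h : G.IsSub V E) {v : α} (hv : v ∉ V) :
    surplus (insert v V) E = surplus V E + 2 := by
  simp only [surplus, Set.ncard_insert_of_notMem hv h.finite_verts]
  push_cast
  ring

theorem notMem_edges (h : G.IsSub V E) {u v : α} {g : Γ} (hu : u ∉ V) : gedge u v g ∉ E :=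
  fun he => hu (h.mem_of_gedge he).1

/-- The gain graph carried by a subgraph. -/
def toGainGraph (h : G.IsSub V E) : GainGraph α Γ where
  verts := V
  edges := E
  verts_finite := h.finite_verts
  edges_finite := h.finite_edges
  ends_mem _ _ _ he := h.mem_of_gedge he
  loop_gain_ne_one v g he := G.loop_gain_ne_one v g (h.edges he)

end IsSub

/-! ### Tightness in terms of sign potentials -/

/-- The surplus condition: the surplus of `G` is `1`, that of nonempty subgraphs is at least `1`,
and at least `2` if there is a compatible sign potential. -/
structure SignTight (χ : Γ →* ℤˣ) (G : GainGraph α Γ) : Prop where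
  total : surplus G.verts G.edges = 1
  one_le : ∀ V E, G.IsSub V E → V.Nonempty → 1 ≤ surplus V E
  two_le : ∀ V E φ, G.IsSub V E → V.Nonempty → (∀ e ∈ E, e.Compat χ φ) → 2 ≤ surplus V E

/-! ### Closed walks and sign potentials -/

namespace WalkGain

variable {G : GainGraph α Γ}

theorem mem_left {u v : α} {g : Γ} (h : G.WalkGain u v g) : u ∈ G.verts := by
  cases h with
  | nil hv => exact hv
  | cons he _ => exact (G.ends_mem _ _ _ he).1

theorem append {u v w : α} {g h : Γ} (h₁ : G.WalkGain u v g) (h₂ : G.WalkGain v w h) :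
    G.WalkGain u w (g * h) := by
  induction h₁ with
  | nil hv => simpa using h₂
  | cons he _ ih => rw [mul_assoc]; exact .cons he (ih h₂)

theorem of_edge {u v : α} {g : Γ} (h : gedge u v g ∈ G.edges) : G.WalkGain u v g := by
  simpa using WalkGain.cons h (.nil (G.ends_mem _ _ _ h).2)

theorem reverse {u v : α} {g : Γ} (h : G.WalkGain u v g) : G.WalkGain v u g⁻¹ := by
  induction h with
  | nil hv => simpa using WalkGain.nil hv
  | cons he _ ih =>
    rw [mul_inv_rev]
    exact ih.append (of_edge (by rwa [gedge_symm] at he))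

theorem map_eq {χ : Γ →* ℤˣ} {φ : α → ℤˣ} (hφ : ∀ e ∈ G.edges, e.Compat χ φ) {u v : α} {g : Γ}
    (h : G.WalkGain u v g) : χ g = φ u * φ v := by
  induction h with
  | nil hv => simp
  | cons he _ ih =>
    have := GainedEdge.compat_gedge.1 (hφ _ he)
    rw [map_mul, ih, this, mul_assoc, ← mul_assoc (φ _) (φ _) (φ _), Int.units_mul_self, one_mul]

end WalkGain

/-- If all closed walks have trivial sign, there is a compatible potential. -/
theorem exists_compat {G : GainGraph α Γ} {χ : Γ →* ℤˣ}
    (h : ∀ v g, G.WalkGain v v g → χ g = 1) : ∃ φ : α → ℤˣ, ∀ e ∈ G.edges, e.Compat χ φ := by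
  classical
  -- Connectedness by walks; the alternative `u = v` only serves reflexivity outside the vertex set,
  -- where there are no walks.
  let s : Setoid α :=
    { r := fun u v => u = v ∨ ∃ g, G.WalkGain u v g
      iseqv :=
        { refl := fun _ => Or.inl rfl
          symm := by
            rintro u v (rfl | ⟨g, hg⟩)
            · exact Or.inl rfl
            · exact Or.inr ⟨_, hg.reverse⟩
          trans := by
            rintro u v w (rfl | ⟨g, hg⟩) (rfl | ⟨k, hk⟩)
            · exact Or.inl rfl
            · exact Or.inr ⟨_, hk⟩
            · exact Or.inr ⟨_, hg⟩
            · exact Or.inr ⟨_, hg.append hk⟩ } }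
  let rep : α → α := fun x => (Quotient.mk s x).out
  have hrep : ∀ x ∈ G.verts, ∃ g, G.WalkGain (rep x) x g := by
    intro x hx
    rcases (Quotient.exact (Quotient.out_eq (Quotient.mk s x)) : s.r (rep x) x) with h | h
    · rw [h]; exact ⟨1, .nil hx⟩
    · exact h
  let γ : α → Γ := fun x => if hx : x ∈ G.verts then (hrep x hx).choose else 1
  have hγ : ∀ x ∈ G.verts, G.WalkGain (rep x) x (γ x) := by
    intro x hx
    simp only [γ, dif_pos hx]
    exact (hrep x hx).choose_spec
  refine ⟨fun x => χ (γ x), fun e he => ?_⟩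
  obtain ⟨a, b, g, rfl⟩ := e.exists_eq_gedge
  obtain ⟨ha, hb⟩ := G.ends_mem _ _ _ he
  -- The chosen walks to `a` and `b` start at one common basepoint, so going to `a`, along the edge
  -- and back from `b` closes up.
  have hab : rep a = rep b := by
    have : Quotient.mk s a = Quotient.mk s b :=
      Quotient.sound (s := s) (Or.inr ⟨g, .of_edge he⟩ : s.r a b)
    simp only [rep, this]
  have hb' := hγ b hb
  rw [← hab] at hb'
  have := h _ _ (((hγ a ha).append (.of_edge he)).append hb'.reverse)
  rw [GainedEdge.compat_gedge]
  simp only [map_mul, map_inv, Int.units_inv_eq_self] at this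
  rw [Int.units_eq_mul_iff, mul_comm (χ g)]
  exact (mul_eq_one_iff_eq_inv.1 this).trans (Int.units_inv_eq_self _)

/-- Translations are the kernel of the sign map. Unlike the condition on closed walks, a potential
can be restricted, extended by one vertex and glued. -/
theorem purelyPeriodic_iff {G : GainGraph α ZReflective} :
    G.PurelyPeriodic ↔
      ∃ φ : α → ℤˣ, ∀ e ∈ G.edges, e.Compat SemidirectProduct.rightHom φ := by
  constructor
  · intro h
    refine exists_compat fun v g hg => ?_
    exact h v hg.mem_left (Subgroup.subset_closure hg)
  · rintro ⟨φ, hφ⟩ v -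
    refine (Subgroup.closure_le _).2 fun g hg => ?_
    have : SemidirectProduct.rightHom g = φ v * φ v := hg.map_eq hφ
    rw [Int.units_mul_self] at this
    exact this

theorem zReflectiveTight_iff {G : GainGraph α ZReflective} :
    G.ZReflectiveTight ↔ G.SignTight SemidirectProduct.rightHom := by
  -- `Sparse` ignores edgeless subgraphs while `SignTight` requires only a vertex; an edgeless
  -- subgraph with a vertex meets both bounds anyway.
  have hempty : ∀ {V : Set α} {E : Set (GainedEdge α ZReflective)}, G.IsSub V E → V.Nonempty →
      ¬ E.Nonempty → 2 ≤ surplus V E := by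
    intro V E h hV hE
    have := (Set.ncard_pos h.finite_verts).2 hV
    rw [Set.not_nonempty_iff_eq_empty.1 hE]
    simp only [surplus, Set.ncard_empty]
    omega
  have hne : ∀ {V : Set α} {E : Set (GainedEdge α ZReflective)}, G.IsSub V E → E.Nonempty →
      V.Nonempty := by
    rintro V E h ⟨e, he⟩
    obtain ⟨a, b, g, rfl⟩ := e.exists_eq_gedge
    exact ⟨a, (h.mem_of_gedge he).1⟩
  constructor
  · rintro ⟨⟨h1, h2⟩, h3⟩
    refine ⟨?_, fun V E h hV => ?_, fun V E φ h hV hφ => ?_⟩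
    · simp only [surplus, h2]; push_cast; ring
    · by_cases hE : E.Nonempty
      · have := h1 h.toGainGraph ⟨h.verts, h.edges⟩ hE
        simp only [IsSub.toGainGraph] at this
        simp only [surplus]
        push_cast at this
        linarith
      · linarith [hempty h hV hE]
    · by_cases hE : E.Nonempty
      · have := h3 h.toGainGraph ⟨h.verts, h.edges⟩ (purelyPeriodic_iff.2 ⟨φ, hφ⟩) h.toGainGraph
          ⟨subset_rfl, subset_rfl⟩ hE
        simp only [IsSub.toGainGraph] at this
        simp only [surplus]
        push_cast at this
        linarith
      · exact hempty h hV hE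
  · rintro ⟨h1, h2, h3⟩
    refine ⟨⟨fun H hH hE => ?_, ?_⟩, fun H hH hp H' hH' hE => ?_⟩
    · have := h2 _ _ hH.isSub (hne hH.isSub hE)
      simp only [surplus] at this
      push_cast
      linarith
    · simp only [surplus] at h1
      push_cast
      linarith
    · obtain ⟨φ, hφ⟩ := purelyPeriodic_iff.1 hp
      have hs : G.IsSub H'.verts H'.edges :=
        ⟨hH'.1.trans hH.1, hH'.2.trans hH.2, fun _ => H'.supp_subset_verts⟩
      have := h3 _ _ φ hs (hne hs hE) (fun e he => hφ e (hH'.2 he))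
      simp only [surplus] at this
      push_cast
      linarith

end GainGraph

/-! ### Switching -/

namespace GainedEdge

variable {α : Type*} {Γ : Type*} [Group Γ]

/-- Simultaneous switching of an edge: `(a, b; g)` becomes `(a, b; σ(a) g σ(b)⁻¹)`. -/
def switch (σ : α → Γ) : GainedEdge α Γ → GainedEdge α Γ :=
  Quotient.lift (s := gainedEdgeSetoid α Γ)
    (fun x => gedge x.1 x.2.1 (σ x.1 * x.2.2 * (σ x.2.1)⁻¹)) (by
      rintro ⟨a, b, g⟩ ⟨c, d, h⟩ (h | h) <;> simp_all [gedge_eq_iff, mul_assoc])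

@[simp] theorem switch_gedge (σ : α → Γ) (a b : α) (g : Γ) :
    (gedge a b g).switch σ = gedge a b (σ a * g * (σ b)⁻¹) := rfl

theorem switch_mul (σ τ : α → Γ) (e : GainedEdge α Γ) :
    e.switch (σ * τ) = (e.switch τ).switch σ := by
  obtain ⟨a, b, g, rfl⟩ := e.exists_eq_gedge
  simp [mul_assoc]

theorem switch_one (e : GainedEdge α Γ) : e.switch 1 = e := by
  obtain ⟨a, b, g, rfl⟩ := e.exists_eq_gedge
  simp

@[simp] theorem switch_inv_switch (σ : α → Γ) (e : GainedEdge α Γ) :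
    (e.switch σ).switch σ⁻¹ = e := by
  rw [← switch_mul, inv_mul_cancel, switch_one]

@[simp] theorem switch_switch_inv (σ : α → Γ) (e : GainedEdge α Γ) :
    (e.switch σ⁻¹).switch σ = e := by
  rw [← switch_mul, mul_inv_cancel, switch_one]

theorem switch_injective (σ : α → Γ) : Function.Injective (switch σ) :=
  Function.LeftInverse.injective (g := switch σ⁻¹) (switch_inv_switch σ)

@[simp] theorem supp_switch (σ : α → Γ) (e : GainedEdge α Γ) : (e.switch σ).supp = e.supp := by
  obtain ⟨a, b, g, rfl⟩ := e.exists_eq_gedge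
  simp

theorem Compat.of_switch {χ : Γ →* ℤˣ} {φ : α → ℤˣ} {σ : α → Γ} {e : GainedEdge α Γ}
    (h : (e.switch σ).Compat χ φ) : e.Compat χ (fun x => χ (σ x) * φ x) := by
  obtain ⟨a, b, g, rfl⟩ := e.exists_eq_gedge
  simp only [switch_gedge, compat_gedge, map_mul, map_inv, Int.units_inv_eq_self] at h ⊢
  rw [mul_mul_mul_comm, ← h]
  have := Int.units_mul_self (χ (σ a))
  have h2 := Int.units_mul_self (χ (σ b))
  calc χ g = (χ (σ a) * χ (σ a)) * (χ (σ b) * χ (σ b)) * χ g := by rw [this, h2]; simp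
    _ = _ := by ac_rfl

end GainedEdge

namespace GainGraph

variable {α : Type*} {Γ : Type*} [Group Γ] {χ : Γ →* ℤˣ} {G G' : GainGraph α Γ}

/-- Switching is a bijection on edges that keeps ends, so it preserves every surplus; potentials are
only twisted by the signs of `σ`. -/
theorem SignTight.of_switch (hG : G.SignTight χ) (σ : α → Γ) (hV : G'.verts = G.verts)
    (hE : G'.edges = GainedEdge.switch σ '' G.edges) : G'.SignTight χ := by
  have hinj := GainedEdge.switch_injective (Γ := Γ) σ
  have hsub : ∀ {V E}, G'.IsSub V E → G.IsSub V (GainedEdge.switch σ ⁻¹' E) ∧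
      surplus V (GainedEdge.switch σ ⁻¹' E) = surplus V E := by
    intro V E h
    refine ⟨⟨hV ▸ h.verts, fun e he => ?_, fun e he => ?_⟩, ?_⟩
    · have := h.edges he
      rw [hE] at this
      obtain ⟨e', he', heq⟩ := this
      rwa [← hinj heq]
    · simpa using h.supp _ he
    · rw [surplus, surplus, Set.ncard_preimage_of_injective_subset_range hinj]
      intro e _
      exact ⟨_, GainedEdge.switch_switch_inv σ e⟩
  refine ⟨?_, fun V E h hne => ?_, fun V E φ h hne hφ => ?_⟩
  · rw [surplus, hV, hE, Set.ncard_image_of_injective _ hinj]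
    exact hG.total
  · rw [← (hsub h).2]
    exact hG.one_le _ _ (hsub h).1 hne
  · rw [← (hsub h).2]
    exact hG.two_le _ _ _ (hsub h).1 hne (fun e he => (hφ _ he).of_switch)

theorem Switching.signTight (h : Switching G G') (hG : G.SignTight χ) : G'.SignTight χ := by
  classical
  obtain ⟨v, hv, γ, hV, hE⟩ := h
  refine hG.of_switch (fun a => if a = v then γ else 1) hV ?_
  ext e
  constructor
  · intro he
    obtain ⟨a, b, g, rfl⟩ := e.exists_eq_gedge
    refine ⟨gedge a b ((if a = v then γ else 1)⁻¹ * g * (if b = v then γ else 1)), ?_, ?_⟩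
    · rw [← hE]
      convert he using 2
      group
    · rw [GainedEdge.switch_gedge]
      congr 1
      group
  · rintro ⟨e, he, rfl⟩
    obtain ⟨a, b, g, rfl⟩ := e.exists_eq_gedge
    exact (hE a b g).2 he

/-! ### Extensions by a single vertex -/

/-- No edge of `G` meets `v₀`, so intersecting with the edges of `G` already discards everything at
`v₀`. -/
theorem IsSub.restrict {v₀ : α} {V : Set α} {E : Set (GainedEdge α Γ)} (h : G'.IsSub V E)
    (hV : G'.verts = insert v₀ G.verts) (hv₀ : v₀ ∉ G.verts) :
    G.IsSub (V \ {v₀}) (E ∩ G.edges) := by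
  refine ⟨?_, Set.inter_subset_right, fun e he x hx => ⟨h.supp e he.1 hx, ?_⟩⟩
  · rintro x ⟨hx, hx0⟩
    have := h.verts hx
    rw [hV] at this
    exact this.resolve_left hx0
  · rintro rfl
    exact hv₀ (G.supp_subset_verts he.2 hx)

theorem IsSub.surplus_restrict {v₀ : α} {V : Set α} {E : Set (GainedEdge α Γ)}
    (h : G'.IsSub V E) (hv : v₀ ∈ V) :
    surplus V E = surplus (V \ {v₀}) (E ∩ G.edges) + 2 - (E \ G.edges).ncard := by
  have h1 := Set.ncard_sdiff_singleton_add_one hv h.finite_verts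
  have h2 := Set.ncard_inter_add_ncard_sdiff_eq_ncard E G.edges h.finite_edges
  simp only [surplus]
  omega

/-- Losing `v₀` costs 2, and the at most two lost edges give back at most 2. -/
theorem IsSub.surplus_restrict_le {v₀ : α} {V : Set α} {E : Set (GainedEdge α Γ)}
    (h : G'.IsSub V E) (hE : ∀ e ∈ G'.edges, v₀ ∉ e.supp → e ∈ G.edges)
    (hle : (E \ G.edges).ncard ≤ 2) :
    surplus (V \ {v₀}) (E ∩ G.edges) ≤ surplus V E := by
  by_cases hv : v₀ ∈ V
  · have := h.surplus_restrict (G := G) hv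
    omega
  · rw [Set.sdiff_singleton_eq_self hv, Set.inter_eq_left.2]
    exact fun e he => hE e (h.edges he) (fun h' => hv (h.supp e he h'))

theorem ncard_pair_le {β : Type*} (a b : β) : ({a, b} : Set β).ncard ≤ 2 :=
  (Set.ncard_insert_le _ _).trans (by simp)

theorem surplus_singleton_empty (v : α) :
    surplus ({v} : Set α) (∅ : Set (GainedEdge α Γ)) = 2 := by
  simp [surplus]

theorem notMem_edges_of_notMem {v₀ x : α} (hv₀ : v₀ ∉ G.verts) (g : Γ) :
    gedge v₀ x g ∉ G.edges := fun h => hv₀ (G.ends_mem _ _ _ h).1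

theorem eq_singleton_of_diff_empty {v₀ : α} {V : Set α} (hne : V.Nonempty)
    (h : ¬ (V \ {v₀}).Nonempty) : V = {v₀} :=
  (Set.subset_singleton_iff_eq.1 (Set.sdiff_eq_empty.1 (Set.not_nonempty_iff_eq_empty.1 h))
    ).resolve_left hne.ne_empty

theorem ZeroExtension.signTight (h : ZeroExtension G G') (hG : G.SignTight χ) :
    G'.SignTight χ := by
  obtain ⟨v₀, v₁, v₂, g₁, g₂, hv₀, hv₁, hv₂, hne, hV, hE⟩ := h
  have h1 : v₁ ≠ v₀ := by rintro rfl; exact hv₀ hv₁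
  have h2 : v₂ ≠ v₀ := by rintro rfl; exact hv₀ hv₂
  have hdiff : G'.edges \ G.edges ⊆ {gedge v₀ v₁ g₁, gedge v₀ v₂ g₂} := by
    rw [hE]; exact Set.union_sdiff_left.subset.trans Set.sdiff_subset
  have hold : ∀ e ∈ G'.edges, v₀ ∉ e.supp → e ∈ G.edges := by
    intro e he hs
    by_contra hc
    rcases hdiff ⟨he, hc⟩ with rfl | rfl <;> exact hs (by simp)
  have hle : ∀ {V E}, G'.IsSub V E → (E \ G.edges).ncard ≤ 2 := fun h =>
    (Set.ncard_le_ncard ((Set.sdiff_subset_sdiff_left h.edges).trans hdiff)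
      (Set.toFinite _)).trans (ncard_pair_le _ _)
  have hsing : ∀ {V E}, G'.IsSub V E → V.Nonempty → ¬ (V \ {v₀}).Nonempty → surplus V E = 2 := by
    intro V E h hne hemp
    obtain rfl := eq_singleton_of_diff_empty hne hemp
    have : E = ∅ := by
      rw [Set.eq_empty_iff_forall_notMem]
      intro e he
      by_cases hc : e ∈ G.edges
      · obtain ⟨a, b, g, rfl⟩ := e.exists_eq_gedge
        have := (h.mem_of_gedge he).1
        simp only [Set.mem_singleton_iff] at this
        subst this
        exact notMem_edges_of_notMem hv₀ g hc
      · rcases hdiff ⟨h.edges he, hc⟩ with rfl | rfl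
        · exact h1 (h.mem_of_gedge he).2
        · exact h2 (h.mem_of_gedge he).2
    rw [this, surplus_singleton_empty]
  refine ⟨?_, fun V E h hne => ?_, fun V E φ h hne hφ => ?_⟩
  · have hd : Disjoint G.edges {gedge v₀ v₁ g₁, gedge v₀ v₂ g₂} := by
      rw [Set.disjoint_left]
      rintro e he (rfl | rfl) <;> exact notMem_edges_of_notMem hv₀ _ he
    have := hG.total
    rw [surplus] at this ⊢
    rw [hV, hE, Set.ncard_union_eq hd G.edges_finite (Set.toFinite _), Set.ncard_pair hne,
      Set.ncard_insert_of_notMem hv₀ G.verts_finite]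
    push_cast
    linarith
  · by_cases hemp : (V \ {v₀}).Nonempty
    · exact (hG.one_le _ _ (h.restrict hV hv₀) hemp).trans (h.surplus_restrict_le hold (hle h))
    · rw [hsing h hne hemp]; norm_num
  · by_cases hemp : (V \ {v₀}).Nonempty
    · exact (hG.two_le _ _ φ (h.restrict hV hv₀) hemp fun e he => hφ e he.1).trans
        (h.surplus_restrict_le hold (hle h))
    · rw [hsing h hne hemp]

/-- A subgraph without both `g₁`- and `g₂`-edges loses at most two edges with `v₀`. One with both
may lose three, but then the removed edge can be put back: its ends lie in the subgraph, and its
gain is that of the path through `v₀`, so a potential stays compatible. -/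
theorem OneExtension.signTight (h : OneExtension G G') (hG : G.SignTight χ) :
    G'.SignTight χ := by
  obtain ⟨v₀, v₁, v₂, v₃, g, g₁, g₂, g₃, hv₀, hv₃, he, hg, h12, h13, h23, hV, hE⟩ := h
  obtain ⟨hv₁, hv₂⟩ := G.ends_mem _ _ _ he
  have h1 : v₁ ≠ v₀ := by rintro rfl; exact hv₀ hv₁
  have h2 : v₂ ≠ v₀ := by rintro rfl; exact hv₀ hv₂
  have h3 : v₃ ≠ v₀ := by rintro rfl; exact hv₀ hv₃
  have hdiff : G'.edges \ G.edges ⊆ {gedge v₀ v₁ g₁, gedge v₀ v₂ g₂, gedge v₀ v₃ g₃} := by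
    rw [hE]; rintro e ⟨he | he, hc⟩
    · exact absurd he.1 hc
    · exact he
  have hold : ∀ e ∈ G'.edges, v₀ ∉ e.supp → e ∈ G.edges := by
    intro e he hs
    by_contra hc
    rcases hdiff ⟨he, hc⟩ with rfl | rfl | rfl <;> exact hs (by simp)
  have he' : gedge v₁ v₂ g ∉ G'.edges := by
    rw [hE]
    rintro (⟨-, hc⟩ | hc)
    · exact hc rfl
    · have : v₀ ∈ (gedge v₁ v₂ g).supp := by
        rcases hc with hc | hc | hc <;> rw [hc] <;> simp
      exact hv₀ (G.supp_subset_verts he this)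
  have hle3 : ∀ {V E}, G'.IsSub V E → (E \ G.edges).ncard ≤ 3 := fun h =>
    (Set.ncard_le_ncard ((Set.sdiff_subset_sdiff_left h.edges).trans hdiff)
      (Set.toFinite _)).trans ((Set.ncard_insert_le _ _).trans (by
        have := ncard_pair_le (gedge v₀ v₂ g₂) (gedge v₀ v₃ g₃)
        omega))
  have hle : ∀ {V E}, G'.IsSub V E → ¬ (gedge v₀ v₁ g₁ ∈ E ∧ gedge v₀ v₂ g₂ ∈ E) →
      (E \ G.edges).ncard ≤ 2 := by
    intro V E h hc
    by_cases hc1 : gedge v₀ v₁ g₁ ∈ E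
    · refine (Set.ncard_le_ncard (t := {gedge v₀ v₁ g₁, gedge v₀ v₃ g₃}) ?_
        (Set.toFinite _)).trans (ncard_pair_le _ _)
      intro e he
      rcases hdiff ⟨h.edges he.1, he.2⟩ with rfl | rfl | rfl
      · simp
      · exact absurd ⟨hc1, he.1⟩ hc
      · simp
    · refine (Set.ncard_le_ncard (t := {gedge v₀ v₂ g₂, gedge v₀ v₃ g₃}) ?_
        (Set.toFinite _)).trans (ncard_pair_le _ _)
      intro e he
      rcases hdiff ⟨h.edges he.1, he.2⟩ with rfl | rfl | rfl
      · exact absurd he.1 hc1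
      · simp
      · simp
  have hsing : ∀ {V E}, G'.IsSub V E → V.Nonempty → ¬ (V \ {v₀}).Nonempty → surplus V E = 2 := by
    intro V E h hne hemp
    obtain rfl := eq_singleton_of_diff_empty hne hemp
    have : E = ∅ := by
      rw [Set.eq_empty_iff_forall_notMem]
      intro e he
      by_cases hc : e ∈ G.edges
      · obtain ⟨a, b, g, rfl⟩ := e.exists_eq_gedge
        have := (h.mem_of_gedge he).1
        simp only [Set.mem_singleton_iff] at this
        subst this
        exact notMem_edges_of_notMem hv₀ g hc
      · rcases hdiff ⟨h.edges he, hc⟩ with rfl | rfl | rfl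
        · exact h1 (h.mem_of_gedge he).2
        · exact h2 (h.mem_of_gedge he).2
        · exact h3 (h.mem_of_gedge he).2
    rw [this, surplus_singleton_empty]
  have hfull : ∀ {V E}, G'.IsSub V E → gedge v₀ v₁ g₁ ∈ E → gedge v₀ v₂ g₂ ∈ E →
      (V \ {v₀}).Nonempty ∧ G.IsSub (V \ {v₀}) (insert (gedge v₁ v₂ g) (E ∩ G.edges)) ∧
      surplus (V \ {v₀}) (insert (gedge v₁ v₂ g) (E ∩ G.edges)) ≤ surplus V E := by
    intro V E h m1 m2
    have n1 : v₁ ∈ V \ {v₀} := ⟨(h.mem_of_gedge m1).2, h1⟩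
    have n2 : v₂ ∈ V \ {v₀} := ⟨(h.mem_of_gedge m2).2, h2⟩
    have hr := h.restrict hV hv₀
    refine ⟨⟨_, n1⟩, hr.insert_edge he n1 n2, ?_⟩
    rw [hr.surplus_insert_edge (fun hc => he' (h.edges hc.1)),
      h.surplus_restrict (G := G) (h.mem_of_gedge m1).1]
    have := hle3 h
    omega
  refine ⟨?_, fun V E h hne => ?_, fun V E φ h hne hφ => ?_⟩
  · have hd : Disjoint (G.edges \ {gedge v₁ v₂ g})
        {gedge v₀ v₁ g₁, gedge v₀ v₂ g₂, gedge v₀ v₃ g₃} := by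
      rw [Set.disjoint_left]
      rintro e he (rfl | rfl | rfl) <;> exact notMem_edges_of_notMem hv₀ _ he.1
    have := hG.total
    have h4 := Set.ncard_sdiff_singleton_add_one he G.edges_finite
    rw [surplus] at this ⊢
    rw [hV, hE, Set.ncard_union_eq hd (G.edges_finite.subset Set.sdiff_subset) (Set.toFinite _),
      Set.ncard_eq_three.2 ⟨_, _, _, h12, h13, h23, rfl⟩,
      Set.ncard_insert_of_notMem hv₀ G.verts_finite]
    push_cast
    omega
  · by_cases hc : gedge v₀ v₁ g₁ ∈ E ∧ gedge v₀ v₂ g₂ ∈ E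
    · obtain ⟨k1, k2, k3⟩ := hfull h hc.1 hc.2
      exact (hG.one_le _ _ k2 k1).trans k3
    by_cases hemp : (V \ {v₀}).Nonempty
    · exact (hG.one_le _ _ (h.restrict hV hv₀) hemp).trans (h.surplus_restrict_le hold (hle h hc))
    · rw [hsing h hne hemp]; norm_num
  · by_cases hc : gedge v₀ v₁ g₁ ∈ E ∧ gedge v₀ v₂ g₂ ∈ E
    · obtain ⟨k1, k2, k3⟩ := hfull h hc.1 hc.2
      refine (hG.two_le _ _ φ k2 k1 ?_).trans k3
      rintro e (rfl | he)
      · have c1 := GainedEdge.compat_gedge.1 (hφ _ hc.1)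
        have c2 := GainedEdge.compat_gedge.1 (hφ _ hc.2)
        rw [GainedEdge.compat_gedge, ← hg, map_mul, map_inv, Int.units_inv_eq_self, c1, c2,
          mul_mul_mul_comm, Int.units_mul_self, one_mul]
      · exact hφ e he.1
    by_cases hemp : (V \ {v₀}).Nonempty
    · exact (hG.two_le _ _ φ (h.restrict hV hv₀) hemp fun e he => hφ e he.1).trans
        (h.surplus_restrict_le hold (hle h hc))
    · rw [hsing h hne hemp]

/-- The counting is that of a 0-extension except on the vertex `v₀` alone, where the loop brings the
surplus down to 1; its non-trivial sign rules out a potential there. -/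
theorem LoopOneExtension.signTight {G G' : GainGraph α ZReflective} (h : LoopOneExtension G G')
    (hG : G.SignTight SemidirectProduct.rightHom) :
    G'.SignTight SemidirectProduct.rightHom := by
  obtain ⟨v₀, v₁, l, g, hv₀, hv₁, hl, hV, hE⟩ := h
  have h1 : v₁ ≠ v₀ := by rintro rfl; exact hv₀ hv₁
  have hdiff : G'.edges \ G.edges ⊆ {gedge v₀ v₀ l, gedge v₀ v₁ g} := by
    rw [hE]; exact Set.union_sdiff_left.subset.trans Set.sdiff_subset
  have hold : ∀ e ∈ G'.edges, v₀ ∉ e.supp → e ∈ G.edges := by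
    intro e he hs
    by_contra hc
    rcases hdiff ⟨he, hc⟩ with rfl | rfl <;> exact hs (by simp)
  have hle : ∀ {V E}, G'.IsSub V E → (E \ G.edges).ncard ≤ 2 := fun h =>
    (Set.ncard_le_ncard ((Set.sdiff_subset_sdiff_left h.edges).trans hdiff)
      (Set.toFinite _)).trans (ncard_pair_le _ _)
  have hsing : ∀ {E}, G'.IsSub {v₀} E → E ⊆ {gedge v₀ v₀ l} := by
    intro E h e he
    by_cases hc : e ∈ G.edges
    · obtain ⟨a, b, g, rfl⟩ := e.exists_eq_gedge
      have := (h.mem_of_gedge he).1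
      simp only [Set.mem_singleton_iff] at this
      subst this
      exact absurd hc (notMem_edges_of_notMem hv₀ g)
    · rcases hdiff ⟨h.edges he, hc⟩ with rfl | rfl
      · rfl
      · exact absurd (h.mem_of_gedge he).2 h1
  refine ⟨?_, fun V E h hne => ?_, fun V E φ h hne hφ => ?_⟩
  · have hd : Disjoint G.edges {gedge v₀ v₀ l, gedge v₀ v₁ g} := by
      rw [Set.disjoint_left]
      rintro e he (rfl | rfl) <;> exact notMem_edges_of_notMem hv₀ _ he
    have := hG.total
    rw [surplus] at this ⊢
    have hne : gedge v₀ v₀ l ≠ gedge v₀ v₁ g := by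
      simp [gedge_eq_iff, h1.symm]
    rw [hV, hE, Set.ncard_union_eq hd G.edges_finite (Set.toFinite _), Set.ncard_pair hne,
      Set.ncard_insert_of_notMem hv₀ G.verts_finite]
    push_cast
    linarith
  · by_cases hemp : (V \ {v₀}).Nonempty
    · exact (hG.one_le _ _ (h.restrict hV hv₀) hemp).trans (h.surplus_restrict_le hold (hle h))
    · obtain rfl := eq_singleton_of_diff_empty hne hemp
      have := Set.ncard_le_ncard (hsing h)
      simp only [Set.ncard_singleton] at this
      simp only [surplus, Set.ncard_singleton]
      omega
  · by_cases hemp : (V \ {v₀}).Nonempty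
    · exact (hG.two_le _ _ φ (h.restrict hV hv₀) hemp fun e he => hφ e he.1).trans
        (h.surplus_restrict_le hold (hle h))
    · obtain rfl := eq_singleton_of_diff_empty hne hemp
      have : E = ∅ := by
        rw [Set.eq_empty_iff_forall_notMem]
        intro e he
        obtain rfl := hsing h he
        have := GainedEdge.compat_gedge.1 (hφ _ he)
        rw [Int.units_mul_self] at this
        exact hl this
      rw [this, surplus_singleton_empty]

end GainGraph

namespace GainGraph

variable {α : Type*} {Γ : Type*} [Group Γ] {χ : Γ →* ℤˣ} {G G' : GainGraph α Γ}

/-! ### Edge-to-`K_3` and vertex-to-`K_4` moves -/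

open Classical in
theorem ncard_inter_insert_le {β : Type*} (S T : Set β) (a : β) :
    (S ∩ insert a T).ncard ≤ (S ∩ T).ncard + (if a ∈ S then 1 else 0) := by
  split_ifs with h
  · rw [Set.inter_insert_of_mem h]
    exact Set.ncard_insert_le _ _
  · rw [Set.inter_insert_of_notMem h, add_zero]

open Classical in
theorem ncard_inter_insert {β : Type*} (S T : Set β) (hT : T.Finite) (a : β) (ha : a ∉ T) :
    (S ∩ insert a T).ncard = (S ∩ T).ncard + (if a ∈ S then 1 else 0) := by
  split_ifs with h
  · rw [Set.inter_insert_of_mem h, Set.ncard_insert_of_notMem (fun h' => ha h'.2)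
      (hT.subset Set.inter_subset_right)]
  · rw [Set.inter_insert_of_notMem h, add_zero]

theorem ncard_le_of_subset_image_union {β γ : Type*} {f : β → γ} {E : Set γ} {D : Set β}
    {N : Set γ} (hD : D.Finite) (hN : N.Finite) (h : E ⊆ f '' D ∪ N) :
    E.ncard ≤ D.ncard + (E ∩ N).ncard := by
  have : E ⊆ f '' D ∪ (E ∩ N) := fun e he => (h he).imp_right fun h' => ⟨he, h'⟩
  refine (Set.ncard_le_ncard this ((hD.image f).union (hN.subset Set.inter_subset_right))).trans
    ((Set.ncard_union_le _ _).trans ?_)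
  exact Nat.add_le_add_right (Set.ncard_image_le hD) _

/-- Contract `v₀` back into `v₁`. If both lie in the subgraph, a vertex worth 2 is lost, against at
most two edges: `a`, and one of the pair `e₀`, `b`, which merge. If `v₁` is missing, so are `a` and
`e₀`, and nothing is lost. -/
theorem EdgeToK3.signTight (h : EdgeToK3 G G') (hG : G.SignTight χ) : G'.SignTight χ := by
  classical
  obtain ⟨v₀, v₁, v₂, g, g₁, g₂, f, hv₀, h12, he₀, hg, hf, hV, hE⟩ := h
  obtain ⟨hv₁, hv₂⟩ := G.ends_mem _ _ _ he₀
  have h01 : v₁ ≠ v₀ := by rintro rfl; exact hv₀ hv₁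
  have h02 : v₂ ≠ v₀ := by rintro rfl; exact hv₀ hv₂
  have hv₀e : ∀ e ∈ G.edges, v₀ ∉ e.supp := fun e he h => hv₀ (G.supp_subset_verts he h)
  set e₀ := gedge v₁ v₂ g with he₀_def
  set a := gedge v₀ v₁ g₁ with ha_def
  set b := gedge v₀ v₂ g₂ with hb_def
  -- The new vertex `v₀` shows whether an edge was replaced, so its original can be recovered.
  have hinj : Set.InjOn f (G.edges \ {e₀}) := by
    rintro e he e' he' heq
    rcases hf e he with h | ⟨x, k, h, h'⟩ <;> rcases hf e' he' with k' | ⟨y, l, hl, hl'⟩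
    · rw [← h, ← k', heq]
    · exact absurd (by rw [← h, heq, hl']; simp) (hv₀e e he.1)
    · exact absurd (by rw [← k', ← heq, h']; simp) (hv₀e e' he'.1)
    · have hx : x ≠ v₀ := by rintro rfl; exact hv₀e e he.1 (by rw [h]; simp)
      rw [h', hl', gedge_eq_iff] at heq
      rcases heq with ⟨-, rfl, h3⟩ | ⟨-, h2, -⟩
      · rw [h, hl, mul_left_cancel h3]
      · exact absurd h2 hx
  have hnew : ∀ e ∈ G.edges \ {e₀}, f e ∉ ({e₀, a, b} : Set (GainedEdge α Γ)) := by
    intro e he hc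
    rcases hf e he with h | ⟨x, k, h, h'⟩
    · rw [h] at hc
      rcases hc with hc | rfl | rfl
      · exact he.2 hc
      · exact hv₀e _ he.1 (by simp [ha_def])
      · exact hv₀e _ he.1 (by simp [hb_def])
    · have hx : x ≠ v₀ := by rintro rfl; exact hv₀e e he.1 (by rw [h]; simp)
      rw [h'] at hc
      rcases hc with hc | hc | hc
      · exact hv₀e e₀ he₀ (by rw [← hc]; simp)
      · rw [ha_def, gedge_eq_iff] at hc
        rcases hc with ⟨-, rfl, h3⟩ | ⟨-, h3, -⟩
        · exact G.loop_gain_ne_one x k (h ▸ he.1) (by simpa using h3)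
        · exact hx h3
      · rw [Set.mem_singleton_iff, hb_def, gedge_eq_iff] at hc
        rcases hc with ⟨-, rfl, h3⟩ | ⟨-, h3, -⟩
        · exact he.2 (by rw [Set.mem_singleton_iff, h, he₀_def, ← hg, ← h3]; simp)
        · exact hx h3
  have hab : a ≠ b := by
    rw [ha_def, hb_def, Ne, gedge_eq_iff]
    rintro (⟨-, h, -⟩ | ⟨-, h, -⟩)
    · exact h12 h
    · exact h01 h
  have hea : e₀ ≠ a := fun h => hv₀e e₀ he₀ (by rw [h]; simp [ha_def])
  have heb : e₀ ≠ b := fun h => hv₀e e₀ he₀ (by rw [h]; simp [hb_def])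
  have hfin : (G.edges \ {e₀}).Finite := G.edges_finite.subset Set.sdiff_subset
  -- the contracted subgraph
  have key : ∀ {V E}, G'.IsSub V E → v₀ ∈ V → ∃ Ē, G.IsSub (insert v₁ (V \ {v₀})) Ē ∧
      (∀ φ : α → ℤˣ, (∀ e ∈ E, e.Compat χ φ) → (v₁ ∉ V ∨ χ g₁ = φ v₀ * φ v₁) →
        ∃ ψ, ∀ e ∈ Ē, e.Compat χ ψ) ∧
      (E.ncard : ℤ) ≤ Ē.ncard + (if a ∈ E then 1 else 0) +
        (if e₀ ∈ E ∧ b ∈ E then 1 else 0) := by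
    intro V E h hv
    set D := {e ∈ G.edges \ {e₀} | f e ∈ E} with hD
    -- Both `e₀` and `b` contract to `e₀`, which is therefore counted once.
    set S : Set (GainedEdge α Γ) := if e₀ ∈ E ∨ b ∈ E then {e₀} else ∅ with hS
    have hSmem : ∀ e ∈ S, e = e₀ ∧ (e₀ ∈ E ∨ b ∈ E) := by
      intro e he
      rw [hS] at he
      split_ifs at he with hc
      · exact ⟨he, hc⟩
      · exact absurd he (Set.notMem_empty e)
    have hDf : D.Finite := hfin.subset (Set.sep_subset _ _)
    have hx0 : ∀ e ∈ G.edges, ∀ x ∈ e.supp, x ≠ v₀ := by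
      rintro e he x hx rfl; exact hv₀e e he hx
    refine ⟨D ∪ S, ⟨?_, ?_, ?_⟩, ?_, ?_⟩
    · rintro x (rfl | ⟨hx, hx'⟩)
      · exact hv₁
      · have := h.verts hx
        rw [hV] at this
        exact this.resolve_left hx'
    · rintro e (he | he)
      · exact he.1.1
      · rw [(hSmem e he).1]; exact he₀
    · rintro e (⟨he, hfe⟩ | he) x hx
      · have hx0' := hx0 e he.1 x hx
        rcases hf e he with h' | ⟨y, k, h', h''⟩
        · rw [h'] at hfe
          exact Or.inr ⟨h.supp _ hfe hx, hx0'⟩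
        · rw [h''] at hfe
          rw [h'] at hx
          rcases hx with rfl | rfl
          · exact Or.inl rfl
          · exact Or.inr ⟨(h.mem_of_gedge hfe).2, hx0'⟩
      · obtain ⟨rfl, he | he⟩ := hSmem e he
        · exact Or.inr ⟨h.supp _ he hx, hx0 _ he₀ x hx⟩
        · rcases hx with rfl | rfl
          · exact Or.inl rfl
          · exact Or.inr ⟨(h.mem_of_gedge he).2, h02⟩
    · intro φ hφ hcond
      -- This is the value at `v₁` that compatibility with `a` would force; it agrees with `φ` on
      -- `V` in the cases considered.
      set ψ := Function.update φ v₁ (χ g₁ * φ v₀) with hψ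
      have hψ1 : ψ v₁ = χ g₁ * φ v₀ := by simp [hψ]
      have hψV : ∀ x ∈ V, φ x = ψ x := by
        intro x hx
        by_cases hx1 : x = v₁
        · subst hx1
          rw [hψ1, ← Int.units_eq_mul_iff.1 (hcond.resolve_left (not_not.2 hx))]
        · simp [hψ, hx1]
      refine ⟨ψ, ?_⟩
      rintro e (⟨he, hfe⟩ | he)
      · rcases hf e he with h' | ⟨y, k, h', h''⟩
        · rw [h'] at hfe
          exact (hφ e hfe).congr fun x hx => hψV x (h.supp _ hfe hx)
        · rw [h''] at hfe
          have hc := GainedEdge.compat_gedge.1 (hφ _ hfe)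
          rw [h', GainedEdge.compat_gedge, hψ1, ← hψV y (h.mem_of_gedge hfe).2, mul_assoc, ← hc,
            map_mul, ← mul_assoc, Int.units_mul_self, one_mul]
      · obtain ⟨rfl, he | he⟩ := hSmem e he
        · exact (hφ _ he).congr fun x hx => hψV x (h.supp _ he hx)
        · have hc := GainedEdge.compat_gedge.1 (hφ _ he)
          rw [he₀_def, GainedEdge.compat_gedge, hψ1, ← hψV v₂ (h.mem_of_gedge he).2, mul_assoc,
            ← hc, ← hg, map_mul, map_inv, Int.units_inv_eq_self]
    · have hdisj : Disjoint D S := by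
        rw [Set.disjoint_left]
        intro e he he'
        exact he.1.2 (hSmem e he').1
      have hSf : S.Finite := by rw [hS]; split_ifs <;> simp
      have hcard : E.ncard ≤ D.ncard + (E ∩ {e₀, a, b}).ncard := by
        refine ncard_le_of_subset_image_union (f := f) hDf (Set.toFinite _) fun e he => ?_
        have := h.edges he
        rw [hE] at this
        rcases this with ⟨e', he', rfl⟩ | h'
        · exact Or.inl ⟨e', ⟨he', he⟩, rfl⟩
        · exact Or.inr h'
      have hSc : S.ncard = if e₀ ∈ E ∨ b ∈ E then 1 else 0 := by
        rw [hS]; split_ifs <;> simp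
      have i1 := ncard_inter_insert_le E {a, b} e₀
      have i2 := ncard_inter_insert_le E {b} a
      have i3 : (E ∩ {b}).ncard ≤ if b ∈ E then 1 else 0 := by
        have := ncard_inter_insert_le E ∅ b
        simpa using this
      rw [Set.ncard_union_eq hdisj hDf hSf, hSc]
      by_cases m1 : e₀ ∈ E <;> by_cases m2 : a ∈ E <;> by_cases m3 : b ∈ E <;>
        simp only [m1, m2, m3, if_true, if_false, true_or, or_true, or_self, and_self, and_true,
          and_false] at * <;> omega
  have hold : ∀ {V E}, G'.IsSub V E → v₀ ∉ V → G.IsSub V E := by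
    intro V E h hv
    refine ⟨fun x hx => ?_, fun e he => ?_, h.supp⟩
    · have := h.verts hx
      rw [hV] at this
      exact this.resolve_left (by rintro rfl; exact hv hx)
    · have h' := h.edges he
      rw [hE] at h'
      rcases h' with ⟨e', he', rfl⟩ | rfl | rfl | rfl
      · rcases hf e' he' with h'' | ⟨x, k, -, h''⟩
        · rw [h'']; exact he'.1
        · rw [h''] at he; exact absurd (h.mem_of_gedge he).1 hv
      · exact he₀
      · exact absurd (h.mem_of_gedge he).1 hv
      · exact absurd (h.mem_of_gedge he).1 hv
  have hcV : ∀ {V E}, G'.IsSub V E → v₀ ∈ V →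
      ((insert v₁ (V \ {v₀})).ncard : ℤ) = V.ncard - (if v₁ ∈ V then 1 else 0) := by
    intro V E h hv
    have := Set.ncard_sdiff_singleton_add_one hv h.finite_verts
    split_ifs with hc
    · rw [Set.insert_eq_of_mem (show v₁ ∈ V \ {v₀} from ⟨hc, h01⟩)]
      omega
    · rw [Set.ncard_insert_of_notMem (fun h' => hc h'.1) (h.finite_verts.subset Set.sdiff_subset)]
      omega
  refine ⟨?_, fun V E h hne => ?_, fun V E φ h hne hφ => ?_⟩
  · have hd : Disjoint (f '' (G.edges \ {e₀})) {e₀, a, b} := by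
      rw [Set.disjoint_left]
      rintro _ ⟨e, he, rfl⟩
      exact hnew e he
    have := hG.total
    have h4 := Set.ncard_sdiff_singleton_add_one he₀ G.edges_finite
    rw [surplus] at this ⊢
    rw [hV, hE, Set.ncard_union_eq hd (hfin.image f) (Set.toFinite _),
      Set.ncard_eq_three.2 ⟨_, _, _, hea, heb, hab, rfl⟩, hinj.ncard_image,
      Set.ncard_insert_of_notMem hv₀ G.verts_finite]
    push_cast
    omega
  · by_cases hv : v₀ ∈ V
    · obtain ⟨Ē, k1, -, k3⟩ := key h hv
      have k4 := hG.one_le _ _ k1 ⟨v₁, Or.inl rfl⟩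
      rw [surplus, hcV h hv] at k4
      rw [surplus]
      have c1 : a ∈ E → v₁ ∈ V := fun h' => (h.mem_of_gedge h').2
      have c2 : e₀ ∈ E → v₁ ∈ V := fun h' => (h.mem_of_gedge h').1
      split_ifs at k3 k4 <;> first | omega | simp_all
    · exact hG.one_le _ _ (hold h hv) hne
  · by_cases hv : v₀ ∈ V
    · obtain ⟨Ē, k1, k2, k3⟩ := key h hv
      have c1 : a ∈ E → v₁ ∈ V := fun h' => (h.mem_of_gedge h').2
      have c2 : e₀ ∈ E → v₁ ∈ V := fun h' => (h.mem_of_gedge h').1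
      rw [surplus]
      by_cases hcond : v₁ ∉ V ∨ χ g₁ = φ v₀ * φ v₁
      · obtain ⟨ψ, hψ⟩ := k2 φ hφ hcond
        have k4 := hG.two_le _ _ ψ k1 ⟨v₁, Or.inl rfl⟩ hψ
        rw [surplus, hcV h hv] at k4
        split_ifs at k3 k4 <;> first | omega | simp_all
      -- Here `φ` conflicts with `a`, and so with the pair `e₀`, `b` as well. No edge is lost in the
      -- contraction, and the weaker bound 1 plus the 2 for the vertex is more than enough.
      · push Not at hcond
        have k4 := hG.one_le _ _ k1 ⟨v₁, Or.inl rfl⟩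
        rw [surplus, hcV h hv, if_pos hcond.1] at k4
        have na : a ∉ E := fun h' => hcond.2 (GainedEdge.compat_gedge.1 (hφ _ h'))
        have nb : ¬ (e₀ ∈ E ∧ b ∈ E) := by
          rintro ⟨m1, m2⟩
          have c1 := GainedEdge.compat_gedge.1 (hφ _ m1)
          have c2 := GainedEdge.compat_gedge.1 (hφ _ m2)
          have : g₁ = g₂ * g⁻¹ := by rw [← hg]; group
          apply hcond.2
          rw [this, map_mul, map_inv, Int.units_inv_eq_self, c1, c2, mul_comm (φ v₁),
            mul_assoc, ← mul_assoc (φ v₂), Int.units_mul_self, one_mul]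
        rw [if_neg na, if_neg nb] at k3
        omega
    · exact hG.two_le _ _ φ (hold h hv) hne hφ

/-- The edges of a `K_4` all of whose gains are trivial. -/
def k4Edges (Γ : Type*) [Group Γ] {α : Type*} (v₁ w₂ w₃ w₄ : α) : Set (GainedEdge α Γ) :=
  {gedge v₁ w₂ 1, gedge v₁ w₃ 1, gedge v₁ w₄ 1, gedge w₂ w₃ 1, gedge w₂ w₄ 1, gedge w₃ w₄ 1}

theorem finite_k4Edges (v₁ w₂ w₃ w₄ : α) : (k4Edges Γ v₁ w₂ w₃ w₄).Finite :=
  Set.toFinite {gedge v₁ w₂ 1, gedge v₁ w₃ 1, gedge v₁ w₄ 1, gedge w₂ w₃ 1, gedge w₂ w₄ 1,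
    gedge w₃ w₄ 1}

theorem ncard_k4Edges {v₁ w₂ w₃ w₄ : α} (h12 : v₁ ≠ w₂) (h13 : v₁ ≠ w₃) (h14 : v₁ ≠ w₄)
    (h23 : w₂ ≠ w₃) (h24 : w₂ ≠ w₄) (h34 : w₃ ≠ w₄) : (k4Edges Γ v₁ w₂ w₃ w₄).ncard = 6 := by
  rw [k4Edges, Set.ncard_insert_of_notMem _ (Set.toFinite _),
    Set.ncard_insert_of_notMem _ (Set.toFinite _), Set.ncard_insert_of_notMem _ (Set.toFinite _),
    Set.ncard_insert_of_notMem _ (Set.toFinite _), Set.ncard_pair]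
  all_goals
    simp [gedge_eq_iff, h12, h13, h14, h23, h24, h34, h12.symm, h13.symm, h23.symm, h24.symm,
      h34.symm]

open Classical in
theorem ncard_inter_k4 {v₁ w₂ w₃ w₄ : α} (h12 : v₁ ≠ w₂) (h13 : v₁ ≠ w₃) (h14 : v₁ ≠ w₄)
    (h23 : w₂ ≠ w₃) (h24 : w₂ ≠ w₄) (h34 : w₃ ≠ w₄) (V : Set α) :
    (V ∩ {v₁, w₂, w₃, w₄}).ncard = (if v₁ ∈ V then 1 else 0) + (if w₂ ∈ V then 1 else 0) +
      (if w₃ ∈ V then 1 else 0) + (if w₄ ∈ V then 1 else 0) := by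
  have h := ncard_inter_insert V ∅ Set.finite_empty w₄ (by simp)
  rw [insert_empty_eq, Set.inter_empty, Set.ncard_empty] at h
  rw [ncard_inter_insert V {w₂, w₃, w₄} (Set.toFinite _) v₁ (by simp [*]),
    ncard_inter_insert V {w₃, w₄} (Set.toFinite _) w₂ (by simp [*]),
    ncard_inter_insert V {w₄} (Set.toFinite _) w₃ (by simp [*]), h]
  ring

open Classical in
theorem ncard_inter_k4Edges_le (v₁ w₂ w₃ w₄ : α) (E : Set (GainedEdge α Γ)) :
    (E ∩ k4Edges Γ v₁ w₂ w₃ w₄).ncard ≤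
      (if gedge v₁ w₂ 1 ∈ E then 1 else 0) + (if gedge v₁ w₃ 1 ∈ E then 1 else 0) +
      (if gedge v₁ w₄ 1 ∈ E then 1 else 0) + (if gedge w₂ w₃ 1 ∈ E then 1 else 0) +
      (if gedge w₂ w₄ 1 ∈ E then 1 else 0) + (if gedge w₃ w₄ 1 ∈ E then 1 else 0) := by
  have h := ncard_inter_insert_le E ∅ (gedge w₃ w₄ 1)
  rw [insert_empty_eq, Set.inter_empty, Set.ncard_empty] at h
  rw [k4Edges]
  refine (ncard_inter_insert_le _ _ _).trans ?_
  have h2 := ncard_inter_insert_le E {gedge w₃ w₄ 1} (gedge w₂ w₄ 1)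
  have h3 := ncard_inter_insert_le E {gedge w₂ w₄ 1, gedge w₃ w₄ 1} (gedge w₂ w₃ 1)
  have h4 := ncard_inter_insert_le E {gedge w₂ w₃ 1, gedge w₂ w₄ 1, gedge w₃ w₄ 1} (gedge v₁ w₄ 1)
  have h5 := ncard_inter_insert_le E
    {gedge v₁ w₄ 1, gedge w₂ w₃ 1, gedge w₂ w₄ 1, gedge w₃ w₄ 1} (gedge v₁ w₃ 1)
  omega

/-- A subgraph of a balanced `K_4` satisfies the strict surplus bound unless it is a single vertex
or everything; in these cases every compatible potential is constant on it. -/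
theorem IsSub.ncard_k4 {v₁ w₂ w₃ w₄ : α} (h12 : v₁ ≠ w₂) (h13 : v₁ ≠ w₃) (h14 : v₁ ≠ w₄)
    (h23 : w₂ ≠ w₃) (h24 : w₂ ≠ w₄) (h34 : w₃ ≠ w₄) {V : Set α} {E : Set (GainedEdge α Γ)}
    (h : G.IsSub V E) (hne : (V ∩ {v₁, w₂, w₃, w₄}).Nonempty) :
    (E ∩ k4Edges Γ v₁ w₂ w₃ w₄).ncard + 2 ≤ 2 * (V ∩ {v₁, w₂, w₃, w₄}).ncard ∧
    ((E ∩ k4Edges Γ v₁ w₂ w₃ w₄).ncard + 3 ≤ 2 * (V ∩ {v₁, w₂, w₃, w₄}).ncard ∨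
      ∀ φ : α → ℤˣ, (∀ e ∈ E, e.Compat χ φ) →
        ∀ x ∈ V ∩ {v₁, w₂, w₃, w₄}, ∀ y ∈ V ∩ {v₁, w₂, w₃, w₄}, φ x = φ y) := by
  classical
  have hpos := (Set.ncard_pos ((Set.toFinite _).subset Set.inter_subset_right)).2 hne
  have hE := ncard_inter_k4Edges_le v₁ w₂ w₃ w₄ E
  have hV := ncard_inter_k4 h12 h13 h14 h23 h24 h34 V
  -- The membership indicators become opaque 0/1 values, leaving pure linear arithmetic with the
  -- constraint that an edge requires its ends.
  obtain ⟨I, hI⟩ : ∃ I : GainedEdge α Γ → ℕ, ∀ e, (if e ∈ E then 1 else 0) = I e :=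
    ⟨_, fun _ => rfl⟩
  obtain ⟨J, hJ⟩ : ∃ J : α → ℕ, ∀ x, (if x ∈ V then 1 else 0) = J x := ⟨_, fun _ => rfl⟩
  simp only [hI] at hE
  simp only [hJ] at hV
  have hle : ∀ a b : α, I (gedge a b 1) ≤ J a ∧ I (gedge a b 1) ≤ J b := by
    intro a b
    rw [← hI, ← hJ, ← hJ]
    by_cases hc : gedge a b 1 ∈ E
    · simp [hc, h.mem_of_gedge hc]
    · simp [hc]
  have hone : ∀ a : α, J a ≤ 1 := by
    intro a; rw [← hJ]; split_ifs <;> simp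
  obtain ⟨a1, a2⟩ := hle v₁ w₂
  obtain ⟨b1, b2⟩ := hle v₁ w₃
  obtain ⟨c1, c2⟩ := hle v₁ w₄
  obtain ⟨d1, d2⟩ := hle w₂ w₃
  obtain ⟨e1, e2⟩ := hle w₂ w₄
  obtain ⟨f1, f2⟩ := hle w₃ w₄
  have o1 := hone v₁
  have o2 := hone w₂
  have o3 := hone w₃
  have o4 := hone w₄
  refine ⟨by omega, or_iff_not_imp_left.2 fun hlt φ hφ => ?_⟩
  -- Two or three vertices always leave slack, and four leave slack unless all six edges occur; the
  -- three edges at `v₁` suffice to make a potential constant.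
  have hcase : (V ∩ {v₁, w₂, w₃, w₄}).ncard = 1 ∨
      (I (gedge v₁ w₂ 1) = 1 ∧ I (gedge v₁ w₃ 1) = 1 ∧ I (gedge v₁ w₄ 1) = 1) := by
    have hJ01 : ∀ a : α, J a = 0 ∨ J a = 1 := fun a => by have := hone a; omega
    clear hI hJ hle hone
    rcases hJ01 v₁ with j1 | j1 <;> rcases hJ01 w₂ with j2 | j2 <;>
      rcases hJ01 w₃ with j3 | j3 <;> rcases hJ01 w₄ with j4 | j4 <;>
      first
      | (left; omega)
      | (right; refine ⟨?_, ?_, ?_⟩ <;> omega)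
  rcases hcase with h1 | ⟨m2, m3, m4⟩
  · obtain ⟨z, hz⟩ := Set.ncard_eq_one.1 h1
    intro x hx y hy
    rw [hz] at hx hy
    rw [hx, hy]
  · have heq : ∀ w, I (gedge v₁ w 1) = 1 → φ w = φ v₁ := by
      intro w hw
      have : gedge v₁ w 1 ∈ E := by
        by_contra hc; simp [← hI, hc] at hw
      have := GainedEdge.compat_gedge.1 (hφ _ this)
      rw [map_one, Int.units_eq_mul_iff, one_mul] at this
      exact this.symm
    have hall : ∀ x ∈ V ∩ {v₁, w₂, w₃, w₄}, φ x = φ v₁ := by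
      rintro x ⟨-, rfl | rfl | rfl | rfl⟩
      exacts [rfl, heq _ m2, heq _ m3, heq _ m4]
    intro x hx y hy
    rw [hall x hx, hall y hy]

/-- Contracting the `K_4` cannot raise the surplus, since its subgraphs have surplus at least 2,
that of the single vertex replacing them. A potential descends when it is constant on the part
inside the `K_4`; otherwise `IsSub.ncard_k4` yields one spare unit, which lifts the bound 1 to 2. -/
theorem VertexToK4.signTight (h : VertexToK4 G G') (hG : G.SignTight χ) : G'.SignTight χ := by
  classical
  obtain ⟨v₁, w₂, w₃, w₄, f, hv₁, hw₂, hw₃, hw₄, h23, h24, h34, hf, hV, hE⟩ := h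
  have h12 : v₁ ≠ w₂ := by rintro rfl; exact hw₂ hv₁
  have h13 : v₁ ≠ w₃ := by rintro rfl; exact hw₃ hv₁
  have h14 : v₁ ≠ w₄ := by rintro rfl; exact hw₄ hv₁
  set W : Set α := {w₂, w₃, w₄} with hW
  have hWG : ∀ y ∈ W, y ∉ G.verts := by rintro y (rfl | rfl | rfl) <;> assumption
  have hWe : ∀ e ∈ G.edges, ∀ x ∈ e.supp, x ∉ W :=
    fun e he x hx h => hWG x h (G.supp_subset_verts he hx)
  set K : Set α := insert v₁ W with hK
  change G'.edges = f '' G.edges ∪ k4Edges Γ v₁ w₂ w₃ w₄ at hE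
  have hinj : Set.InjOn f G.edges := by
    rintro e he e' he' heq
    rcases hf e he with h | ⟨x, k, y, h, hy, h'⟩ <;>
      rcases hf e' he' with k' | ⟨x', l, y', hl, hy', hl'⟩
    · rw [← h, ← k', heq]
    · exact absurd hy' (hWe e he y' (by rw [← h, heq, hl']; simp))
    · exact absurd hy (hWe e' he' y (by rw [← k', ← heq, h']; simp))
    · rw [h', hl', gedge_eq_iff] at heq
      rcases heq with ⟨rfl, rfl, rfl⟩ | ⟨rfl, h2, -⟩
      · rw [h, hl]
      · exact absurd hy (hWe e' he' y (by rw [hl]; simp))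
  have hK6 : ∀ e ∈ k4Edges Γ v₁ w₂ w₃ w₄, ∃ a b, e = gedge a b 1 ∧ a ∈ K ∧ b ∈ W ∧ a ≠ b := by
    rintro e (rfl | rfl | rfl | rfl | rfl | rfl)
    · exact ⟨v₁, w₂, rfl, by simp [hK], by simp [hW], h12⟩
    · exact ⟨v₁, w₃, rfl, by simp [hK], by simp [hW], h13⟩
    · exact ⟨v₁, w₄, rfl, by simp [hK], by simp [hW], h14⟩
    · exact ⟨w₂, w₃, rfl, by simp [hK, hW], by simp [hW], h23⟩
    · exact ⟨w₂, w₄, rfl, by simp [hK, hW], by simp [hW], h24⟩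
    · exact ⟨w₃, w₄, rfl, by simp [hK, hW], by simp [hW], h34⟩
  have hnew : ∀ e ∈ G.edges, f e ∉ k4Edges Γ v₁ w₂ w₃ w₄ := by
    intro e he hc
    obtain ⟨a, b, hab, ha, hb, hne⟩ := hK6 _ hc
    rcases hf e he with h | ⟨x, k, y, h, hy, h'⟩
    · exact hWe e he b (by rw [← h, hab]; simp) hb
    · have hx : x ∉ W := hWe e he x (by rw [h]; simp)
      rw [h', gedge_eq_iff] at hab
      rcases hab with ⟨-, rfl, -⟩ | ⟨-, rfl, rfl⟩
      · exact hx hb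
      · obtain rfl : x = v₁ := ha.resolve_right hx
        exact G.loop_gain_ne_one x _ (h ▸ he) (by simp)
  -- the contracted subgraph
  have key : ∀ {V E}, G'.IsSub V E → (V ∩ K).Nonempty →
      G.IsSub (insert v₁ (V \ K)) {e ∈ G.edges | f e ∈ E} ∧
      (∀ φ : α → ℤˣ, (∀ e ∈ E, e.Compat χ φ) →
        (∀ x ∈ V ∩ K, ∀ y ∈ V ∩ K, φ x = φ y) →
        ∃ ψ, ∀ e ∈ {e ∈ G.edges | f e ∈ E}, e.Compat χ ψ) ∧
      surplus V E + (E ∩ k4Edges Γ v₁ w₂ w₃ w₄).ncard + 2 ≥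
        surplus (insert v₁ (V \ K)) {e ∈ G.edges | f e ∈ E} + 2 * (V ∩ K).ncard := by
    intro V E h hne
    have hx0 : ∀ x ∈ V, x ∉ W → x ∈ insert v₁ (V \ K) := by
      intro x hx hxW
      by_cases hx1 : x = v₁
      · exact Or.inl hx1
      · exact Or.inr ⟨hx, by rintro (h | h) <;> contradiction⟩
    refine ⟨⟨?_, Set.sep_subset _ _, ?_⟩, ?_, ?_⟩
    · rintro x (rfl | ⟨hx, hx'⟩)
      · exact hv₁
      · have := h.verts hx
        rw [hV] at this
        exact this.resolve_right fun h' => hx' (Or.inr h')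
    · rintro e ⟨he, hfe⟩ x hx
      have hx0' := hWe e he x hx
      rcases hf e he with h' | ⟨z, k, y, h', hy, h''⟩
      · rw [h'] at hfe
        exact hx0 x (h.supp _ hfe hx) hx0'
      · rw [h''] at hfe
        rw [h'] at hx
        rcases hx with rfl | rfl
        · exact Or.inl rfl
        · exact hx0 x (h.mem_of_gedge hfe).2 hx0'
    · intro φ hφ hconst
      obtain ⟨y₀, hy₀⟩ := hne
      set ψ := Function.update φ v₁ (φ y₀) with hψ
      have hψ1 : ψ v₁ = φ y₀ := by simp [hψ]
      have hψV : ∀ x ∈ V, φ x = ψ x := by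
        intro x hx
        by_cases hx1 : x = v₁
        · subst hx1
          rw [hψ1]
          exact hconst x ⟨hx, Or.inl rfl⟩ y₀ hy₀
        · simp [hψ, hx1]
      refine ⟨ψ, ?_⟩
      rintro e ⟨he, hfe⟩
      rcases hf e he with h' | ⟨z, k, y, h', hy, h''⟩
      · rw [h'] at hfe
        exact (hφ e hfe).congr fun x hx => hψV x (h.supp _ hfe hx)
      · rw [h''] at hfe
        have hc := GainedEdge.compat_gedge.1 (hφ _ hfe)
        have hm := h.mem_of_gedge hfe
        rw [h', GainedEdge.compat_gedge, hψ1, ← hψV z hm.2, hc,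
          hconst y ⟨hm.1, Or.inr hy⟩ y₀ hy₀]
    · have hcard : E.ncard ≤ {e ∈ G.edges | f e ∈ E}.ncard +
          (E ∩ k4Edges Γ v₁ w₂ w₃ w₄).ncard := by
        refine ncard_le_of_subset_image_union (f := f) (G.edges_finite.subset (Set.sep_subset _ _))
          (finite_k4Edges _ _ _ _) fun e he => ?_
        have := h.edges he
        rw [hE] at this
        rcases this with ⟨e', he', rfl⟩ | h'
        · exact Or.inl ⟨e', ⟨he', he⟩, rfl⟩
        · exact Or.inr h'
      have h1 := Set.ncard_inter_add_ncard_sdiff_eq_ncard V K h.finite_verts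
      rw [surplus, surplus, Set.ncard_insert_of_notMem (fun h' => h'.2 (Or.inl rfl))
        (h.finite_verts.subset Set.sdiff_subset)]
      push_cast
      omega
  have hold : ∀ {V E}, G'.IsSub V E → ¬ (V ∩ K).Nonempty → G.IsSub V E := by
    intro V E h hv
    have hv' : ∀ x ∈ V, x ∉ K := fun x hx hxK => hv ⟨x, hx, hxK⟩
    refine ⟨fun x hx => ?_, fun e he => ?_, h.supp⟩
    · have := h.verts hx
      rw [hV] at this
      exact this.resolve_right fun h' => hv' x hx (Or.inr h')
    · have h' := h.edges he
      rw [hE] at h'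
      rcases h' with ⟨e', he', rfl⟩ | h'
      · rcases hf e' he' with h'' | ⟨x, k, y, -, hy, h''⟩
        · rw [h'']; exact he'
        · rw [h''] at he; exact absurd (Or.inr hy) (hv' y (h.mem_of_gedge he).1)
      · obtain ⟨a, b, rfl, ha, -, -⟩ := hK6 _ h'
        exact absurd ha (hv' a (h.mem_of_gedge he).1)
  refine ⟨?_, fun V E h hne => ?_, fun V E φ h hne hφ => ?_⟩
  · have hd : Disjoint (f '' G.edges) (k4Edges Γ v₁ w₂ w₃ w₄) := by
      rw [Set.disjoint_left]
      rintro _ ⟨e, he, rfl⟩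
      exact hnew e he
    have hd' : Disjoint G.verts W := Set.disjoint_right.2 hWG
    have := hG.total
    rw [surplus] at this ⊢
    rw [hV, hE, Set.ncard_union_eq hd (G.edges_finite.image f) (finite_k4Edges _ _ _ _),
      ncard_k4Edges h12 h13 h14 h23 h24 h34, hinj.ncard_image,
      Set.ncard_union_eq hd' G.verts_finite (Set.toFinite _),
      Set.ncard_eq_three.2 ⟨_, _, _, h23, h24, h34, rfl⟩]
    push_cast
    omega
  · by_cases hv : (V ∩ K).Nonempty
    · obtain ⟨k1, -, k3⟩ := key h hv
      have k4 := hG.one_le _ _ k1 ⟨v₁, Or.inl rfl⟩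
      have k5 := (h.ncard_k4 (χ := χ) h12 h13 h14 h23 h24 h34 hv).1
      rw [← hW, ← hK] at k5
      omega
    · exact hG.one_le _ _ (hold h hv) hne
  · by_cases hv : (V ∩ K).Nonempty
    · obtain ⟨k1, k2, k3⟩ := key h hv
      obtain ⟨k5, k6⟩ := h.ncard_k4 (χ := χ) h12 h13 h14 h23 h24 h34 hv
      rw [← hW, ← hK] at k5 k6
      rcases k6 with k6 | k6
      · have k4 := hG.one_le _ _ k1 ⟨v₁, Or.inl rfl⟩
        omega
      · obtain ⟨ψ, hψ⟩ := k2 φ hφ (k6 φ hφ)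
        have k4 := hG.two_le _ _ ψ k1 ⟨v₁, Or.inl rfl⟩ hψ
        omega
    · exact hG.two_le _ _ φ (hold h hv) hne hφ

end GainGraph

/-! ### Degrees, with loops counted twice -/

namespace GainedEdge

variable {α : Type*} {Γ : Type*} [Group Γ]

open Classical in
/-- The number of ends of `e` at `x`; a loop at `x` counts twice. -/
noncomputable def mult (x : α) : GainedEdge α Γ → ℕ :=
  Quotient.lift (s := gainedEdgeSetoid α Γ)
    (fun y => (if y.1 = x then 1 else 0) + (if y.2.1 = x then 1 else 0)) (by
      rintro ⟨a, b, g⟩ ⟨c, d, h⟩ (h | h) <;> simp_all [add_comm])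

open Classical in
theorem mult_gedge (x u v : α) (g : Γ) :
    (gedge u v g).mult x = (if u = x then 1 else 0) + (if v = x then 1 else 0) := rfl

theorem mult_pos {x : α} {e : GainedEdge α Γ} (h : x ∈ e.supp) : 1 ≤ e.mult x := by
  obtain ⟨y, g, rfl⟩ := exists_eq_gedge_of_mem h
  simp [mult_gedge]

theorem mult_loop (x : α) (g : Γ) : (gedge x x g).mult x = 2 := by
  simp [mult_gedge]

theorem sum_mult {V : Finset α} {e : GainedEdge α Γ} (h : e.supp ⊆ V) :
    ∑ x ∈ V, e.mult x = 2 := by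
  classical
  obtain ⟨a, b, g, rfl⟩ := e.exists_eq_gedge
  have ha : a ∈ V := h (by simp)
  have hb : b ∈ V := h (by simp)
  simp [mult_gedge, Finset.sum_add_distrib, Finset.sum_ite_eq, ha, hb]

end GainedEdge

namespace GainGraph

variable {α : Type*} {Γ : Type*} [Group Γ] {χ : Γ →* ℤˣ} {G G' : GainGraph α Γ}

/-! ### Gluing potentials -/

/-- Two subgraphs with compatible potentials whose intersection has surplus at most `2` have a
common potential. -/
theorem SignTight.glue (hG : G.SignTight χ) {V₁ V₂ : Set α} {E₁ E₂ : Set (GainedEdge α Γ)}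
    (h₁ : G.IsSub V₁ E₁) (h₂ : G.IsSub V₂ E₂) {φ₁ φ₂ : α → ℤˣ}
    (hφ₁ : ∀ e ∈ E₁, e.Compat χ φ₁) (hφ₂ : ∀ e ∈ E₂, e.Compat χ φ₂)
    (hs : surplus (V₁ ∩ V₂) (E₁ ∩ E₂) ≤ 2) :
    ∃ (φ : α → ℤˣ) (ε : ℤˣ), (∀ x ∈ V₁, φ x = φ₁ x) ∧ (∀ x ∈ V₂, φ x = ε * φ₂ x) ∧
      ∀ e ∈ E₁ ∪ E₂, e.Compat χ φ := by
  classical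
  have hI := h₁.inter h₂
  have hε : ∃ ε : ℤˣ, ∀ x ∈ V₁ ∩ V₂, φ₁ x = ε * φ₂ x := by
    by_contra hcon
    -- Compatibility with both potentials keeps every common edge inside the agreement set or inside
    -- the disagreement set. If both sets were nonempty, each would have surplus at least 2, giving
    -- 4 on the intersection.
    set D := {x ∈ V₁ ∩ V₂ | φ₁ x = φ₂ x} with hD
    set D' := {x ∈ V₁ ∩ V₂ | φ₁ x ≠ φ₂ x} with hD'
    set F := {e ∈ E₁ ∩ E₂ | e.supp ⊆ D} with hF
    set F' := {e ∈ E₁ ∩ E₂ | e.supp ⊆ D'} with hF'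
    have hDne : D.Nonempty := by
      by_contra hc
      refine hcon ⟨-1, fun x hx => ?_⟩
      rw [neg_one_mul]
      exact Int.units_ne_iff_eq_neg.1 fun h => hc ⟨x, hx, h⟩
    have hDne' : D'.Nonempty := by
      by_contra hc
      refine hcon ⟨1, fun x hx => ?_⟩
      rw [one_mul]
      by_contra h
      exact hc ⟨x, hx, h⟩
    have hV : (V₁ ∩ V₂).ncard = D.ncard + D'.ncard := by
      rw [← Set.ncard_union_eq _ (hI.finite_verts.subset (Set.sep_subset _ _))
        (hI.finite_verts.subset (Set.sep_subset _ _))]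
      · congr 1
        ext x
        constructor
        · intro hx
          by_cases hc : φ₁ x = φ₂ x
          exacts [Or.inl ⟨hx, hc⟩, Or.inr ⟨hx, hc⟩]
        · rintro (hx | hx) <;> exact hx.1
      · rw [Set.disjoint_left]
        exact fun x hx hx' => hx'.2 hx.2
    have hE : (E₁ ∩ E₂).ncard = F.ncard + F'.ncard := by
      rw [← Set.ncard_union_eq _ (hI.finite_edges.subset (Set.sep_subset _ _))
        (hI.finite_edges.subset (Set.sep_subset _ _))]
      · congr 1
        ext e
        constructor
        · intro he
          obtain ⟨a, b, g, rfl⟩ := e.exists_eq_gedge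
          have hm := hI.mem_of_gedge he
          have c1 := GainedEdge.compat_gedge.1 (hφ₁ _ he.1)
          have c2 := GainedEdge.compat_gedge.1 (hφ₂ _ he.2)
          rw [c1] at c2
          by_cases hc : φ₁ a = φ₂ a
          · left
            rw [hc] at c2
            refine ⟨he, ?_⟩
            rintro x (rfl | rfl)
            · exact ⟨hm.1, hc⟩
            · exact ⟨hm.2, mul_left_cancel c2⟩
          · right
            refine ⟨he, ?_⟩
            rintro x (rfl | rfl)
            · exact ⟨hm.1, hc⟩
            · exact ⟨hm.2, fun h => hc (by rw [h] at c2; exact mul_right_cancel c2)⟩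
        · rintro (he | he) <;> exact he.1
      · rw [Set.disjoint_left]
        intro e he he'
        obtain ⟨a, b, g, rfl⟩ := e.exists_eq_gedge
        exact (he'.2 (show a ∈ _ by simp)).2 (he.2 (show a ∈ _ by simp)).2
    have s1 := hG.two_le D F φ₁ ⟨(Set.sep_subset _ _).trans hI.verts,
      (Set.sep_subset _ _).trans hI.edges, fun e he => he.2⟩ hDne fun e he => hφ₁ e he.1.1
    have s2 := hG.two_le D' F' φ₁ ⟨(Set.sep_subset _ _).trans hI.verts,
      (Set.sep_subset _ _).trans hI.edges, fun e he => he.2⟩ hDne' fun e he => hφ₁ e he.1.1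
    rw [surplus] at s1 s2 hs
    omega
  obtain ⟨ε, hε⟩ := hε
  have hl : ∀ x ∈ V₁, (if x ∈ V₁ then φ₁ x else ε * φ₂ x) = φ₁ x := fun x hx => if_pos hx
  have hr : ∀ x ∈ V₂, (if x ∈ V₁ then φ₁ x else ε * φ₂ x) = ε * φ₂ x := by
    intro x hx
    split_ifs with hx1
    · exact hε x ⟨hx1, hx⟩
    · rfl
  refine ⟨fun x => if x ∈ V₁ then φ₁ x else ε * φ₂ x, ε, hl, hr, ?_⟩
  rintro e (he | he)
  · exact (hφ₁ e he).congr fun x hx => (hl x (h₁.supp e he hx)).symm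
  · exact ((hφ₂ e he).const_mul ε).congr fun x hx => (hr x (h₂.supp e he hx)).symm

/-! ### Vertices of low degree -/

/-- The edges incident with `v`. -/
def star (G : GainGraph α Γ) (v : α) : Set (GainedEdge α Γ) := {e ∈ G.edges | v ∈ e.supp}

theorem isSub_delete (G : GainGraph α Γ) (v : α) :
    G.IsSub (G.verts \ {v}) (G.edges \ G.star v) :=
  ⟨Set.sdiff_subset, Set.sdiff_subset, fun e he x hx =>
    ⟨G.supp_subset_verts he.1 hx, by rintro rfl; exact he.2 ⟨he.1, hx⟩⟩⟩

theorem surplus_delete {v : α} (hv : v ∈ G.verts) :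
    surplus (G.verts \ {v}) (G.edges \ G.star v) =
      surplus G.verts G.edges - 2 + (G.star v).ncard := by
  have h1 := Set.ncard_sdiff_singleton_add_one hv G.verts_finite
  have h2 := Set.ncard_sdiff_add_ncard_of_subset (show G.star v ⊆ G.edges from Set.sep_subset _ _)
    G.edges_finite
  simp only [surplus]
  omega

/-- The degrees sum to 2|E| = 4|V| - 2, so they cannot all be at least 4. -/
theorem SignTight.exists_sum_mult_le (hG : G.SignTight χ) :
    ∃ v ∈ G.verts, ∑ e ∈ G.edges_finite.toFinset, e.mult v ≤ 3 := by
  by_contra! hcon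
  have h1 : ∑ v ∈ G.verts_finite.toFinset, 4 ≤
      ∑ v ∈ G.verts_finite.toFinset, ∑ e ∈ G.edges_finite.toFinset, e.mult v :=
    Finset.sum_le_sum fun v hv => hcon v ((Set.Finite.mem_toFinset _).1 hv)
  have h2 : ∑ v ∈ G.verts_finite.toFinset, ∑ e ∈ G.edges_finite.toFinset, e.mult v =
      ∑ e ∈ G.edges_finite.toFinset, 2 := by
    rw [Finset.sum_comm]
    refine Finset.sum_congr rfl fun e he => GainedEdge.sum_mult fun x hx => ?_
    simpa using G.supp_subset_verts ((Set.Finite.mem_toFinset _).1 he) hx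
  have := hG.total
  rw [surplus, Set.ncard_eq_toFinset_card _ G.verts_finite,
    Set.ncard_eq_toFinset_card _ G.edges_finite] at this
  rw [h2] at h1
  simp only [Finset.sum_const, smul_eq_mul] at h1
  omega

/-- Three distinct non-loop edges at `v`. -/
structure IsClaw (G : GainGraph α Γ) (v a b c : α) (g h k : Γ) : Prop where
  mem_a : gedge v a g ∈ G.edges
  mem_b : gedge v b h ∈ G.edges
  mem_c : gedge v c k ∈ G.edges
  ne_a : a ≠ v
  ne_b : b ≠ v
  ne_c : c ≠ v
  ab : gedge v a g ≠ gedge v b h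
  ac : gedge v a g ≠ gedge v c k
  bc : gedge v b h ≠ gedge v c k

theorem SignTight.exists_low_degree (hG : G.SignTight χ) (hcard : 2 ≤ G.verts.ncard) :
    ∃ v ∈ G.verts,
      (∃ a b g h, a ≠ v ∧ b ≠ v ∧ gedge v a g ≠ gedge v b h ∧
        G.star v = {gedge v a g, gedge v b h}) ∨
      (∃ a l g, a ≠ v ∧ G.star v = {gedge v v l, gedge v a g}) ∨
      (∃ a b c g h k, G.IsClaw v a b c g h k ∧
        G.star v = {gedge v a g, gedge v b h, gedge v c k}) := by
  classical
  obtain ⟨v, hv, hsum⟩ := hG.exists_sum_mult_le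
  have hne : (G.verts \ {v}).Nonempty := by
    rw [← Set.ncard_pos (G.verts_finite.subset Set.sdiff_subset)]
    have h1 := Set.ncard_sdiff_singleton_add_one hv G.verts_finite
    omega
  -- Deleting `v` leaves surplus 1 - 2 + |star|, which must be at least 1 as a vertex remains.
  have hlow : 2 ≤ (G.star v).ncard := by
    have := hG.one_le _ _ (G.isSub_delete v) hne
    rw [surplus_delete hv, hG.total] at this
    omega
  have hsf : (G.star v).Finite := G.edges_finite.subset (Set.sep_subset _ _)
  have hsum' : ∀ s : Finset (GainedEdge α Γ), (s : Set (GainedEdge α Γ)) ⊆ G.star v →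
      ∑ e ∈ s, e.mult v ≤ 3 := fun s hs =>
    (Finset.sum_le_sum_of_subset fun e he =>
      (Set.Finite.mem_toFinset _).2 (hs (Finset.mem_coe.2 he)).1).trans hsum
  have hhigh : (G.star v).ncard ≤ 3 := by
    rw [Set.ncard_eq_toFinset_card _ hsf]
    refine le_trans ?_ (hsum' hsf.toFinset (by simp))
    rw [Finset.card_eq_sum_ones]
    exact Finset.sum_le_sum fun e he =>
      GainedEdge.mult_pos ((Set.Finite.mem_toFinset _).1 he).2
  refine ⟨v, hv, ?_⟩
  obtain h2 | h3 : (G.star v).ncard = 2 ∨ (G.star v).ncard = 3 := by omega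
  · obtain ⟨e₁, e₂, hne, hst⟩ := Set.ncard_eq_two.1 h2
    have m1 : e₁ ∈ G.star v := by rw [hst]; simp
    have m2 : e₂ ∈ G.star v := by rw [hst]; simp
    obtain ⟨a, g, rfl⟩ := GainedEdge.exists_eq_gedge_of_mem m1.2
    obtain ⟨b, h, rfl⟩ := GainedEdge.exists_eq_gedge_of_mem m2.2
    have := hsum' {gedge v a g, gedge v b h} (by rw [hst]; simp)
    rw [Finset.sum_pair hne] at this
    by_cases ha : a = v
    · subst ha
      refine Or.inr (Or.inl ⟨b, g, h, ?_, hst⟩)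
      rintro rfl
      rw [GainedEdge.mult_loop, GainedEdge.mult_loop] at this
      omega
    · by_cases hb : b = v
      · subst hb
        exact Or.inr (Or.inl ⟨a, h, g, ha, by rw [hst, Set.pair_comm]⟩)
      · exact Or.inl ⟨a, b, g, h, ha, hb, hne, hst⟩
  · obtain ⟨e₁, e₂, e₃, h12, h13, h23, hst⟩ := Set.ncard_eq_three.1 h3
    have m1 : e₁ ∈ G.star v := by rw [hst]; simp
    have m2 : e₂ ∈ G.star v := by rw [hst]; simp
    have m3 : e₃ ∈ G.star v := by rw [hst]; simp
    have hs := hsum' {e₁, e₂, e₃} (by rw [hst]; simp)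
    rw [Finset.sum_insert (by simp [h12, h13]), Finset.sum_pair h23] at hs
    have p1 := GainedEdge.mult_pos m1.2
    have p2 := GainedEdge.mult_pos m2.2
    have p3 := GainedEdge.mult_pos m3.2
    obtain ⟨a, g, rfl⟩ := GainedEdge.exists_eq_gedge_of_mem m1.2
    obtain ⟨b, h, rfl⟩ := GainedEdge.exists_eq_gedge_of_mem m2.2
    obtain ⟨c, k, rfl⟩ := GainedEdge.exists_eq_gedge_of_mem m3.2
    refine Or.inr (Or.inr ⟨a, b, c, g, h, k, ⟨m1.1, m2.1, m3.1, ?_, ?_, ?_, h12, h13, h23⟩, hst⟩)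
    · rintro rfl
      have := GainedEdge.mult_loop a g
      omega
    · rintro rfl
      have := GainedEdge.mult_loop b h
      omega
    · rintro rfl
      have := GainedEdge.mult_loop c k
      omega

/-! ### Vertex deletion -/

/-- The gain graph obtained by deleting the vertex `v`. -/
def delete (G : GainGraph α Γ) (v : α) : GainGraph α Γ := (G.isSub_delete v).toGainGraph

theorem IsSub.of_delete {v : α} {V : Set α} {E : Set (GainedEdge α Γ)}
    (h : (G.delete v).IsSub V E) : G.IsSub V E :=
  ⟨h.verts.trans Set.sdiff_subset, h.edges.trans Set.sdiff_subset, h.supp⟩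

theorem SignTight.delete (hG : G.SignTight χ) {v : α} (hv : v ∈ G.verts)
    (hs : (G.star v).ncard = 2) : (G.delete v).SignTight χ := by
  refine ⟨?_, fun V E h => hG.one_le V E h.of_delete,
    fun V E φ h => hG.two_le V E φ h.of_delete⟩
  change surplus (G.verts \ {v}) (G.edges \ G.star v) = 1
  rw [surplus_delete hv, hG.total, hs]
  norm_num

theorem star_union (G : GainGraph α Γ) (v : α) : G.edges \ G.star v ∪ G.star v = G.edges :=
  Set.sdiff_union_of_subset (Set.sep_subset _ _)

theorem insert_sdiff_vertex {v : α} (hv : v ∈ G.verts) : insert v (G.verts \ {v}) = G.verts := by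
  rw [Set.insert_sdiff_singleton, Set.insert_eq_of_mem hv]

theorem zeroExtension_delete {v a b : α} {g h : Γ} (hv : v ∈ G.verts) (ha : a ≠ v) (hb : b ≠ v)
    (hne : gedge v a g ≠ gedge v b h) (hs : G.star v = {gedge v a g, gedge v b h}) :
    ZeroExtension (G.delete v) G := by
  have m1 : gedge v a g ∈ G.star v := by rw [hs]; simp
  have m2 : gedge v b h ∈ G.star v := by rw [hs]; simp
  refine ⟨v, a, b, g, h, fun h' => h'.2 rfl, ⟨(G.ends_mem _ _ _ m1.1).2, ha⟩,
    ⟨(G.ends_mem _ _ _ m2.1).2, hb⟩, hne, (insert_sdiff_vertex hv).symm, ?_⟩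
  rw [← hs]
  exact (G.star_union v).symm

/-- A loop of trivial sign would be a subgraph of surplus 1 compatible with the constant potential.
-/
theorem SignTight.map_loop_ne_one (hG : G.SignTight χ) {v : α} {l : Γ}
    (h : gedge v v l ∈ G.edges) : χ l ≠ 1 := by
  intro hl
  have hv := (G.ends_mem _ _ _ h).1
  have := hG.two_le {v} {gedge v v l} 1 ⟨by simpa, by simpa, by simp⟩ ⟨v, rfl⟩ (by
    rintro e rfl
    simp [hl])
  simp [surplus] at this

theorem loopOneExtension_delete {G : GainGraph α ZReflective}
    (hG : G.SignTight SemidirectProduct.rightHom) {v a : α} {l g : ZReflective}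
    (hv : v ∈ G.verts) (ha : a ≠ v) (hs : G.star v = {gedge v v l, gedge v a g}) :
    LoopOneExtension (G.delete v) G := by
  have m1 : gedge v v l ∈ G.star v := by rw [hs]; simp
  have m2 : gedge v a g ∈ G.star v := by rw [hs]; simp
  refine ⟨v, a, l, g, fun h' => h'.2 rfl, ⟨(G.ends_mem _ _ _ m2.1).2, ha⟩,
    hG.map_loop_ne_one m1.1, (insert_sdiff_vertex hv).symm, ?_⟩
  rw [← hs]
  exact (G.star_union v).symm

/-! ### Reducing vertices of degree three -/

/-- An obstruction to inserting the edge `(a, b; k)` into `G` without `v`. -/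
def Blocked (χ : Γ →* ℤˣ) (G : GainGraph α Γ) (v a b : α) (k : Γ) : Prop :=
  ∃ V E, G.IsSub V E ∧ v ∉ V ∧ a ∈ V ∧ b ∈ V ∧
    (surplus V E ≤ 1 ∨
      surplus V E ≤ 2 ∧ ∃ φ : α → ℤˣ, (∀ e ∈ E, e.Compat χ φ) ∧ χ k = φ a * φ b)

theorem Blocked.symm {v a b : α} {k : Γ} (h : Blocked χ G v a b k) : Blocked χ G v b a k⁻¹ := by
  obtain ⟨V, E, h, hv, ha, hb, h1 | ⟨h1, φ, hφ, hk⟩⟩ := h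
  · exact ⟨V, E, h, hv, hb, ha, Or.inl h1⟩
  · exact ⟨V, E, h, hv, hb, ha, Or.inr ⟨h1, φ, hφ, by
      rw [map_inv, Int.units_inv_eq_self, hk, mul_comm]⟩⟩

namespace IsClaw

variable {v a b c : α} {g h k : Γ}

theorem rotate (H : G.IsClaw v a b c g h k) : G.IsClaw v b c a h k g :=
  ⟨H.mem_b, H.mem_c, H.mem_a, H.ne_b, H.ne_c, H.ne_a, H.bc, H.ab.symm, H.ac.symm⟩

theorem swap (H : G.IsClaw v a b c g h k) : G.IsClaw v b a c h g k :=
  ⟨H.mem_b, H.mem_a, H.mem_c, H.ne_b, H.ne_a, H.ne_c, H.ab.symm, H.bc, H.ac⟩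

theorem isSub_insert (H : G.IsClaw v a b c g h k) {V : Set α} {E : Set (GainedEdge α Γ)}
    (hs : G.IsSub V E) (hv : v ∉ V) (ha : a ∈ V) (hb : b ∈ V) (hc : c ∈ V) :
    G.IsSub (insert v V) (insert (gedge v a g) (insert (gedge v b h) (insert (gedge v c k) E))) ∧
    surplus (insert v V) (insert (gedge v a g) (insert (gedge v b h) (insert (gedge v c k) E))) =
      surplus V E - 1 := by
  have hV : v ∈ G.verts := (G.ends_mem _ _ _ H.mem_a).1
  have s0 := hs.insert_vertex hV
  have s1 := s0.insert_edge H.mem_c (Or.inl rfl) (Or.inr hc)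
  have s2 := s1.insert_edge H.mem_b (Or.inl rfl) (Or.inr hb)
  have s3 := s2.insert_edge H.mem_a (Or.inl rfl) (Or.inr ha)
  refine ⟨s3, ?_⟩
  rw [s2.surplus_insert_edge, s1.surplus_insert_edge, s0.surplus_insert_edge,
    hs.surplus_insert_vertex hv]
  · ring
  · exact hs.notMem_edges hv
  · rintro (h' | h')
    · exact H.bc h'
    · exact hs.notMem_edges hv h'
  · rintro (h' | h' | h')
    · exact H.ab h'
    · exact H.ac h'
    · exact hs.notMem_edges hv h'

/-- Adjoining `v` with its three edges lowers the surplus by 1 and must leave at least 1. -/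
theorem two_le (H : G.IsClaw v a b c g h k) (hG : G.SignTight χ) {V : Set α}
    {E : Set (GainedEdge α Γ)} (hs : G.IsSub V E) (hv : v ∉ V) (ha : a ∈ V) (hb : b ∈ V)
    (hc : c ∈ V) : 2 ≤ surplus V E := by
  obtain ⟨h1, h2⟩ := H.isSub_insert hs hv ha hb hc
  have := hG.one_le _ _ h1 ⟨v, Or.inl rfl⟩
  omega

/-- The sign conditions say exactly that the potential extends to `v`, so after adjoining `v` at
least 2 must remain. -/
theorem three_le (H : G.IsClaw v a b c g h k) (hG : G.SignTight χ) {V : Set α}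
    {E : Set (GainedEdge α Γ)} (hs : G.IsSub V E) (hv : v ∉ V) (ha : a ∈ V) (hb : b ∈ V)
    (hc : c ∈ V) {φ : α → ℤˣ} (hφ : ∀ e ∈ E, e.Compat χ φ)
    (hab : χ (g⁻¹ * h) = φ a * φ b) (hac : χ (g⁻¹ * k) = φ a * φ c) : 3 ≤ surplus V E := by
  classical
  obtain ⟨h1, h2⟩ := H.isSub_insert hs hv ha hb hc
  set ψ := Function.update φ v (χ g * φ a) with hψ
  have hψv : ψ v = χ g * φ a := by simp [hψ]
  have hψV : ∀ x ∈ V, φ x = ψ x := by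
    intro x hx
    have : x ≠ v := by rintro rfl; exact hv hx
    simp [hψ, this]
  simp only [map_mul, map_inv, Int.units_inv_eq_self] at hab hac
  have := hG.two_le _ _ ψ h1 ⟨v, Or.inl rfl⟩ (by
    rintro e (rfl | rfl | rfl | he)
    · rw [GainedEdge.compat_gedge, hψv, ← hψV a ha, mul_assoc, Int.units_mul_self, mul_one]
    · rw [GainedEdge.compat_gedge, hψv, ← hψV b hb, mul_assoc, ← hab, ← mul_assoc,
        Int.units_mul_self, one_mul]
    · rw [GainedEdge.compat_gedge, hψv, ← hψV c hc, mul_assoc, ← hac, ← mul_assoc,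
        Int.units_mul_self, one_mul]
    · exact (hφ e he).congr fun x hx => hψV x (hs.supp e he hx))
  omega

/-- At most one of the three edges that could replace a vertex of degree three is blocked. -/
theorem not_blocked_and_blocked (H : G.IsClaw v a b c g h k) (hG : G.SignTight χ)
    (h₁ : Blocked χ G v a b (g⁻¹ * h)) (h₂ : Blocked χ G v b c (h⁻¹ * k)) : False := by
  obtain ⟨V₁, E₁, s₁, hv₁, ha, hb₁, d₁⟩ := h₁
  obtain ⟨V₂, E₂, s₂, hv₂, hb₂, hc, d₂⟩ := h₂
  have hsum := s₁.surplus_union_add_inter s₂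
  have hne : (V₁ ∩ V₂).Nonempty := ⟨b, hb₁, hb₂⟩
  have hvU : v ∉ V₁ ∪ V₂ := by rintro (h | h) <;> contradiction
  -- The union contains all three neighbours of `v`. A potential on either side raises the bound for
  -- the intersection to 2, which settles every case except two potentials.
  have hU := H.two_le hG (s₁.union s₂) hvU (Or.inl ha) (Or.inl hb₁) (Or.inr hc)
  have hI := hG.one_le _ _ (s₁.inter s₂) hne
  rcases d₁ with d₁ | ⟨d₁, φ₁, hφ₁, k₁⟩
  · rcases d₂ with d₂ | ⟨d₂, φ₂, hφ₂, k₂⟩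
    · omega
    · have := hG.two_le _ _ φ₂ (s₁.inter s₂) hne fun e he => hφ₂ e he.2
      omega
  · have hI2 := hG.two_le _ _ φ₁ (s₁.inter s₂) hne fun e he => hφ₁ e he.1
    rcases d₂ with d₂ | ⟨d₂, φ₂, hφ₂, k₂⟩
    · omega
    -- The surpluses add to at most 4 and the union takes at least 2, so the intersection has at
    -- most 2 and gluing applies. The glued potential then fits `v`, forcing 3 + 2 on the left of
    -- the modular identity.
    · obtain ⟨φ, ε, e₁, e₂, hφ⟩ := hG.glue s₁ s₂ hφ₁ hφ₂ (by omega)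
      have k₂' : χ (h⁻¹ * k) = φ b * φ c := by
        rw [k₂, e₂ b hb₂, e₂ c hc, mul_mul_mul_comm, Int.units_mul_self, one_mul]
      rw [← e₁ a ha, ← e₁ b hb₁] at k₁
      have k₃ : χ (g⁻¹ * k) = φ a * φ c := by
        rw [show g⁻¹ * k = (g⁻¹ * h) * (h⁻¹ * k) by group, map_mul, k₁, k₂', mul_assoc,
          ← mul_assoc (φ b), Int.units_mul_self, one_mul]
      have := H.three_le hG (s₁.union s₂) hvU (Or.inl ha) (Or.inl hb₁) (Or.inr hc) hφ k₁ k₃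
      omega

/-- If two of the edges that could replace a vertex of degree three are present, then the third
one is not blocked. -/
theorem not_blocked_of_mem (H : G.IsClaw v a b c g h k) (hG : G.SignTight χ)
    (hca : c ≠ a) (hcb : c ≠ b) (mac : gedge a c (g⁻¹ * k) ∈ G.edges)
    (mbc : gedge b c (h⁻¹ * k) ∈ G.edges) : ¬ Blocked χ G v a b (g⁻¹ * h) := by
  classical
  rintro ⟨V, E, s, hv, ha, hb, d⟩
  have hcG : c ∈ G.verts := (G.ends_mem _ _ _ mac).2
  by_cases hc : c ∈ V
  · have h2 := H.two_le hG s hv ha hb hc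
    rcases d with d | ⟨d, φ, hφ, hk⟩
    · omega
    · by_cases hm : gedge a c (g⁻¹ * k) ∈ E
      · have := H.three_le hG s hv ha hb hc hφ hk (GainedEdge.compat_gedge.1 (hφ _ hm))
        omega
      -- The missing edge `ac` can be added, dropping the surplus to at most 1.
      · have := H.two_le hG (s.insert_edge mac ha hc) hv ha hb hc
        rw [s.surplus_insert_edge hm] at this
        omega
  -- Adding `c` with the edges `ac` and `bc` keeps the surplus and brings in the third neighbour; a
  -- potential extends to `c` because the three gains multiply consistently around the triangle.
  · have s0 := s.insert_vertex hcG
    have s1 := s0.insert_edge mac (Or.inr ha) (Or.inl rfl)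
    have s2 := s1.insert_edge mbc (Or.inr hb) (Or.inl rfl)
    have nac : ∀ x l, gedge x c l ∉ E := fun x l h' => hc (s.mem_of_gedge h').2
    have hvc : v ∉ insert c V := by
      rintro (h' | h')
      · exact H.ne_c h'.symm
      · exact hv h'
    have hsur : surplus (insert c V)
        (insert (gedge b c (h⁻¹ * k)) (insert (gedge a c (g⁻¹ * k)) E)) = surplus V E := by
      rw [s1.surplus_insert_edge, s0.surplus_insert_edge (nac _ _), s.surplus_insert_vertex hc]
      · ring
      · rintro (h' | h')
        · rcases gedge_eq_iff.1 h' with ⟨rfl, -, h3⟩ | ⟨h3, -, -⟩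
          · exact H.ab (by rw [inv_inj.1 (mul_right_cancel h3)])
          · exact hcb h3.symm
        · exact nac _ _ h'
    rcases d with d | ⟨d, φ, hφ, hk⟩
    · have := H.two_le hG s2 hvc (Or.inr ha) (Or.inr hb) (Or.inl rfl)
      omega
    · set ψ := Function.update φ c (φ a * χ (g⁻¹ * k)) with hψ
      have hψc : ψ c = φ a * χ (g⁻¹ * k) := by simp [hψ]
      have hψV : ∀ x ∈ V, φ x = ψ x := by
        intro x hx
        have : x ≠ c := by rintro rfl; exact hc hx
        simp [hψ, this]
      have hac : χ (g⁻¹ * k) = ψ a * ψ c := by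
        rw [hψc, ← hψV a ha, ← mul_assoc, Int.units_mul_self, one_mul]
      rw [hψV a ha, hψV b hb] at hk
      have := H.three_le hG s2 hvc (Or.inr ha) (Or.inr hb) (Or.inl rfl) (φ := ψ) (by
        rintro e (rfl | rfl | he)
        · rw [GainedEdge.compat_gedge,
            show h⁻¹ * k = (g⁻¹ * h)⁻¹ * (g⁻¹ * k) by group, map_mul, map_inv,
            Int.units_inv_eq_self, hk, hac, mul_mul_mul_comm, Int.units_mul_self, one_mul]
        · exact hac
        · exact (hφ e he).congr fun x hx => hψV x (s.supp e he hx)) hk hac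
      omega

end IsClaw

/-- The gain graph obtained by replacing the vertex `v` by the edge `(a, b; k)`. -/
def replaceByEdge (G : GainGraph α Γ) (v a b : α) (k : Γ) (ha : a ∈ G.verts \ {v})
    (hb : b ∈ G.verts \ {v}) (hk : a = b → k ≠ 1) : GainGraph α Γ where
  verts := G.verts \ {v}
  edges := insert (gedge a b k) (G.edges \ G.star v)
  verts_finite := G.verts_finite.subset Set.sdiff_subset
  edges_finite := (G.edges_finite.subset Set.sdiff_subset).insert _
  ends_mem x y l h := by
    rcases h with h | h
    · rcases gedge_eq_iff.1 h with ⟨rfl, rfl, -⟩ | ⟨rfl, rfl, -⟩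
      exacts [⟨ha, hb⟩, ⟨hb, ha⟩]
    · exact (G.isSub_delete v).mem_of_gedge h
  loop_gain_ne_one x l h := by
    rcases h with h | h
    · rcases gedge_eq_iff.1 h with ⟨rfl, rfl, rfl⟩ | ⟨rfl, rfl, rfl⟩
      · exact hk rfl
      · exact fun h' => hk rfl (inv_eq_one.1 h')
    · exact G.loop_gain_ne_one x l h.1

/-- A subgraph violating a bound after the replacement must contain the new edge; without it, that
subgraph is precisely a witness of `Blocked`. -/
theorem IsClaw.exists_reduction {v a b c : α} {g h k : Γ} (H : G.IsClaw v a b c g h k)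
    (hG : G.SignTight χ) (hs : G.star v = {gedge v a g, gedge v b h, gedge v c k})
    (hne : gedge a b (g⁻¹ * h) ∉ G.edges) (hb : ¬ Blocked χ G v a b (g⁻¹ * h)) :
    ∃ G₁ : GainGraph α Γ, G₁.SignTight χ ∧ G₁.verts = G.verts \ {v} ∧ OneExtension G₁ G := by
  have hv : v ∈ G.verts := (G.ends_mem _ _ _ H.mem_a).1
  have ha' : a ∈ G.verts \ {v} := ⟨(G.ends_mem _ _ _ H.mem_a).2, H.ne_a⟩
  have hb' : b ∈ G.verts \ {v} := ⟨(G.ends_mem _ _ _ H.mem_b).2, H.ne_b⟩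
  have hc' : c ∈ G.verts \ {v} := ⟨(G.ends_mem _ _ _ H.mem_c).2, H.ne_c⟩
  have hcard : (G.star v).ncard = 3 := by
    rw [hs]; exact Set.ncard_eq_three.2 ⟨_, _, _, H.ab, H.ac, H.bc, rfl⟩
  -- If the ends coincide the new edge is a loop, with non-trivial gain because the two edges it
  -- replaces are distinct.
  have hk : a = b → g⁻¹ * h ≠ 1 := by
    rintro rfl h1
    exact H.ab (by rw [inv_mul_eq_one.1 h1])
  refine ⟨G.replaceByEdge v a b (g⁻¹ * h) ha' hb' hk, ?_, rfl, ?_⟩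
  · have hnm : gedge a b (g⁻¹ * h) ∉ G.edges \ G.star v := fun h' => hne h'.1
    have old : ∀ {V E}, (G.replaceByEdge v a b (g⁻¹ * h) ha' hb' hk).IsSub V E →
        v ∉ V ∧ G.IsSub V (E \ {gedge a b (g⁻¹ * h)}) := by
      intro V E s
      refine ⟨fun h' => (s.verts h').2 rfl, s.verts.trans Set.sdiff_subset, ?_,
        fun e he => s.supp e he.1⟩
      rintro e ⟨he, he'⟩
      exact ((s.edges he).resolve_left he').1
    have hsur : ∀ {V E}, (G.replaceByEdge v a b (g⁻¹ * h) ha' hb' hk).IsSub V E →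
        gedge a b (g⁻¹ * h) ∈ E →
        surplus V E = surplus V (E \ {gedge a b (g⁻¹ * h)}) - 1 := by
      intro V E s hm
      rw [← (old s).2.surplus_insert_edge (e := gedge a b (g⁻¹ * h)) (fun h' => h'.2 rfl),
        Set.insert_sdiff_singleton, Set.insert_eq_of_mem hm]
    refine ⟨?_, fun V E s hV => ?_, fun V E φ s hV hφ => ?_⟩
    · change surplus (G.verts \ {v}) (insert _ (G.edges \ G.star v)) = 1
      rw [(G.isSub_delete v).surplus_insert_edge hnm, surplus_delete hv, hG.total, hcard]
      norm_num
    · obtain ⟨hvV, s'⟩ := old s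
      by_cases hm : gedge a b (g⁻¹ * h) ∈ E
      · rw [hsur s hm]
        by_contra hcon
        have hm' := s.mem_of_gedge hm
        exact hb ⟨V, _, s', hvV, hm'.1, hm'.2, Or.inl (by omega)⟩
      · rw [Set.sdiff_singleton_eq_self hm] at s'
        exact hG.one_le _ _ s' hV
    · obtain ⟨hvV, s'⟩ := old s
      by_cases hm : gedge a b (g⁻¹ * h) ∈ E
      · rw [hsur s hm]
        by_contra hcon
        have hm' := s.mem_of_gedge hm
        exact hb ⟨V, _, s', hvV, hm'.1, hm'.2, Or.inr ⟨by omega, φ, fun e he => hφ e he.1,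
          GainedEdge.compat_gedge.1 (hφ _ hm)⟩⟩
      · rw [Set.sdiff_singleton_eq_self hm] at s'
        exact hG.two_le _ _ φ s' hV hφ
  · refine ⟨v, a, b, c, g⁻¹ * h, g, h, k, fun h' => h'.2 rfl, hc', Or.inl rfl, rfl, H.ab, H.ac,
      H.bc, (insert_sdiff_vertex hv).symm, ?_⟩
    rw [← hs]
    change G.edges = insert (gedge a b (g⁻¹ * h)) (G.edges \ G.star v) \ _ ∪ G.star v
    rw [Set.insert_sdiff_of_mem _ (Set.mem_singleton _), Set.sdiff_singleton_eq_self (fun h' => hne h'.1), star_union]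

/-- A vertex of degree three can be replaced by an edge, unless it lies in a balanced `K_4`. -/
theorem IsClaw.exists_reduction_or {v a b c : α} {g h k : Γ} (H : G.IsClaw v a b c g h k)
    (hG : G.SignTight χ) (hs : G.star v = {gedge v a g, gedge v b h, gedge v c k}) :
    (∃ G₁ : GainGraph α Γ, G₁.SignTight χ ∧ G₁.verts = G.verts \ {v} ∧ OneExtension G₁ G) ∨
    (a ≠ b ∧ a ≠ c ∧ b ≠ c ∧ gedge a b (g⁻¹ * h) ∈ G.edges ∧ gedge a c (g⁻¹ * k) ∈ G.edges ∧
      gedge b c (h⁻¹ * k) ∈ G.edges) := by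
  refine or_iff_not_imp_left.2 fun hred => ?_
  have key : ∀ {a b c g h k}, G.IsClaw v a b c g h k →
      G.star v = {gedge v a g, gedge v b h, gedge v c k} →
      Blocked χ G v a b (g⁻¹ * h) ∨ (a ≠ b ∧ gedge a b (g⁻¹ * h) ∈ G.edges) := by
    intro a b c g h k H hs
    by_contra hcon
    push Not at hcon
    by_cases hm : gedge a b (g⁻¹ * h) ∈ G.edges
    · have hab : a = b := by by_contra hab; exact hcon.2 hab hm
      subst hab
      have haG := (G.ends_mem _ _ _ hm).1
      -- A candidate already present as a loop blocks itself: one vertex with a loop has surplus 1.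
      refine hcon.1 ⟨{a}, {gedge a a (g⁻¹ * h)}, ⟨by simpa, by simpa, by simp⟩, H.ne_a.symm, rfl,
        rfl, Or.inl ?_⟩
      simp [surplus]
    · exact hred (H.exists_reduction hG hs hm hcon.1)
  have kab := key H hs
  have kbc := key H.rotate (by rw [hs]; ext; simp; tauto)
  have kac := key H.swap.rotate (by rw [hs]; ext; simp; tauto)
  have inv_eq : ∀ x y : Γ, (x⁻¹ * y)⁻¹ = y⁻¹ * x := fun x y => by group
  rcases kab with kab | ⟨nab, mab⟩
  · exfalso
    rcases kbc with kbc | ⟨nbc, mbc⟩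
    · exact H.not_blocked_and_blocked hG kab kbc
    rcases kac with kac | ⟨nac, mac⟩
    · have := kab.symm
      rw [inv_eq] at this
      exact H.swap.not_blocked_and_blocked hG this kac
    · exact H.not_blocked_of_mem hG nac.symm nbc.symm mac mbc kab
  · rcases kbc with kbc | ⟨nbc, mbc⟩
    · exfalso
      rcases kac with kac | ⟨nac, mac⟩
      · have := kac.symm
        rw [inv_eq] at this
        exact H.rotate.not_blocked_and_blocked hG kbc this
      · refine H.rotate.not_blocked_of_mem hG nab nac ?_ ?_ kbc
        · rwa [gedge_symm, inv_eq] at mab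
        · rwa [gedge_symm, inv_eq] at mac
    · rcases kac with kac | ⟨nac, mac⟩
      · exfalso
        refine H.swap.rotate.not_blocked_of_mem hG nab.symm nbc mab ?_ kac
        rwa [gedge_symm, inv_eq] at mbc
      · exact ⟨nab, nac, nbc, mab, mac, mbc⟩

end GainGraph

namespace GainGraph

variable {α : Type*} {Γ : Type*} [Group Γ] {χ : Γ →* ℤˣ} {G G' : GainGraph α Γ}

/-! ### Simultaneous switching -/

theorem eq_of_verts_of_edges (hV : G.verts = G'.verts) (hE : G.edges = G'.edges) : G = G' := by
  cases G; cases G'; cases hV; cases hE; rfl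

/-- Switching at all vertices simultaneously. -/
def switchBy (G : GainGraph α Γ) (σ : α → Γ) : GainGraph α Γ where
  verts := G.verts
  edges := GainedEdge.switch σ '' G.edges
  verts_finite := G.verts_finite
  edges_finite := G.edges_finite.image _
  ends_mem u v g h := by
    obtain ⟨e, he, h⟩ := h
    have := G.supp_subset_verts he
    rw [← GainedEdge.supp_switch σ, h] at this
    exact ⟨this (by simp), this (by simp)⟩
  loop_gain_ne_one v g h := by
    rintro rfl
    obtain ⟨e, he, h⟩ := h
    obtain ⟨a, b, k, rfl⟩ := e.exists_eq_gedge
    rw [GainedEdge.switch_gedge, gedge_eq_iff, inv_one, or_self] at h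
    obtain ⟨rfl, rfl, h⟩ := h
    exact G.loop_gain_ne_one _ k he (conj_eq_one_iff.1 h)

theorem mem_switchBy {σ : α → Γ} {a b : α} {g : Γ} :
    gedge a b (σ a * g * (σ b)⁻¹) ∈ (G.switchBy σ).edges ↔ gedge a b g ∈ G.edges :=
  (GainedEdge.switch_injective σ).mem_set_image (s := G.edges) (a := gedge a b g)

theorem SignTight.switchBy (hG : G.SignTight χ) (σ : α → Γ) : (G.switchBy σ).SignTight χ :=
  hG.of_switch σ rfl rfl

theorem switchBy_switchBy (σ τ : α → Γ) : (G.switchBy τ).switchBy σ = G.switchBy (σ * τ) := by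
  refine eq_of_verts_of_edges rfl ?_
  change GainedEdge.switch σ '' (GainedEdge.switch τ '' G.edges) = _
  rw [Set.image_image]
  exact Set.image_congr fun e _ => (GainedEdge.switch_mul σ τ e).symm

theorem switchBy_congr {σ τ : α → Γ} (h : ∀ x ∈ G.verts, σ x = τ x) :
    G.switchBy σ = G.switchBy τ := by
  refine eq_of_verts_of_edges rfl (Set.image_congr fun e he => ?_)
  obtain ⟨a, b, g, rfl⟩ := e.exists_eq_gedge
  obtain ⟨ha, hb⟩ := G.ends_mem _ _ _ he
  simp [h a ha, h b hb]

theorem switchBy_one : G.switchBy 1 = G := by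
  refine eq_of_verts_of_edges rfl ?_
  change GainedEdge.switch 1 '' G.edges = G.edges
  rw [Set.image_congr fun e _ => GainedEdge.switch_one e, Set.image_id']

/-- Switch at one vertex after another; there are finitely many, and values of `σ` off the vertex
set have no effect. -/
theorem reflTransGen_switchBy (G : GainGraph α Γ) (σ : α → Γ) :
    Relation.ReflTransGen Switching G (G.switchBy σ) := by
  classical
  have key : ∀ s : Finset α, (s : Set α) ⊆ G.verts →
      Relation.ReflTransGen Switching G (G.switchBy fun x => if x ∈ s then σ x else 1) := by
    intro s
    induction s using Finset.induction with
    | empty =>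
      intro _
      have h : G.switchBy (fun x => if x ∈ (∅ : Finset α) then σ x else 1) = G := by
        rw [switchBy_congr (τ := 1) (by simp), switchBy_one]
      rw [h]
    | insert a s ha ih =>
      intro hs
      refine (ih fun x hx => hs (by simp [Finset.mem_coe.1 hx])).tail
        ⟨a, hs (by simp), σ a, rfl, fun x y g => ?_⟩
      have h : G.switchBy (fun x => if x ∈ insert a s then σ x else 1) =
          (G.switchBy fun x => if x ∈ s then σ x else 1).switchBy
            fun x => if x = a then σ a else 1 := by
        rw [switchBy_switchBy]
        refine switchBy_congr fun x _ => ?_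
        by_cases hx : x = a
        · subst hx; simp [ha]
        · simp [hx]
      rw [h]
      convert mem_switchBy (G := G.switchBy fun x => if x ∈ s then σ x else 1)
        (σ := fun x => if x = a then σ a else 1) using 5
  have := key G.verts_finite.toFinset (by simp)
  rwa [switchBy_congr (τ := σ)] at this
  intro x hx
  simp [hx]

/-! ### Contractions -/

end GainGraph

namespace GainedEdge

variable {α : Type*} {Γ : Type*} [Group Γ]

/-- The image of an edge under a map of vertices. -/
def map (ρ : α → α) : GainedEdge α Γ → GainedEdge α Γ :=
  Quotient.lift (s := gainedEdgeSetoid α Γ) (fun x => gedge (ρ x.1) (ρ x.2.1) x.2.2) (by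
    rintro ⟨a, b, g⟩ ⟨c, d, h⟩ (h | h) <;> simp_all [gedge_eq_iff])

@[simp] theorem map_gedge (ρ : α → α) (a b : α) (g : Γ) :
    (gedge a b g).map ρ = gedge (ρ a) (ρ b) g := rfl

theorem supp_map (ρ : α → α) (e : GainedEdge α Γ) : (e.map ρ).supp = ρ '' e.supp := by
  obtain ⟨a, b, g, rfl⟩ := e.exists_eq_gedge
  simp [Set.image_pair]

theorem Compat.of_map {χ : Γ →* ℤˣ} {φ : α → ℤˣ} {ρ : α → α} {e : GainedEdge α Γ}
    (h : (e.map ρ).Compat χ φ) : e.Compat χ (φ ∘ ρ) := by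
  obtain ⟨a, b, g, rfl⟩ := e.exists_eq_gedge
  exact h

theorem map_eq_self {ρ : α → α} {e : GainedEdge α Γ} (h : ∀ x ∈ e.supp, ρ x = x) :
    e.map ρ = e := by
  obtain ⟨a, b, g, rfl⟩ := e.exists_eq_gedge
  rw [map_gedge, h a (by simp), h b (by simp)]

end GainedEdge

namespace GainGraph

variable {α : Type*} {Γ : Type*} [Group Γ] {χ : Γ →* ℤˣ} {G G' : GainGraph α Γ}

open Classical in
/-- The map of vertices that sends all of `W` to `v`. -/
noncomputable def collapse (W : Set α) (v : α) (x : α) : α := if x ∈ W then v else x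

theorem collapse_of_mem {W : Set α} {v x : α} (h : x ∈ W) : collapse W v x = v := if_pos h

theorem collapse_of_notMem {W : Set α} {v x : α} (h : x ∉ W) : collapse W v x = x := if_neg h

theorem eq_or_mem_of_collapse_eq {W : Set α} {v x y : α} (h : collapse W v x = collapse W v y) :
    x = y ∨ x ∈ insert v W ∧ y ∈ insert v W := by
  by_cases hx : x ∈ W <;> by_cases hy : y ∈ W <;> simp_all [collapse]

/-- Contracting `W` to the vertex `v` after deleting the edges in `F`. -/
noncomputable def contract (G : GainGraph α Γ) (W : Set α) (v : α) (F : Set (GainedEdge α Γ))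
    (hv : v ∈ G.verts) (hvW : v ∉ W)
    (hloop : ∀ p q, gedge p q 1 ∈ G.edges \ F → collapse W v p ≠ collapse W v q) :
    GainGraph α Γ where
  verts := G.verts \ W
  edges := GainedEdge.map (collapse W v) '' (G.edges \ F)
  verts_finite := G.verts_finite.subset Set.sdiff_subset
  edges_finite := (G.edges_finite.subset Set.sdiff_subset).image _
  ends_mem a b g h := by
    obtain ⟨e, he, h⟩ := h
    have hs : ∀ x ∈ (gedge a b g).supp, x ∈ G.verts \ W := by
      intro x hx
      rw [← h, GainedEdge.supp_map] at hx
      obtain ⟨y, hy, rfl⟩ := hx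
      by_cases hyW : y ∈ W
      · rw [collapse_of_mem hyW]; exact ⟨hv, hvW⟩
      · rw [collapse_of_notMem hyW]; exact ⟨G.supp_subset_verts he.1 hy, hyW⟩
    exact ⟨hs a (by simp), hs b (by simp)⟩
  loop_gain_ne_one u g h := by
    rintro rfl
    obtain ⟨e, he, h⟩ := h
    obtain ⟨a, b, k, rfl⟩ := e.exists_eq_gedge
    rw [GainedEdge.map_gedge, gedge_eq_iff, inv_one, or_self] at h
    obtain ⟨h1, h2, rfl⟩ := h
    exact hloop a b he (h1.trans h2.symm)

section Contract

variable {W : Set α} {v : α} {F : Set (GainedEdge α Γ)} {hv : v ∈ G.verts} {hvW : v ∉ W}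
  {hloop : ∀ p q, gedge p q 1 ∈ G.edges \ F → collapse W v p ≠ collapse W v q}

theorem IsSub.of_contract {V : Set α} {E : Set (GainedEdge α Γ)}
    (h : (G.contract W v F hv hvW hloop).IsSub V E) (hV : v ∉ V) : G.IsSub V E := by
  refine ⟨h.verts.trans Set.sdiff_subset, fun e he => ?_, h.supp⟩
  obtain ⟨e', he', rfl⟩ := h.edges he
  have hs := h.supp _ he
  rw [GainedEdge.supp_map] at hs
  rw [GainedEdge.map_eq_self]
  · exact he'.1
  · intro x hx
    refine collapse_of_notMem fun hxW => hV ?_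
    have := hs ⟨x, hx, rfl⟩
    rwa [collapse_of_mem hxW] at this

/-- The preimage of a subgraph of a contraction. -/
theorem IsSub.expand {V : Set α} {E : Set (GainedEdge α Γ)} (hW : W ⊆ G.verts)
    (hinj : Set.InjOn (GainedEdge.map (collapse W v)) (G.edges \ F))
    (h : (G.contract W v F hv hvW hloop).IsSub V E) :
    ∃ D ⊆ G.edges \ F, D = {e ∈ G.edges \ F | e.map (collapse W v) ∈ E} ∧ G.IsSub (V ∪ W) D ∧
      surplus (V ∪ W) D = surplus V E + 2 * W.ncard ∧
      ∀ φ : α → ℤˣ, (∀ e ∈ E, e.Compat χ φ) → ∀ e ∈ D, e.Compat χ (φ ∘ collapse W v) := by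
  refine ⟨_, Set.sep_subset _ _, rfl, ⟨?_, ?_, ?_⟩, ?_, fun φ hφ e he => (hφ _ he.2).of_map⟩
  · exact Set.union_subset (h.verts.trans Set.sdiff_subset) hW
  · exact fun e he => he.1.1
  · rintro e ⟨he, heE⟩ x hx
    by_cases hxW : x ∈ W
    · exact Or.inr hxW
    · left
      have hs := h.supp _ heE
      rw [GainedEdge.supp_map] at hs
      have := hs ⟨x, hx, rfl⟩
      rwa [collapse_of_notMem hxW] at this
  · have hE : E = GainedEdge.map (collapse W v) ''
        {e ∈ G.edges \ F | e.map (collapse W v) ∈ E} := by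
      ext e
      constructor
      · intro he
        obtain ⟨e', he', rfl⟩ := h.edges he
        exact ⟨e', ⟨he', he⟩, rfl⟩
      · rintro ⟨e', he', rfl⟩
        exact he'.2
    have hc : E.ncard = {e ∈ G.edges \ F | e.map (collapse W v) ∈ E}.ncard := by
      conv_lhs => rw [hE]
      exact (hinj.mono (Set.sep_subset _ _)).ncard_image
    have hd : Disjoint V W := Set.disjoint_left.2 fun x hx => (h.verts hx).2
    rw [surplus, surplus, ← hc, Set.ncard_union_eq hd h.finite_verts (G.verts_finite.subset hW)]
    push_cast
    ring

theorem surplus_contract (hW : W ⊆ G.verts)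
    (hinj : Set.InjOn (GainedEdge.map (collapse W v)) (G.edges \ F)) (hF : F ⊆ G.edges) :
    surplus (G.contract W v F hv hvW hloop).verts (G.contract W v F hv hvW hloop).edges =
      surplus G.verts G.edges - 2 * W.ncard + F.ncard := by
  have h1 := Set.ncard_sdiff_add_ncard_of_subset hW G.verts_finite
  have h2 := Set.ncard_sdiff_add_ncard_of_subset hF G.edges_finite
  have h3 : (G.contract W v F hv hvW hloop).edges.ncard = (G.edges \ F).ncard := hinj.ncard_image
  have h4 : (G.contract W v F hv hvW hloop).verts.ncard = (G.verts \ W).ncard := rfl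
  rw [surplus, surplus, h3, h4]
  omega

/-- The lift of the edges of a contraction. -/
theorem exists_lift (hW : ∀ p q k, gedge p q k ∈ G.edges \ F → p ∈ W → q ∉ W)
    (hinj : Set.InjOn (GainedEdge.map (collapse W v)) (G.edges \ F)) :
    ∃ f : GainedEdge α Γ → GainedEdge α Γ,
      (∀ e ∈ G.edges \ F, f (e.map (collapse W v)) = e) ∧
      ∀ e ∈ (G.contract W v F hv hvW hloop).edges, f e = e ∨
        ∃ x k, ∃ y ∈ W, e = gedge v x k ∧ f e = gedge y x k := by
  classical
  refine ⟨fun e => if h : ∃ e' ∈ G.edges \ F, e'.map (collapse W v) = e then h.choose else e,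
    ?_, ?_⟩
  · intro e he
    have h : ∃ e' ∈ G.edges \ F, e'.map (collapse W v) = e.map (collapse W v) := ⟨e, he, rfl⟩
    beta_reduce
    rw [dif_pos h]
    exact hinj h.choose_spec.1 he h.choose_spec.2
  · intro e he
    have h : ∃ e' ∈ G.edges \ F, e'.map (collapse W v) = e := he
    beta_reduce
    rw [dif_pos h]
    obtain ⟨he', heq⟩ := h.choose_spec
    set e' := h.choose
    by_cases hs : ∃ y ∈ e'.supp, y ∈ W
    · obtain ⟨y, hy, hyW⟩ := hs
      obtain ⟨x, k, hx⟩ := GainedEdge.exists_eq_gedge_of_mem hy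
      right
      refine ⟨x, k, y, hyW, ?_, hx⟩
      rw [hx] at he'
      -- Only one end was moved, since no remaining edge has both ends in `W`. This is what makes
      -- the lift a legal replacement in the moves, which rewrite a single end.
      rw [← heq, hx, GainedEdge.map_gedge, collapse_of_mem hyW,
        collapse_of_notMem (hW y x k he' hyW)]
    · left
      push Not at hs
      rw [← heq, GainedEdge.map_eq_self fun x hx => collapse_of_notMem (hs x hx)]

end Contract

/-! ### Undoing the vertex-to-K_4 and edge-to-K_3 moves -/

/-- Contracting a `K_4` with trivial gains. -/
theorem SignTight.exists_vertexToK4 (hG : G.SignTight χ) {v₁ w₂ w₃ w₄ : α} (h12 : v₁ ≠ w₂)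
    (h13 : v₁ ≠ w₃) (h14 : v₁ ≠ w₄) (h23 : w₂ ≠ w₃) (h24 : w₂ ≠ w₄) (h34 : w₃ ≠ w₄)
    (hK : k4Edges Γ v₁ w₂ w₃ w₄ ⊆ G.edges)
    (hmax : ∀ x ∉ ({v₁, w₂, w₃, w₄} : Set α), ∀ p ∈ ({v₁, w₂, w₃, w₄} : Set α),
      ∀ q ∈ ({v₁, w₂, w₃, w₄} : Set α), ∀ k, gedge x p k ∈ G.edges → gedge x q k ∈ G.edges → p = q)
    (hextra : ∀ e ∈ G.edges \ k4Edges Γ v₁ w₂ w₃ w₄, e.supp ⊆ {v₁, w₂, w₃, w₄} → v₁ ∈ e.supp) :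
    ∃ G₁ : GainGraph α Γ, G₁.SignTight χ ∧ G₁.verts.ncard < G.verts.ncard ∧ VertexToK4 G₁ G := by
  set W : Set α := {w₂, w₃, w₄} with hWdef
  set F := k4Edges Γ v₁ w₂ w₃ w₄ with hFdef
  have hvW : v₁ ∉ W := by simp [hWdef, h12, h13, h14]
  have hv : v₁ ∈ G.verts := (G.ends_mem v₁ w₂ 1 (hK (by simp [hFdef, k4Edges]))).1
  have hWG : W ⊆ G.verts := by
    rintro x (rfl | rfl | rfl)
    · exact (G.ends_mem v₁ x 1 (hK (by simp [hFdef, k4Edges]))).2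
    · exact (G.ends_mem v₁ x 1 (hK (by simp [hFdef, k4Edges]))).2
    · exact (G.ends_mem v₁ x 1 (hK (by simp [hFdef, k4Edges]))).2
  have hWc : W.ncard = 3 := Set.ncard_eq_three.2 ⟨_, _, _, h23, h24, h34, rfl⟩
  have hFc : F.ncard = 6 := ncard_k4Edges h12 h13 h14 h23 h24 h34
  have hFs : ∀ e ∈ F, e.supp ⊆ insert v₁ W := by
    rintro e (rfl | rfl | rfl | rfl | rfl | rfl) x (rfl | rfl) <;> simp [hWdef]
  have hFφ : ∀ φ : α → ℤˣ, (∀ x ∈ insert v₁ W, φ x = φ v₁) → ∀ e ∈ F, e.Compat χ φ := by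
    intro φ hφ e he
    have hs := hFs e he
    have : ∃ a b, e = gedge a b 1 := by
      rcases he with rfl | rfl | rfl | rfl | rfl | rfl <;> exact ⟨_, _, rfl⟩
    obtain ⟨a, b, rfl⟩ := this
    rw [GainedEdge.compat_gedge, hφ a (hs (by simp)), hφ b (hs (by simp)), Int.units_mul_self,
      map_one]
  have sK : G.IsSub (insert v₁ W) F := ⟨Set.insert_subset hv hWG, hK, hFs⟩
  have surK : surplus (insert v₁ W) F = 2 := by
    rw [surplus, Set.ncard_insert_of_notMem hvW (Set.toFinite _), hWc, hFc]
    norm_num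
  -- The `K_4` has surplus 2, so two further edges on its vertices would bring it to 0.
  have uniq : ∀ p q k p' q' k', gedge p q k ∈ G.edges \ F → gedge p' q' k' ∈ G.edges \ F →
      p ∈ insert v₁ W → q ∈ insert v₁ W → p' ∈ insert v₁ W → q' ∈ insert v₁ W →
      gedge p q k = gedge p' q' k' := by
    intro p q k p' q' k' m m' hp hq hp' hq'
    by_contra hne
    have s1 := sK.insert_edge m.1 hp hq
    have s2 := s1.insert_edge m'.1 hp' hq'
    have := hG.one_le _ _ s2 ⟨v₁, Or.inl rfl⟩
    rw [s1.surplus_insert_edge, sK.surplus_insert_edge m.2, surK] at this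
    · omega
    · rintro (h | h)
      · exact hne h.symm
      · exact m'.2 h
  have hinj : Set.InjOn (GainedEdge.map (collapse W v₁)) (G.edges \ F) := by
    have key : ∀ p q p' q' k, gedge p q k ∈ G.edges \ F → gedge p' q' k ∈ G.edges \ F →
        collapse W v₁ p = collapse W v₁ p' → collapse W v₁ q = collapse W v₁ q' →
        gedge p q k = gedge p' q' k := by
      have one : ∀ p q p' k, gedge p q k ∈ G.edges \ F → gedge p' q k ∈ G.edges \ F →
          p ∈ insert v₁ W → p' ∈ insert v₁ W → gedge p q k = gedge p' q k := by
        intro p q p' k m m' hp hp'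
        by_cases hq : q ∈ insert v₁ W
        · exact uniq _ _ _ _ _ _ m m' hp hq hp' hq
        · have m1 := m.1
          have m2 := m'.1
          rw [gedge_symm] at m1 m2
          rw [hmax q hq p hp p' hp' _ m1 m2]
      intro p q p' q' k m m' h1 h2
      rcases eq_or_mem_of_collapse_eq h1 with rfl | ⟨hp, hp'⟩
      · rcases eq_or_mem_of_collapse_eq h2 with rfl | ⟨hq, hq'⟩
        · rfl
        · rw [gedge_symm p q, gedge_symm p q'] at *
          exact one _ _ _ _ m m' hq hq'
      · rcases eq_or_mem_of_collapse_eq h2 with rfl | ⟨hq, hq'⟩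
        · exact one _ _ _ _ m m' hp hp'
        · exact uniq _ _ _ _ _ _ m m' hp hq hp' hq'
    intro e he e' he' heq
    obtain ⟨p, q, k, rfl⟩ := e.exists_eq_gedge
    obtain ⟨p', q', k', rfl⟩ := e'.exists_eq_gedge
    rw [GainedEdge.map_gedge, GainedEdge.map_gedge, gedge_eq_iff] at heq
    rcases heq with ⟨h1, h2, rfl⟩ | ⟨h1, h2, rfl⟩
    · exact key _ _ _ _ _ he he' h1 h2
    · rw [gedge_symm p' q'] at he' ⊢
      exact key _ _ _ _ _ he he' h1 h2
  -- A further identity edge on the `K_4` would give surplus 1 with the constant potential.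
  have hloop : ∀ p q, gedge p q 1 ∈ G.edges \ F → collapse W v₁ p ≠ collapse W v₁ q := by
    intro p q m h
    rcases eq_or_mem_of_collapse_eq h with rfl | ⟨hp, hq⟩
    · exact G.loop_gain_ne_one _ _ m.1 rfl
    · have := hG.two_le _ _ 1 (sK.insert_edge m.1 hp hq) ⟨v₁, Or.inl rfl⟩ (by
        rintro e (rfl | he)
        · simp
        · exact hFφ 1 (fun _ _ => rfl) e he)
      rw [sK.surplus_insert_edge m.2, surK] at this
      omega
  have hWW : ∀ p q k, gedge p q k ∈ G.edges \ F → p ∈ W → q ∉ W := by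
    intro p q k m hp hq
    have := hextra _ m (by rintro x (rfl | rfl) <;> exact Or.inr ‹_›)
    rcases this with h | h
    · exact hvW (h ▸ hp)
    · exact hvW (h ▸ hq)
  refine ⟨G.contract W v₁ F hv hvW hloop, ⟨?_, fun V E h hne => ?_, fun V E φ h hne hφ => ?_⟩,
    ?_, ?_⟩
  · rw [surplus_contract hWG hinj hK, hG.total, hWc, hFc]
    norm_num
  · by_cases hV : v₁ ∈ V
    · obtain ⟨D, hD, -, s, hsur, -⟩ := h.expand (χ := χ) hWG hinj
      have hd : Disjoint D F := Set.disjoint_left.2 fun e he => (hD he).2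
      -- Restoring the `K_4` adds three vertices and six edges, so the surplus is unchanged.
      have s' : G.IsSub (V ∪ W) (D ∪ F) := by
        have hsub : insert v₁ W ⊆ V ∪ W :=
          Set.insert_subset (Set.mem_union_left _ hV) Set.subset_union_right
        have := s.union sK
        rwa [Set.union_eq_left.2 hsub] at this
      have := hG.one_le _ _ s' ⟨v₁, Or.inl hV⟩
      rw [surplus, Set.ncard_union_eq hd s.finite_edges sK.finite_edges, hFc] at this
      rw [surplus, hWc] at hsur
      push_cast at this hsur
      omega
    · exact hG.one_le _ _ (h.of_contract hV) hne
  · by_cases hV : v₁ ∈ V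
    · obtain ⟨D, hD, -, s, hsur, hcomp⟩ := h.expand (χ := χ) hWG hinj
      have hd : Disjoint D F := Set.disjoint_left.2 fun e he => (hD he).2
      have s' : G.IsSub (V ∪ W) (D ∪ F) := by
        have hsub : insert v₁ W ⊆ V ∪ W :=
          Set.insert_subset (Set.mem_union_left _ hV) Set.subset_union_right
        have := s.union sK
        rwa [Set.union_eq_left.2 hsub] at this
      have := hG.two_le _ _ (φ ∘ collapse W v₁) s' ⟨v₁, Or.inl hV⟩ (by
        rintro e (he | he)
        · exact hcomp φ hφ e he
        · refine hFφ _ ?_ e he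
          rintro x (rfl | hx)
          · rfl
          · rw [Function.comp_apply, Function.comp_apply, collapse_of_mem hx,
              collapse_of_notMem hvW])
      rw [surplus, Set.ncard_union_eq hd s.finite_edges sK.finite_edges, hFc] at this
      rw [surplus, hWc] at hsur
      push_cast at this hsur
      omega
    · exact hG.two_le _ _ φ (h.of_contract hV) hne hφ
  · have h1 := Set.ncard_sdiff_add_ncard_of_subset hWG G.verts_finite
    change (G.verts \ W).ncard < _
    omega
  · obtain ⟨f, hf1, hf2⟩ := exists_lift (hv := hv) (hvW := hvW) (hloop := hloop) hWW hinj
    refine ⟨v₁, w₂, w₃, w₄, f, ⟨hv, hvW⟩, fun h => h.2 (by simp [hWdef]),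
      fun h => h.2 (by simp [hWdef]), fun h => h.2 (by simp [hWdef]), h23, h24, h34, ?_, ?_, ?_⟩
    · intro e he
      refine (hf2 e he).imp_right ?_
      rintro ⟨x, k, y, hy, h1, h2⟩
      exact ⟨x, k, y, h1, hy, h2⟩
    · exact (Set.sdiff_union_of_subset hWG).symm
    · change G.edges = f '' (GainedEdge.map (collapse W v₁) '' (G.edges \ F)) ∪ F
      rw [Set.image_image, Set.image_congr hf1, Set.image_id', Set.sdiff_union_of_subset hK]

/-- Contracting an edge of a triangle. -/
theorem SignTight.exists_edgeToK3 (hG : G.SignTight χ) {v₀ v₁ v₂ : α} (h01 : v₀ ≠ v₁)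
    (h02 : v₀ ≠ v₂) (h12 : v₁ ≠ v₂) (ma : gedge v₀ v₁ 1 ∈ G.edges) (mb : gedge v₀ v₂ 1 ∈ G.edges)
    (me : gedge v₁ v₂ 1 ∈ G.edges) (hnl : ∀ l, gedge v₀ v₀ l ∉ G.edges)
    (hcommon : ∀ y k, gedge v₀ y k ∈ G.edges → gedge v₁ y k ∈ G.edges → y = v₂ ∧ k = 1)
    (hcrit : ∀ V E, G.IsSub V E → v₂ ∉ V → gedge v₀ v₁ 1 ∈ E → 2 ≤ surplus V E ∧
      ∀ φ : α → ℤˣ, (∀ e ∈ E, e.Compat χ φ) → 3 ≤ surplus V E) :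
    ∃ G₁ : GainGraph α Γ, G₁.SignTight χ ∧ G₁.verts.ncard < G.verts.ncard ∧ EdgeToK3 G₁ G := by
  set W : Set α := {v₀} with hWdef
  set F : Set (GainedEdge α Γ) := {gedge v₀ v₁ 1, gedge v₀ v₂ 1} with hFdef
  have hvW : v₁ ∉ W := fun h => h01 h.symm
  have hv₂W : v₂ ∉ W := fun h => h02 h.symm
  obtain ⟨hv₀, hv⟩ := G.ends_mem _ _ _ ma
  have hv₂ := (G.ends_mem _ _ _ me).2
  have hWG : W ⊆ G.verts := by simpa [hWdef] using hv₀
  have hWc : W.ncard = 1 := Set.ncard_singleton _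
  have hab : gedge v₀ v₁ (1 : Γ) ≠ gedge v₀ v₂ 1 := by
    intro h
    rcases gedge_eq_iff.1 h with ⟨-, h, -⟩ | ⟨h, -, -⟩
    exacts [h12 h, h02 h]
  have hFc : F.ncard = 2 := Set.ncard_pair hab
  have hFG : F ⊆ G.edges := by rintro e (rfl | rfl) <;> assumption
  have meF : gedge v₁ v₂ 1 ∉ F := by
    rintro (h | h) <;> rcases gedge_eq_iff.1 h with ⟨h, h', -⟩ | ⟨h, h', -⟩
    exacts [h01 h.symm, h02 h'.symm, h01 h.symm, h12 h]
  have hpair : ∀ {x y}, collapse W v₁ x = collapse W v₁ y → x ≠ y →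
      x = v₀ ∧ y = v₁ ∨ x = v₁ ∧ y = v₀ := by
    intro x y h hne
    rcases eq_or_mem_of_collapse_eq h with h | ⟨hx | hx, hy | hy⟩
    · exact absurd h hne
    · exact absurd (hx.trans hy.symm) hne
    · exact Or.inr ⟨hx, hy⟩
    · exact Or.inl ⟨hx, hy⟩
    · exact absurd ((show x = v₀ from hx).trans (show y = v₀ from hy).symm) hne
  have hinj : Set.InjOn (GainedEdge.map (collapse W v₁)) (G.edges \ F) := by
    have one : ∀ p q p' k, gedge p q k ∈ G.edges \ F → gedge p' q k ∈ G.edges \ F →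
        collapse W v₁ p = collapse W v₁ p' → gedge p q k = gedge p' q k := by
      intro p q p' k m m' hp
      by_contra hne
      have hpp : p ≠ p' := by rintro rfl; exact hne rfl
      rcases hpair hp hpp with ⟨rfl, rfl⟩ | ⟨rfl, rfl⟩
      · obtain ⟨rfl, rfl⟩ := hcommon q k m.1 m'.1
        exact m.2 (Or.inr rfl)
      · obtain ⟨rfl, rfl⟩ := hcommon q k m'.1 m.1
        exact m'.2 (Or.inr rfl)
    -- These two edges would contract to the same loop. With the identity edge they give surplus 1
    -- on `{v₀, v₁}`, contrary to `hcrit`.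
    have two : ∀ k, gedge v₀ v₁ k ∈ G.edges \ F → gedge v₁ v₀ k ∈ G.edges \ F →
        gedge v₀ v₁ k = gedge v₁ v₀ k := by
      intro k m m'
      by_contra hne
      have s0 : G.IsSub {v₀, v₁} {gedge v₀ v₁ 1} :=
        ⟨by rintro x (rfl | rfl) <;> assumption, by simpa, by simp⟩
      have s1 := s0.insert_edge m.1 (by simp) (by simp)
      have s2 := s1.insert_edge m'.1 (by simp) (by simp)
      have := (hcrit _ _ s2 (by simp [h02.symm, h12.symm]) (by simp)).1
      rw [s1.surplus_insert_edge, s0.surplus_insert_edge, surplus, Set.ncard_pair h01,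
        Set.ncard_singleton] at this
      · norm_num at this
      · exact fun h => m.2 (Or.inl h)
      · rintro (h | h)
        · exact hne h.symm
        · exact m'.2 (Or.inl h)
    have key : ∀ p q p' q' k, gedge p q k ∈ G.edges \ F → gedge p' q' k ∈ G.edges \ F →
        collapse W v₁ p = collapse W v₁ p' → collapse W v₁ q = collapse W v₁ q' →
        gedge p q k = gedge p' q' k := by
      intro p q p' q' k m m' h1 h2
      by_cases hq : q = q'
      · subst hq
        exact one _ _ _ _ m m' h1
      · by_cases hp : p = p'
        · subst hp
          rw [gedge_symm p q, gedge_symm p q'] at *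
          exact one _ _ _ _ m m' h2
        · rcases hpair h1 hp with ⟨rfl, rfl⟩ | ⟨rfl, rfl⟩ <;>
            rcases hpair h2 hq with ⟨rfl, rfl⟩ | ⟨rfl, rfl⟩
          · exact absurd m.1 (hnl k)
          · exact two k m m'
          · exact (two k m' m).symm
          · exact absurd m'.1 (hnl k)
    intro e he e' he' heq
    obtain ⟨p, q, k, rfl⟩ := e.exists_eq_gedge
    obtain ⟨p', q', k', rfl⟩ := e'.exists_eq_gedge
    rw [GainedEdge.map_gedge, GainedEdge.map_gedge, gedge_eq_iff] at heq
    rcases heq with ⟨h1, h2, rfl⟩ | ⟨h1, h2, rfl⟩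
    · exact key _ _ _ _ _ he he' h1 h2
    · rw [gedge_symm p' q'] at he' ⊢
      exact key _ _ _ _ _ he he' h1 h2
  have hloop : ∀ p q, gedge p q 1 ∈ G.edges \ F → collapse W v₁ p ≠ collapse W v₁ q := by
    intro p q m h
    have hpq : p ≠ q := by rintro rfl; exact G.loop_gain_ne_one _ _ m.1 rfl
    rcases hpair h hpq with ⟨rfl, rfl⟩ | ⟨rfl, rfl⟩
    · exact m.2 (Or.inl rfl)
    · exact m.2 (Or.inl (by rw [gedge_symm, inv_one]))
  have hWW : ∀ p q k, gedge p q k ∈ G.edges \ F → p ∈ W → q ∉ W := by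
    intro p q k m hp hq
    obtain rfl : p = v₀ := hp
    obtain rfl : q = p := hq
    exact hnl k m.1
  have hme : (gedge v₁ v₂ (1 : Γ)).map (collapse W v₁) = gedge v₁ v₂ 1 := by
    rw [GainedEdge.map_gedge, collapse_of_notMem hvW, collapse_of_notMem hv₂W]
  refine ⟨G.contract W v₁ F hv hvW hloop, ⟨?_, fun V E h hne => ?_, fun V E φ h hne hφ => ?_⟩,
    ?_, ?_⟩
  · rw [surplus_contract hWG hinj hFG, hG.total, hWc, hFc]
    norm_num
  · by_cases hV : v₁ ∈ V
    · obtain ⟨D, hD, -, s, hsur, -⟩ := h.expand (χ := χ) hWG hinj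
      have s1 := s.insert_edge ma (Or.inr rfl) (Or.inl hV)
      have na : gedge v₀ v₁ 1 ∉ D := fun h' => (hD h').2 (Or.inl rfl)
      have nb : gedge v₀ v₂ 1 ∉ D := fun h' => (hD h').2 (Or.inr rfl)
      have e1 := s.surplus_insert_edge na
      by_cases hV2 : v₂ ∈ V
      · have s2 := s1.insert_edge mb (Or.inr rfl) (Or.inl hV2)
        have e2 := s1.surplus_insert_edge (e := gedge v₀ v₂ 1) (by
          rintro (h' | h')
          exacts [hab h'.symm, nb h'])
        have := hG.one_le _ _ s2 ⟨v₁, Or.inl hV⟩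
        omega
      -- Without `v₂`, only one edge returns with the vertex `v₀`, so the surplus rises by 1;
      -- `hcrit` supplies that unit.
      · have := (hcrit _ _ s1 (by rintro (h' | h') <;> contradiction) (Or.inl rfl)).1
        omega
    · exact hG.one_le _ _ (h.of_contract hV) hne
  · by_cases hV : v₁ ∈ V
    · obtain ⟨D, hD, hDeq, s, hsur, hcomp⟩ := h.expand (χ := χ) hWG hinj
      have s1 := s.insert_edge ma (Or.inr rfl) (Or.inl hV)
      have na : gedge v₀ v₁ 1 ∉ D := fun h' => (hD h').2 (Or.inl rfl)
      have nb : gedge v₀ v₂ 1 ∉ D := fun h' => (hD h').2 (Or.inr rfl)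
      have e1 := s.surplus_insert_edge na
      have c1 : ∀ e ∈ insert (gedge v₀ v₁ 1) D, e.Compat χ (φ ∘ collapse W v₁) := by
        rintro e (rfl | he)
        · rw [GainedEdge.compat_gedge, Function.comp_apply, Function.comp_apply,
            collapse_of_notMem hvW, collapse_of_mem (show v₀ ∈ W from rfl), Int.units_mul_self,
            map_one]
        · exact hcomp φ hφ e he
      by_cases hV2 : v₂ ∈ V
      · have s2 := s1.insert_edge mb (Or.inr rfl) (Or.inl hV2)
        have e2 := s1.surplus_insert_edge (e := gedge v₀ v₂ 1) (by
          rintro (h' | h')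
          exacts [hab h'.symm, nb h'])
        by_cases hφ12 : 1 = φ v₁ * φ v₂
        · have := hG.two_le _ _ (φ ∘ collapse W v₁) s2 ⟨v₁, Or.inl hV⟩ (by
            rintro e (rfl | he)
            · rw [GainedEdge.compat_gedge, Function.comp_apply, Function.comp_apply,
                collapse_of_notMem hv₂W, collapse_of_mem (show v₀ ∈ W from rfl), map_one, hφ12]
            · exact c1 e he)
          omega
        -- The potential conflicts with the identity edge `v₁v₂`, so that edge is absent from the
        -- subgraph and can be added; the plain bound 1 then yields 2.
        · have s3 := s2.insert_edge me (Or.inl hV) (Or.inl hV2)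
          have e3 := s2.surplus_insert_edge (e := gedge v₁ v₂ 1) (by
            rintro (h' | h' | h')
            · exact meF (Or.inr h')
            · exact meF (Or.inl h')
            · rw [hDeq] at h'
              have := h'.2
              rw [hme] at this
              have := GainedEdge.compat_gedge.1 (hφ _ this)
              rw [map_one] at this
              exact hφ12 this)
          have := hG.one_le _ _ s3 ⟨v₁, Or.inl hV⟩
          omega
      · have := (hcrit _ _ s1 (by rintro (h' | h') <;> contradiction) (Or.inl rfl)).2 _ c1
        omega
    · exact hG.two_le _ _ φ (h.of_contract hV) hne hφ
  · have h1 := Set.ncard_sdiff_add_ncard_of_subset hWG G.verts_finite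
    change (G.verts \ W).ncard < _
    omega
  · obtain ⟨f, hf1, hf2⟩ := exists_lift (hv := hv) (hvW := hvW) (hloop := hloop) hWW hinj
    have hfe : f (gedge v₁ v₂ 1) = gedge v₁ v₂ 1 := by
      have := hf1 _ ⟨me, meF⟩
      rwa [hme] at this
    have himg : f '' (G.contract W v₁ F hv hvW hloop).edges = G.edges \ F := by
      change f '' (GainedEdge.map (collapse W v₁) '' (G.edges \ F)) = _
      rw [Set.image_image, Set.image_congr hf1, Set.image_id']
    have hmem : gedge v₁ v₂ 1 ∈ (G.contract W v₁ F hv hvW hloop).edges :=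
      ⟨_, ⟨me, meF⟩, hme⟩
    refine ⟨v₀, v₁, v₂, 1, 1, 1, f, fun h => h.2 rfl, h12, hmem, by simp, ?_,
      (insert_sdiff_vertex hv₀).symm, ?_⟩
    · intro e he
      refine (hf2 e he.1).imp_right ?_
      rintro ⟨x, k, y, hy, h1, h2⟩
      exact ⟨x, k, h1, by rwa [one_mul, ← show y = v₀ from hy]⟩
    · ext e
      constructor
      · intro he
        by_cases heF : e ∈ F
        · exact Or.inr (Or.inr heF)
        · have : e ∈ f '' (G.contract W v₁ F hv hvW hloop).edges := himg ▸ ⟨he, heF⟩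
          obtain ⟨e', he', rfl⟩ := this
          by_cases h' : e' = gedge v₁ v₂ 1
          · subst h'
            exact Or.inr (Or.inl hfe)
          · exact Or.inl ⟨e', ⟨he', h'⟩, rfl⟩
      · rintro (⟨e', he', rfl⟩ | rfl | he)
        · have : f e' ∈ f '' (G.contract W v₁ F hv hvW hloop).edges := ⟨e', he'.1, rfl⟩
          rw [himg] at this
          exact this.1
        · exact me
        · exact hFG he

end GainGraph

namespace GainGraph

variable {α : Type*} {Γ : Type*} [Group Γ] {χ : Γ →* ℤˣ} {G G' : GainGraph α Γ}

/-! ### Triangle sequences -/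

/-- Graphs with trivial gains obtained from a `K_4` by successively joining a new vertex to both
ends of an edge. -/
inductive TriangleSeq : Set α → Set (GainedEdge α Γ) → Prop
  | k4 {v₁ w₂ w₃ w₄ : α} (h12 : v₁ ≠ w₂) (h13 : v₁ ≠ w₃) (h14 : v₁ ≠ w₄) (h23 : w₂ ≠ w₃)
      (h24 : w₂ ≠ w₄) (h34 : w₃ ≠ w₄) : TriangleSeq {v₁, w₂, w₃, w₄} (k4Edges Γ v₁ w₂ w₃ w₄)
  | step {V : Set α} {E : Set (GainedEdge α Γ)} {x p q : α} (h : TriangleSeq V E) (hx : x ∉ V)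
      (hpq : p ≠ q) (he : gedge p q 1 ∈ E) :
      TriangleSeq (insert x V) (insert (gedge x p 1) (insert (gedge x q 1) E))

namespace TriangleSeq

variable {V : Set α} {E : Set (GainedEdge α Γ)}

theorem supp (h : TriangleSeq V E) : ∀ e ∈ E, e.supp ⊆ V := by
  induction h with
  | k4 =>
    rintro e (rfl | rfl | rfl | rfl | rfl | rfl) x (rfl | rfl) <;> simp
  | @step V E x p q h hx hpq he ih =>
    have h1 := ih _ he
    rintro e (rfl | rfl | he')
    · rintro y (rfl | rfl)
      exacts [Or.inl rfl, Or.inr (h1 (by simp))]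
    · rintro y (rfl | rfl)
      exacts [Or.inl rfl, Or.inr (h1 (by simp))]
    · exact (ih e he').trans (Set.subset_insert _ _)

theorem isSub (h : TriangleSeq V E) (hE : E ⊆ G.edges) : G.IsSub V E := by
  refine ⟨?_, hE, h.supp⟩
  induction h with
  | k4 =>
    rintro x (rfl | rfl | rfl | rfl)
    · exact (G.ends_mem x _ 1 (hE (Or.inl rfl))).1
    · exact (G.ends_mem _ x 1 (hE (Or.inl rfl))).2
    · exact (G.ends_mem _ x 1 (hE (Or.inr (Or.inl rfl)))).2
    · exact (G.ends_mem _ x 1 (hE (Or.inr (Or.inr (Or.inl rfl))))).2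
  | @step V E x p q h hx hpq he ih =>
    refine Set.insert_subset (G.ends_mem x p 1 (hE (Or.inl rfl))).1 (ih ?_)
    exact fun e he => hE (Or.inr (Or.inr he))

theorem exists_gain_one (h : TriangleSeq V E) : ∀ e ∈ E, ∃ a b, e = gedge a b 1 := by
  induction h with
  | k4 =>
    rintro e (rfl | rfl | rfl | rfl | rfl | rfl) <;> exact ⟨_, _, rfl⟩
  | step h hx hpq he ih =>
    rintro e (rfl | rfl | he')
    exacts [⟨_, _, rfl⟩, ⟨_, _, rfl⟩, ih e he']

theorem compat (h : TriangleSeq V E) (χ : Γ →* ℤˣ) : ∀ e ∈ E, e.Compat χ 1 := by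
  intro e he
  obtain ⟨a, b, rfl⟩ := h.exists_gain_one e he
  simp

theorem gedge_step_ne {x p q : α} (h : TriangleSeq V E) (hx : x ∉ V) (hpq : p ≠ q)
    (he : gedge p q 1 ∈ E) : gedge x p 1 ∉ insert (gedge x q 1) E := by
  rintro (h' | h')
  · rcases gedge_eq_iff.1 h' with ⟨-, h', -⟩ | ⟨-, rfl, -⟩
    · exact hpq h'
    · exact hx (h.supp _ he (by simp))
  · exact hx (h.supp _ h' (by simp))

/-- A `K_4` has surplus 8 - 6, and each later vertex comes with exactly two edges. -/
theorem surplus_eq (h : TriangleSeq V E) (hE : E ⊆ G.edges) : surplus V E = 2 := by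
  induction h with
  | @k4 v₁ w₂ w₃ w₄ h12 h13 h14 h23 h24 h34 =>
    rw [surplus, ncard_k4Edges h12 h13 h14 h23 h24 h34, Set.ncard_insert_of_notMem,
      Set.ncard_eq_three.2 ⟨_, _, _, h23, h24, h34, rfl⟩]
    · norm_num
    · simp [h12, h13, h14]
  | @step V E x p q h hx hpq he ih =>
    have hE' : E ⊆ G.edges := fun e he => hE (Or.inr (Or.inr he))
    have s := h.isSub hE'
    have s0 := s.insert_vertex (G.ends_mem x p 1 (hE (Or.inl rfl))).1
    have s1 := s0.insert_edge (hE (Or.inr (Or.inl rfl))) (Or.inl rfl)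
      (Or.inr (h.supp _ he (by simp)))
    rw [s1.surplus_insert_edge (h.gedge_step_ne hx hpq he),
      s0.surplus_insert_edge (s.notMem_edges hx), s.surplus_insert_vertex hx, ih hE']
    norm_num

end TriangleSeq

theorem gedge_mem_k4Edges {v₁ w₂ w₃ w₄ p q : α} (hp : p ∈ ({v₁, w₂, w₃, w₄} : Set α))
    (hq : q ∈ ({v₁, w₂, w₃, w₄} : Set α)) (hpq : p ≠ q) :
    gedge p q 1 ∈ k4Edges Γ v₁ w₂ w₃ w₄ := by
  have hsymm : ∀ a b : α, gedge a b (1 : Γ) = gedge b a 1 := fun a b => by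
    rw [gedge_symm, inv_one]
  rcases hp with rfl | rfl | rfl | rfl <;> rcases hq with rfl | rfl | rfl | rfl <;>
    first
    | exact absurd rfl hpq
    | (simp [k4Edges]; done)
    | (rw [hsymm]; simp [k4Edges])

theorem k4Edges_swap₂ (a b c d : α) : k4Edges Γ a b c d = k4Edges Γ b a c d := by
  rw [k4Edges, k4Edges, gedge_symm b a, inv_one]
  ext e
  simp only [Set.mem_insert_iff, Set.mem_singleton_iff]
  tauto

theorem k4Edges_swap₃ (a b c d : α) : k4Edges Γ a b c d = k4Edges Γ a c b d := by
  rw [k4Edges, k4Edges, gedge_symm c b, inv_one]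
  ext e
  simp only [Set.mem_insert_iff, Set.mem_singleton_iff]
  tauto

theorem k4Edges_swap₄ (a b c d : α) : k4Edges Γ a b c d = k4Edges Γ a b d c := by
  rw [k4Edges, k4Edges, gedge_symm d c, inv_one]
  ext e
  simp only [Set.mem_insert_iff, Set.mem_singleton_iff]
  tauto

/-- Contracting a `K_4` that is not extendable to a larger triangle sequence. -/
theorem SignTight.exists_vertexToK4_of_maximal (hG : G.SignTight χ) {a b c d : α} (hab : a ≠ b)
    (hac : a ≠ c) (had : a ≠ d) (hbc : b ≠ c) (hbd : b ≠ d) (hcd : c ≠ d)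
    (hK : k4Edges Γ a b c d ⊆ G.edges)
    (hmax : ∀ x ∉ ({a, b, c, d} : Set α), ∀ p ∈ ({a, b, c, d} : Set α),
      ∀ q ∈ ({a, b, c, d} : Set α), ∀ k, gedge x p k ∈ G.edges → gedge x q k ∈ G.edges → p = q) :
    ∃ G₁ : GainGraph α Γ, G₁.SignTight χ ∧ G₁.verts.ncard < G.verts.ncard ∧ VertexToK4 G₁ G := by
  have seq : TriangleSeq {a, b, c, d} (k4Edges Γ a b c d) := .k4 hab hac had hbc hbd hcd
  have s := seq.isSub hK
  have hs2 := seq.surplus_eq hK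
  -- At most one further edge lies on the `K_4`. Contracting to one of its ends ensures that at most
  -- one end of it has to move, and relabelling puts that end first.
  have hy : ∃ y ∈ ({a, b, c, d} : Set α), ∀ e ∈ G.edges \ k4Edges Γ a b c d,
      e.supp ⊆ {a, b, c, d} → y ∈ e.supp := by
    by_cases hex : ∃ e ∈ G.edges \ k4Edges Γ a b c d, e.supp ⊆ {a, b, c, d}
    · obtain ⟨e, he, hes⟩ := hex
      obtain ⟨y, z, g, rfl⟩ := e.exists_eq_gedge
      refine ⟨y, hes (by simp), fun e' he' hes' => ?_⟩
      obtain ⟨y', z', g', rfl⟩ := e'.exists_eq_gedge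
      by_contra hne
      have s1 := s.insert_edge he.1 (hes (by simp)) (hes (by simp))
      have s2 := s1.insert_edge he'.1 (hes' (by simp)) (hes' (by simp))
      have := hG.one_le _ _ s2 ⟨a, Or.inl rfl⟩
      rw [s1.surplus_insert_edge, s.surplus_insert_edge he.2, hs2] at this
      · omega
      · rintro (h | h)
        · rw [h] at hne; exact hne (by simp)
        · exact he'.2 h
    · exact ⟨a, Or.inl rfl, fun e he hes => absurd ⟨e, he, hes⟩ hex⟩
  obtain ⟨y, hyK, hy⟩ := hy
  rcases hyK with rfl | rfl | rfl | rfl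
  · exact hG.exists_vertexToK4 hab hac had hbc hbd hcd hK hmax hy
  · have hset : ({a, y, c, d} : Set α) = {y, a, c, d} := Set.insert_comm _ _ _
    rw [k4Edges_swap₂] at hK hy
    rw [hset] at hmax hy
    exact hG.exists_vertexToK4 hab.symm hbc hbd hac had hcd hK hmax hy
  · have hset : ({a, b, y, d} : Set α) = {y, a, b, d} := by
      rw [Set.insert_comm b, Set.insert_comm a]
    rw [k4Edges_swap₃, k4Edges_swap₂] at hK hy
    rw [hset] at hmax hy
    exact hG.exists_vertexToK4 hac.symm hbc.symm hcd hab had hbd hK hmax hy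
  · have hset : ({a, b, c, y} : Set α) = {y, a, b, c} := by
      rw [Set.pair_comm c, Set.insert_comm b, Set.insert_comm a]
    rw [k4Edges_swap₄, k4Edges_swap₃, k4Edges_swap₂] at hK hy
    rw [hset] at hmax hy
    exact hG.exists_vertexToK4 had.symm hbd.symm hcd.symm hab hac hbc hK hmax hy

/-- Contracting an edge at the last vertex of a maximal triangle sequence. -/
theorem SignTight.exists_edgeToK3_of_maximal (hG : G.SignTight χ) {V : Set α}
    {E : Set (GainedEdge α Γ)} (seq : TriangleSeq V E) (hE : E ⊆ G.edges) {x p q : α} (hx : x ∉ V)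
    (hpq : p ≠ q) (he : gedge p q 1 ∈ E) (mp : gedge x p 1 ∈ G.edges) (mq : gedge x q 1 ∈ G.edges)
    (hmax : ∀ y ∉ insert x V, ∀ k, gedge y x k ∈ G.edges → gedge y p k ∈ G.edges → False) :
    ∃ G₁ : GainGraph α Γ, G₁.SignTight χ ∧ G₁.verts.ncard < G.verts.ncard ∧ EdgeToK3 G₁ G := by
  have s := seq.isSub hE
  obtain ⟨hp, hq⟩ := s.mem_of_gedge he
  have hxp : x ≠ p := by rintro rfl; exact hx hp
  have hxq : x ≠ q := by rintro rfl; exact hx hq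
  have seq' := TriangleSeq.step seq hx hpq he
  have hE' : insert (gedge x p 1) (insert (gedge x q 1) E) ⊆ G.edges :=
    Set.insert_subset mp (Set.insert_subset mq hE)
  have s' := seq'.isSub hE'
  have sur := seq.surplus_eq hE
  have sur' := seq'.surplus_eq hE'
  -- For `y` outside the sequence this is maximality. For `y` inside, `(x, y; k)` is an extra edge:
  -- if `(p, y; k)` is in the sequence then `k = 1` and the surplus is 1 with constant potential,
  -- and otherwise both edges are extra and the surplus is 0.
  have hcommon : ∀ y k, gedge x y k ∈ G.edges → gedge p y k ∈ G.edges → y = q ∧ k = 1 := by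
    intro y k m1 m2
    by_contra hcon
    have npy : gedge x y k ≠ gedge p y k := by
      intro h
      rcases gedge_eq_iff.1 h with ⟨h, -, -⟩ | ⟨h1, h2, -⟩
      · exact hxp h
      · exact hxp (h1.trans h2)
    have nxy : gedge x y k ∉ insert (gedge x p 1) (insert (gedge x q 1) E) := by
      rintro (h | h | h)
      · rcases gedge_eq_iff.1 h with ⟨-, rfl, rfl⟩ | ⟨h, -, -⟩
        · exact G.loop_gain_ne_one _ _ m2 rfl
        · exact hxp h
      · rcases gedge_eq_iff.1 h with ⟨-, h1, h2⟩ | ⟨h, -, -⟩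
        · exact hcon ⟨h1, h2⟩
        · exact hxq h
      · exact s.notMem_edges hx h
    by_cases hy : y ∈ insert x V
    · have s1 := s'.insert_edge m1 (Or.inl rfl) hy
      have e1 := s'.surplus_insert_edge nxy
      by_cases hm : gedge p y k ∈ insert (gedge x p 1) (insert (gedge x q 1) E)
      · have hk : k = 1 := by
          obtain ⟨_, _, h⟩ := seq'.exists_gain_one _ hm
          rcases gedge_eq_iff.1 h with ⟨-, -, h⟩ | ⟨-, -, h⟩ <;> simpa using h
        subst hk
        have := hG.two_le _ _ 1 s1 ⟨x, Or.inl rfl⟩ (by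
          rintro e (rfl | h)
          · simp
          · exact seq'.compat χ e h)
        omega
      · have s2 := s1.insert_edge m2 (Or.inr hp) hy
        have := hG.one_le _ _ s2 ⟨x, Or.inl rfl⟩
        rw [s1.surplus_insert_edge] at this
        · omega
        · rintro (h | h)
          exacts [npy h.symm, hm h]
    · rw [gedge_symm] at m1 m2
      exact hmax y hy _ m1 m2
  -- Uncross with the sequence before `x` was attached: it has surplus 2, as has at least the
  -- intersection, which contains `p`. The union misses the edge `xq` although it contains both
  -- ends, so it keeps one spare unit.
  have hcrit : ∀ V' E', G.IsSub V' E' → q ∉ V' → gedge x p 1 ∈ E' → 2 ≤ surplus V' E' ∧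
      ∀ φ : α → ℤˣ, (∀ e ∈ E', e.Compat χ φ) → 3 ≤ surplus V' E' := by
    intro V' E' t hqV' hm
    obtain ⟨hxV', hpV'⟩ := t.mem_of_gedge hm
    have hsum := s.surplus_union_add_inter t
    have hI := hG.two_le _ _ 1 (s.inter t) ⟨p, hp, hpV'⟩ fun e he => seq.compat χ e he.1
    have u := s.union t
    have u1 := u.insert_edge mq (Or.inr hxV') (Or.inl hq)
    have eu1 := u.surplus_insert_edge (e := gedge x q 1) (by
      rintro (h | h)
      · exact s.notMem_edges hx h
      · exact hqV' (t.mem_of_gedge h).2)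
    have hU := hG.one_le _ _ u1 ⟨x, Or.inr hxV'⟩
    refine ⟨by omega, fun φ hφ => ?_⟩
    by_contra hcon
    -- The glued potential is constant on the sequence and equal at `x` and `p`, hence also
    -- compatible with `xq`; the union must then have surplus 3.
    obtain ⟨ψ, ε, h1, h2, hψ⟩ := hG.glue s t (seq.compat χ) hφ (by omega)
    have := hG.two_le _ _ ψ u1 ⟨x, Or.inr hxV'⟩ (by
      rintro e (rfl | h)
      · have c := GainedEdge.compat_gedge.1 (hψ _ (Or.inr hm))
        rw [GainedEdge.compat_gedge, c, h1 p hp, h1 q hq]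
        rfl
      · exact hψ e h)
    omega
  -- The contracted vertex must carry no loop. If `x` has one, contract `p` into `x` instead: loops
  -- at both ends would violate `hcrit` on `{x, p}`.
  by_cases hl : ∃ l, gedge x x l ∈ G.edges
  · obtain ⟨l, hl⟩ := hl
    have hsym : gedge x p (1 : Γ) = gedge p x 1 := by rw [gedge_symm, inv_one]
    refine hG.exists_edgeToK3 hxp.symm hpq hxq (hsym ▸ mp) (hE he) mq ?_ ?_ ?_
    · intro l' hl'
      have t0 : G.IsSub {x, p} {gedge x p 1} :=
        ⟨by rintro y (rfl | rfl); exacts [s'.verts (Or.inl rfl), s.verts hp], by simpa, by simp⟩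
      have t1 := t0.insert_edge hl (by simp) (by simp)
      have t2 := t1.insert_edge hl' (by simp) (by simp)
      have := (hcrit _ _ t2 (by simp [hxq.symm, hpq.symm]) (by simp)).1
      rw [t1.surplus_insert_edge, t0.surplus_insert_edge, surplus, Set.ncard_pair hxp,
        Set.ncard_singleton] at this
      · norm_num at this
      · simp [gedge_eq_iff, hxp]
      · simp [gedge_eq_iff, hxp.symm]
    · exact fun y k m1 m2 => hcommon y k m2 m1
    · intro V' E' t hq' hm
      exact hcrit V' E' t hq' (hsym ▸ hm)
  · push Not at hl
    exact hG.exists_edgeToK3 hxp hxq hpq mp mq (hE he) hl hcommon hcrit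

/-- A graph with a triangle sequence can be reduced, after switching. -/
theorem SignTight.exists_reduction_of_triangleSeq (hG : G.SignTight χ) {V : Set α}
    {E : Set (GainedEdge α Γ)} (seq : TriangleSeq V E) (hE : E ⊆ G.edges) :
    ∃ (σ : α → Γ) (G₁ : GainGraph α Γ), G₁.SignTight χ ∧ G₁.verts.ncard < G.verts.ncard ∧
      (VertexToK4 G₁ (G.switchBy σ) ∨ EdgeToK3 G₁ (G.switchBy σ)) := by
  classical
  -- The maximum is taken over all switchings at once, so that extending the sequence may involve
  -- switching again.
  let P : ℕ → Prop := fun n => ∃ (σ : α → Γ) (V : Set α) (E : Set (GainedEdge α Γ)),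
    TriangleSeq V E ∧ E ⊆ (G.switchBy σ).edges ∧ V.ncard = n
  have hbound : ∀ n, P n → n ≤ G.verts.ncard := by
    rintro n ⟨σ, V, E, h, hE, rfl⟩
    exact Set.ncard_le_ncard (h.isSub hE).verts G.verts_finite
  have hP : P V.ncard := ⟨1, V, E, seq, by rwa [switchBy_one], rfl⟩
  clear seq hE
  obtain ⟨σ, V, E, seq, hE, hcard⟩ : P (Nat.findGreatest P G.verts.ncard) :=
    Nat.findGreatest_spec (hbound _ hP) hP
  have hmax : ∀ τ V' E', TriangleSeq V' E' → E' ⊆ (G.switchBy τ).edges →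
      V'.ncard ≤ V.ncard := by
    intro τ V' E' h h'
    have hP' : P V'.ncard := ⟨τ, V', E', h, h', rfl⟩
    rw [hcard]
    exact Nat.le_findGreatest (hbound _ hP') hP'
  have hG' := hG.switchBy σ
  have s := seq.isSub hE
  -- Switching at `y` by `k⁻¹` trivialises both gains and leaves the sequence untouched, so `y`
  -- could be attached.
  have hext : ∀ y ∉ V, ∀ p q k, p ≠ q → gedge p q 1 ∈ E → gedge y p k ∈ (G.switchBy σ).edges →
      gedge y q k ∈ (G.switchBy σ).edges → False := by
    intro y hy p q k hpq he m1 m2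
    let τ : α → Γ := fun x => if x = y then k⁻¹ else 1
    obtain ⟨hp, hq⟩ := s.mem_of_gedge he
    have hτ : ∀ x ∈ V, τ x = 1 := by
      intro x hx
      have : x ≠ y := by rintro rfl; exact hy hx
      simp [τ, this]
    have hτy : τ y = k⁻¹ := by simp [τ]
    have := hmax (τ * σ) _ _ (seq.step hy hpq he) (by
      rw [← switchBy_switchBy]
      rintro e (rfl | rfl | h)
      · have := (mem_switchBy (σ := τ)).2 m1
        simpa [hτ p hp, hτy] using this
      · have := (mem_switchBy (σ := τ)).2 m2
        simpa [hτ q hq, hτy] using this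
      · obtain ⟨a, b, g, rfl⟩ := e.exists_eq_gedge
        obtain ⟨ha, hb⟩ := s.mem_of_gedge h
        have := (mem_switchBy (σ := τ)).2 (hE h)
        simpa [hτ a ha, hτ b hb] using this)
    rw [Set.ncard_insert_of_notMem hy s.finite_verts] at this
    omega
  clear hmax hcard
  refine ⟨σ, ?_⟩
  cases seq with
  | k4 h12 h13 h14 h23 h24 h34 =>
    obtain ⟨G₁, t, hc, h⟩ := hG'.exists_vertexToK4_of_maximal h12 h13 h14 h23 h24 h34 hE (by
      intro x hx p hp q hq k m1 m2
      by_contra hpq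
      exact hext x hx p q k hpq (gedge_mem_k4Edges hp hq hpq) m1 m2)
    exact ⟨G₁, t, hc, Or.inl h⟩
  | @step V E x p q seq hx hpq he =>
    have hxp : x ≠ p := by rintro rfl; exact hx (seq.supp _ he (by simp))
    obtain ⟨G₁, t, hc, h⟩ := hG'.exists_edgeToK3_of_maximal seq
      (fun e he => hE (Or.inr (Or.inr he))) hx hpq he (hE (Or.inl rfl)) (hE (Or.inr (Or.inl rfl)))
      (fun y hy k m1 m2 => hext y hy x p k hxp (Or.inl rfl) m1 m2)
    exact ⟨G₁, t, hc, Or.inr h⟩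

/-! ### The construction theorem -/

theorem Step.signTight {G G' : GainGraph α ZReflective} (h : Step G G')
    (hG : G.SignTight SemidirectProduct.rightHom) :
    G'.SignTight SemidirectProduct.rightHom := by
  rcases h with h | h | h | h | h | h
  exacts [h.signTight hG, h.signTight hG, h.signTight hG, h.signTight hG, h.signTight hG,
    h.signTight hG]

theorem reflTransGen_step_of_switchBy (G : GainGraph α ZReflective) (σ : α → ZReflective) :
    Relation.ReflTransGen Step (G.switchBy σ) G := by
  have h : (G.switchBy σ).switchBy σ⁻¹ = G := by
    rw [switchBy_switchBy, inv_mul_cancel, switchBy_one]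
  have := (G.switchBy σ).reflTransGen_switchBy σ⁻¹
  rw [h] at this
  exact Relation.ReflTransGen.mono
    (fun _ _ h => Or.inr (Or.inr (Or.inr (Or.inr (Or.inr h))))) _ _ this

theorem SignTight.exists_step {G : GainGraph α ZReflective}
    (hG : G.SignTight SemidirectProduct.rightHom) (hcard : 2 ≤ G.verts.ncard) :
    ∃ G₁ : GainGraph α ZReflective, G₁.SignTight SemidirectProduct.rightHom ∧
      G₁.verts.ncard < G.verts.ncard ∧ Relation.ReflTransGen Step G₁ G := by
  classical
  obtain ⟨v, hv, h⟩ := hG.exists_low_degree hcard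
  have hlt : (G.verts \ {v}).ncard < G.verts.ncard :=
    Set.ncard_sdiff_singleton_lt_of_mem hv G.verts_finite
  rcases h with ⟨a, b, g, h, ha, hb, hne, hs⟩ | ⟨a, l, g, ha, hs⟩ | ⟨a, b, c, g, h, k, H, hs⟩
  · exact ⟨G.delete v, hG.delete hv (by rw [hs, Set.ncard_pair hne]), hlt,
      .single (Or.inl (zeroExtension_delete hv ha hb hne hs))⟩
  · have hne : gedge v v l ≠ gedge v a g := by simp [gedge_eq_iff, ha.symm]
    exact ⟨G.delete v, hG.delete hv (by rw [hs, Set.ncard_pair hne]), hlt,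
      .single (Or.inr (Or.inr (Or.inl (loopOneExtension_delete hG hv ha hs))))⟩
  · rcases H.exists_reduction_or hG hs with ⟨G₁, t, hV, h⟩ | ⟨nab, nac, nbc, mab, mac, mbc⟩
    · exact ⟨G₁, t, hV ▸ hlt, .single (Or.inr (Or.inl h))⟩
    -- Switching each neighbour by the gain of its edge from `v` trivialises those three edges and,
    -- with them, the triangle on the neighbours.
    · let σ : α → ZReflective := fun x => if x = a then g else if x = b then h else
        if x = c then k else 1
      have σv : σ v = 1 := by simp [σ, H.ne_a.symm, H.ne_b.symm, H.ne_c.symm]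
      have σa : σ a = g := by simp [σ]
      have σb : σ b = h := by simp [σ, nab.symm]
      have σc : σ c = k := by simp [σ, nac.symm, nbc.symm]
      have hK : k4Edges ZReflective v a b c ⊆ (G.switchBy σ).edges := by
        have key : ∀ {x y l}, gedge x y l ∈ G.edges → σ x * l * (σ y)⁻¹ = 1 →
            gedge x y 1 ∈ (G.switchBy σ).edges := by
          intro x y l m hl
          rw [← hl]
          exact mem_switchBy.2 m
        rintro e (rfl | rfl | rfl | rfl | rfl | rfl)
        · exact key H.mem_a (by rw [σv, σa]; group)
        · exact key H.mem_b (by rw [σv, σb]; group)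
        · exact key H.mem_c (by rw [σv, σc]; group)
        · exact key mab (by rw [σa, σb]; group)
        · exact key mac (by rw [σa, σc]; group)
        · exact key mbc (by rw [σb, σc]; group)
      obtain ⟨τ, G₁, t, hc, h⟩ := (hG.switchBy σ).exists_reduction_of_triangleSeq
        (.k4 H.ne_a.symm H.ne_b.symm H.ne_c.symm nab nac nbc) hK
      -- The move produces the switched graph; undoing the two switchings then leads to `G`.
      refine ⟨G₁, t, hc, Relation.ReflTransGen.head (b := (G.switchBy σ).switchBy τ) ?_
        ((reflTransGen_step_of_switchBy _ τ).trans (reflTransGen_step_of_switchBy _ σ))⟩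
      rcases h with h | h
      · exact Or.inr (Or.inr (Or.inr (Or.inr (Or.inl h))))
      · exact Or.inr (Or.inr (Or.inr (Or.inl h)))

/-- Surplus 1 excludes the empty graph and forces exactly one edge on a single vertex. -/
theorem SignTight.isSingleLoop (hG : G.SignTight χ) (hcard : G.verts.ncard ≤ 1) :
    G.IsSingleLoop := by
  have ht := hG.total
  rw [surplus] at ht
  obtain ⟨v, hv⟩ := Set.ncard_eq_one.1 (show G.verts.ncard = 1 by omega)
  obtain ⟨e, he⟩ := Set.ncard_eq_one.1 (show G.edges.ncard = 1 by omega)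
  obtain ⟨a, b, g, rfl⟩ := e.exists_eq_gedge
  have := G.ends_mem a b g (by rw [he]; rfl)
  rw [hv] at this
  obtain ⟨rfl, rfl⟩ := this
  exact ⟨_, g, hv, he⟩

theorem SignTight.constructible {G : GainGraph α ZReflective}
    (hG : G.SignTight SemidirectProduct.rightHom) : G.Constructible := by
  induction hn : G.verts.ncard using Nat.strong_induction_on generalizing G with
  | _ n ih =>
    by_cases hcard : 2 ≤ G.verts.ncard
    · obtain ⟨G₁, t, hlt, h⟩ := hG.exists_step hcard
      obtain ⟨G₀, h0, h1, h2⟩ := ih _ (hn ▸ hlt) t rfl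
      exact ⟨G₀, h0, h1, h2.trans h⟩
    · exact ⟨G, hG.isSingleLoop (by omega), zReflectiveTight_iff.2 hG, .refl⟩

end GainGraph

theorem theorem9p4 {α : Type*} (G : GainGraph α ZReflective) :
    G.ZReflectiveTight ↔ G.Constructible := by
  constructor
  · exact fun h => (GainGraph.zReflectiveTight_iff.1 h).constructible
  · rintro ⟨G₀, -, h, hsteps⟩
    rw [GainGraph.zReflectiveTight_iff] at h ⊢
    induction hsteps with
    | refl => exact h
    | tail _ hstep ih => exact hstep.signTight ih
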